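/- Let \(N\ge 1\), \(0<s<1\), and let \(\Omega\subset\mathbb R^N\) be a bounded domain with \(C^{0,1}\) boundary. Let \(G:[0,\infty)\to[0,\infty)\) be an \(N\)-function (continuous, convex, \(G(t)=0\iff t=0\), \(G(t)/t\to0\) as \(t\to0\), \(G(t)/t\to\infty\) as \(t\to\infty\)) whose derivative \(g=G'\) is of class \(C^1\) on \([0,\infty)\), and assume: (H1) \(g\) is (locally) absolutely continuous on \([0,\infty)\); (H2) \(g'\) is nondecreasing on \((0,\infty)\); (H3) \(\int_0^1 G^{-1}(\tau)\,\tau^{-\frac{N+s}{N}}\,d\tau<\infty\) and \(\int_1^\infty G^{-1}(\tau)\,\tau^{-\frac{N+s}{N}}\,d\tau=\infty\); (H4) there are real constants \(p^-,p^+\) with \(1<p^--1\le \frac{t g'(t)}{g(t)}\le p^+-1\) for all \(t>0\). Let \(\alpha>0\) and \(0<\beta<p^--1\). Denote by \(\overline A(t)=\sup_{\tau\ge0}(t\tau-A(\tau))\) the complementary function of \(A\), by \(L^A(\Omega)\) the Orlicz space of measurable \(u\) with \(\int_\Omega A(|u|/\lambda)\,dx<\infty\) for some \(\lambda>0\), and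 by \(G_*\) the Sobolev conjugate of \(G\), given by \(G_*^{-1}(t)=\int_0^t G^{-1}(\tau)\tau^{-\frac{N+s}{N}}\,d\tau\). Let \(f\ge0\) a.e. in \(\Omega\), \(f\not\equiv0\), let \(k>0\) a.e. in \(\Omega\), let \(k\in L^{\overline K}(\Omega)\) with \(K(t)=G_*(t^{1/(\beta+1)})\), and assume that one of the following holds: (A1) \(\alpha>1\) and \(f\in L^1(\Omega)\); (A2) \(\alpha=1\) and \(f\in L^{\overline{G_*}}(\Omega)\); (A3) \(\alpha<1\) and \(f\in L^{\overline{\mathfrak F}}(\Omega)\) with \(\mathfrak F(t)=G_*(t^{1/(1-\alpha)})\). Consider the problem \[ (-\Delta)^s_g u=f(x)u^{-\alpha}+k(x)u^{\beta},\quad u>0\ \text{in }\Omega;\qquad u=0\ \text{in }\mathbb R^N\setminus\Omega. \tag{P} \] For measurable \(U\subset\mathbb R^N\), \(W^{s,G}(U)\) is the set of \(u\in L^G(U)\) such that, for some \(\lambda>0\), \(\int_U\int_U G\big(\tfrac{|u(x)-u(y)|}{\lambda|x-y|^s}\big)\tfrac{dx\,dy}{|x-y|^N}<\infty\); \(W^{s,G}_{\rm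 loc}(\Omega)\) is the set of \(u\) belonging to \(W^{s,G}(U)\) for every open \(U\Subset\Omega\); \(W^{s,G}_0(\Omega)\) is the set of \(u\in W^{s,G}(\mathbb R^N)\) with \(u=0\) a.e. in \(\mathbb R^N\setminus\Omega\); and \(L^\infty_c(\Omega)\) is the set of essentially bounded functions vanishing a.e. outside a compact subset of \(\Omega\). A weak super-solution (sub-solution) of (P) is a function \(u\in W^{s,G}_{\rm loc}(\Omega)\) with \(u=0\) a.e. in \(\mathbb R^N\setminus\Omega\) such that (i) \(\Psi(u)\) (extended by \(0\) outside \(\Omega\)) belongs to \(W^{s,G}_0(\Omega)\) for some strictly convex \(\Psi\in C^1((0,\infty);(0,\infty))\) with \(\Psi'\) increasing and \(\theta_1\frac{\Psi(x)}{x}\le\Psi'(x)\le\theta_2\frac{\Psi(x)}{x}\) for all \(x>0\), for some constants \(\theta_1,\theta_2\ge0\); (ii) for each compact \(K\subset\Omega\) there is \(C(K)>0\) with \(u\ge C(K)\) a.e. in \(K\); (iii) for all \(0\le\varphi\in W^{s,G}_0(\Omega)\cap L^\infty_c(\Omega)\), both integrands below are Lebesgue integrable and \[ \int_{\mathbb R^N}\!\int_{\mathbb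 R^N} g\Big(\tfrac{|u(x)-u(y)|}{|x-y|^s}\Big)\tfrac{u(x)-u(y)}{|u(x)-u(y)|}\,\tfrac{\varphi(x)-\varphi(y)}{|x-y|^{N+s}}\,dx\,dy\ \ge\ (\text{resp. }\le)\ \int_\Omega\big(f u^{-\alpha}+k u^{\beta}\big)\varphi\,dx . \] A weak solution is a function that is both a weak sub-solution and a weak super-solution. Then a weak solution of (P) is unique: if \(u\) and \(v\) are weak solutions of (P), then \(u=v\) a.e. in \(\Omega\). -/

import Mathlib

open MeasureTheory Set Filter Topology
open scoped ENNReal NNReal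

noncomputable section

namespace FracGLaplace

/-- Euclidean space `ℝ^N`. -/
abbrev E (N : ℕ) : Type := EuclideanSpace ℝ (Fin N)

/-! ### `N`-functions and associated functions

A function on `ℝ⁺ = [0, ∞)` is represented by a function `ℝ → ℝ` whose values at negative
arguments are never used. -/

/-- `N`-functions `G : [0, ∞) → [0, ∞)`. -/
structure IsNFunction (G : ℝ → ℝ) : Prop where
  nonneg : ∀ t, 0 ≤ t → 0 ≤ G t
  continuousOn : ContinuousOn G (Ici 0)
  convexOn : ConvexOn ℝ (Ici 0) G
  eq_zero_iff : ∀ t, 0 ≤ t → (G t = 0 ↔ t = 0)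
  tendsto_zero : Tendsto (fun t => G t / t) (𝓝[>] 0) (𝓝 0)
  tendsto_top : Tendsto (fun t => G t / t) atTop atTop

/-- The inverse on `[0, ∞)` of a function increasing from `0` to `∞`:
the least `r ≥ 0` with `t ≤ A r`. -/
def inverse (A : ℝ → ℝ) (t : ℝ) : ℝ := sInf {r : ℝ | 0 ≤ r ∧ t ≤ A r}

/-- The integrand `G⁻¹(τ) / τ^((N+s)/N)`. -/
def conjIntegrand (N : ℕ) (s : ℝ) (G : ℝ → ℝ) (τ : ℝ) : ℝ :=
  inverse G τ / τ ^ (((N : ℝ) + s) / (N : ℝ))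

/-- `G_*⁻¹(t) = ∫_0^t G⁻¹(τ) / τ^((N+s)/N) dτ`. -/
def sobolevConjInv (N : ℕ) (s : ℝ) (G : ℝ → ℝ) (t : ℝ) : ℝ :=
  ∫ τ in (0 : ℝ)..t, conjIntegrand N s G τ

/-- The Sobolev conjugate `G_*` of `G`. -/
def sobolevConj (N : ℕ) (s : ℝ) (G : ℝ → ℝ) : ℝ → ℝ := inverse (sobolevConjInv N s G)

/-- The complementary function `t ↦ sup_{τ ≥ 0} (t τ - A τ)` of `A`, with values in `[0, ∞]`
(the supremum is nonnegative because `A 0 = 0`). -/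
def complementary (A : ℝ → ℝ) (t : ℝ) : ℝ≥0∞ :=
  ⨆ (τ : ℝ) (_ : 0 ≤ τ), ENNReal.ofReal (t * τ - A τ)

/-! ### The structural hypotheses on `G` and `g = G'` -/

/-- `g` is (locally) absolutely continuous on `[0, ∞)`. -/
def LocallyAbsCont (g : ℝ → ℝ) : Prop := ∀ T : ℝ, 0 < T → AbsolutelyContinuousOnInterval g 0 T

/-- `g'` is nondecreasing on `(0, ∞)`. -/
def DerivMonotone (g : ℝ → ℝ) : Prop := MonotoneOn (deriv g) (Ioi 0)

/-- `∫_0^1 G⁻¹(τ) τ^(-(N+s)/N) dτ < ∞` and `∫_1^∞ G⁻¹(τ) τ^(-(N+s)/N) dτ = ∞`. -/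
def ConjIntegrability (N : ℕ) (s : ℝ) (G : ℝ → ℝ) : Prop :=
  (∫⁻ τ in Ioo (0 : ℝ) 1, ENNReal.ofReal (conjIntegrand N s G τ)) < ⊤ ∧
  (∫⁻ τ in Ioi (1 : ℝ), ENNReal.ofReal (conjIntegrand N s G τ)) = ⊤

/-- `1 < p⁻ - 1 ≤ t g'(t) / g(t) ≤ p⁺ - 1` for all `t > 0`. -/
def GrowthBounds (g : ℝ → ℝ) (pm pp : ℝ) : Prop :=
  1 < pm - 1 ∧ ∀ t, 0 < t → pm - 1 ≤ t * deriv g t / g t ∧ t * deriv g t / g t ≤ pp - 1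

/-! ### Bounded Lipschitz domains -/

/-- `Ω` has a `C^{0,1}` boundary: near each boundary point, after a choice of a unit vector `e`
as vertical direction, `Ω` is the set of points lying strictly above the graph of a Lipschitz
function `γ` of the component orthogonal to `e`. -/
def HasLipschitzBoundary {N : ℕ} (Ω : Set (E N)) : Prop :=
  ∀ x₀ ∈ frontier Ω, ∃ (e : E N) (γ : E N → ℝ) (L : ℝ≥0) (r : ℝ),
    ‖e‖ = 1 ∧ LipschitzWith L γ ∧ 0 < r ∧
    ∀ y ∈ Metric.ball x₀ r, (y ∈ Ω ↔ γ (y - (inner ℝ e y) • e) < inner ℝ e y)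

/-- Bounded domains (nonempty open connected sets) with `C^{0,1}` boundary. -/
structure IsBoundedLipschitzDomain {N : ℕ} (Ω : Set (E N)) : Prop where
  isOpen : IsOpen Ω
  isConnected : IsConnected Ω
  isBounded : Bornology.IsBounded Ω
  lipschitz : HasLipschitzBoundary Ω

/-! ### Orlicz and fractional Orlicz-Sobolev spaces -/

/-- `u ∈ L^A(U)`: `u` is measurable on `U` and `∫_U A(|u| / λ) < ∞` for some `λ > 0`. -/
def MemOrlicz {N : ℕ} (A : ℝ → ℝ≥0∞) (U : Set (E N)) (u : E N → ℝ) : Prop :=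
  AEMeasurable u (volume.restrict U) ∧
  ∃ l : ℝ, 0 < l ∧ (∫⁻ x in U, A (|u x| / l)) < ⊤

/-- The modular `∫_U ∫_U G(|u(x) - u(y)| / |x - y|^s) dx dy / |x - y|^N`. -/
def gagliardoModular {N : ℕ} (s : ℝ) (G : ℝ → ℝ) (U : Set (E N)) (u : E N → ℝ) : ℝ≥0∞ :=
  ∫⁻ x in U, ∫⁻ y in U, ENNReal.ofReal (G (|u x - u y| / ‖x - y‖ ^ s) / ‖x - y‖ ^ N)

/-- `u ∈ W^{s,G}(U)`. -/
def MemFracSobolev {N : ℕ} (s : ℝ) (G : ℝ → ℝ) (U : Set (E N)) (u : E N → ℝ) : Prop :=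
  MemOrlicz (fun t => ENNReal.ofReal (G t)) U u ∧
  ∃ l : ℝ, 0 < l ∧ gagliardoModular s G U (fun x => u x / l) < ⊤

/-- `u ∈ W^{s,G}_loc(Ω)`: `u ∈ W^{s,G}(U)` for every open `U ⋐ Ω`. -/
def MemFracSobolevLoc {N : ℕ} (s : ℝ) (G : ℝ → ℝ) (Ω : Set (E N)) (u : E N → ℝ) : Prop :=
  ∀ U : Set (E N), IsOpen U → IsCompact (closure U) → closure U ⊆ Ω → MemFracSobolev s G U u

/-- `u ∈ W^{s,G}_0(Ω)`: `u ∈ W^{s,G}(ℝ^N)` and `u = 0` a.e. in `ℝ^N ∖ Ω`. -/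
def MemFracSobolevZero {N : ℕ} (s : ℝ) (G : ℝ → ℝ) (Ω : Set (E N)) (u : E N → ℝ) : Prop :=
  MemFracSobolev s G univ u ∧ ∀ᵐ x ∂(volume : Measure (E N)), x ∉ Ω → u x = 0

/-- `φ ∈ L^∞_c(Ω)`: `φ` is essentially bounded and vanishes a.e. outside a compact subset
of `Ω`. -/
def MemLinftyCompact {N : ℕ} (Ω : Set (E N)) (φ : E N → ℝ) : Prop :=
  AEMeasurable φ volume ∧
  (∃ M : ℝ, ∀ᵐ x ∂(volume : Measure (E N)), |φ x| ≤ M) ∧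
  ∃ K : Set (E N), IsCompact K ∧ K ⊆ Ω ∧ ∀ᵐ x ∂(volume : Measure (E N)), x ∉ K → φ x = 0

/-! ### Weak sub-solutions, super-solutions and solutions -/

/-- The class `FC` of functions `Ψ : (0, ∞) → (0, ∞)`. -/
structure IsFC (Ψ : ℝ → ℝ) : Prop where
  pos : ∀ x, 0 < x → 0 < Ψ x
  contDiffOn : ContDiffOn ℝ 1 Ψ (Ioi 0)
  strictConvexOn : StrictConvexOn ℝ (Ioi 0) Ψ
  deriv_mono : MonotoneOn (deriv Ψ) (Ioi 0)
  growth : ∃ θ₁ θ₂ : ℝ, 0 ≤ θ₁ ∧ 0 ≤ θ₂ ∧ ∀ x, 0 < x →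
    θ₁ * (Ψ x / x) ≤ deriv Ψ x ∧ deriv Ψ x ≤ θ₂ * (Ψ x / x)

/-- Nonnegative test functions `0 ≤ φ ∈ W^{s,G}_0(Ω) ∩ L^∞_c(Ω)`. -/
structure IsTest {N : ℕ} (s : ℝ) (G : ℝ → ℝ) (Ω : Set (E N)) (φ : E N → ℝ) : Prop where
  mem : MemFracSobolevZero s G Ω φ
  linfty : MemLinftyCompact Ω φ
  nonneg : ∀ᵐ x ∂(volume : Measure (E N)), 0 ≤ φ x

/-- The integrand of the weak form of the fractional `g`-Laplacian (it is `0` where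
`u(x) = u(y)`). -/
def energyIntegrand {N : ℕ} (s : ℝ) (g : ℝ → ℝ) (u φ : E N → ℝ) (z : E N × E N) : ℝ :=
  g (|u z.1 - u z.2| / ‖z.1 - z.2‖ ^ s) * ((u z.1 - u z.2) / |u z.1 - u z.2|)
    * ((φ z.1 - φ z.2) / ‖z.1 - z.2‖ ^ ((N : ℝ) + s))

/-- The integrand `(f u^{-α} + k u^β) φ` of the right-hand side. -/
def sourceIntegrand {N : ℕ} (α β : ℝ) (f k u φ : E N → ℝ) (x : E N) : ℝ :=
  (f x * u x ^ (-α) + k x * u x ^ β) * φ x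

/-- The requirements common to weak sub- and super-solutions: `u ∈ W^{s,G}_loc(Ω)`,
`u = 0` outside `Ω`, `Ψ(u) ∈ W^{s,G}_0(Ω)` (extended by zero outside `Ω`) for some `Ψ ∈ FC`,
positive lower bounds on compact subsets of `Ω`, and existence (as Lebesgue integrals) of the
integrals entering the weak formulation. -/
structure IsAdmissible {N : ℕ} (s α β : ℝ) (G g : ℝ → ℝ) (Ω : Set (E N)) (f k u : E N → ℝ) :
    Prop where
  mem_loc : MemFracSobolevLoc s G Ω u
  zero_outside : ∀ᵐ x ∂(volume : Measure (E N)), x ∉ Ω → u x = 0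
  exists_FC : ∃ Ψ : ℝ → ℝ, IsFC Ψ ∧ MemFracSobolevZero s G Ω (Ω.indicator (fun x => Ψ (u x)))
  lower_bound : ∀ K : Set (E N), IsCompact K → K ⊆ Ω →
    ∃ C : ℝ, 0 < C ∧ ∀ᵐ x ∂(volume : Measure (E N)), x ∈ K → C ≤ u x
  integrable_energy : ∀ φ, IsTest s G Ω φ →
    Integrable (energyIntegrand s g u φ) ((volume : Measure (E N)).prod volume)
  integrable_source : ∀ φ, IsTest s G Ω φ → IntegrableOn (sourceIntegrand α β f k u φ) Ω

/-- Weak super-solutions of `(-Δ)^s_g u = f u^{-α} + k u^β`, `u > 0` in `Ω`, `u = 0` outside. -/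
def IsWeakSuperSolution {N : ℕ} (s α β : ℝ) (G g : ℝ → ℝ) (Ω : Set (E N))
    (f k u : E N → ℝ) : Prop :=
  IsAdmissible s α β G g Ω f k u ∧
  ∀ φ, IsTest s G Ω φ →
    (∫ x in Ω, sourceIntegrand α β f k u φ x)
      ≤ ∫ z, energyIntegrand s g u φ z ∂((volume : Measure (E N)).prod volume)

/-- Weak sub-solutions. -/
def IsWeakSubSolution {N : ℕ} (s α β : ℝ) (G g : ℝ → ℝ) (Ω : Set (E N))
    (f k u : E N → ℝ) : Prop :=
  IsAdmissible s α β G g Ω f k u ∧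
  ∀ φ, IsTest s G Ω φ →
    (∫ z, energyIntegrand s g u φ z ∂((volume : Measure (E N)).prod volume))
      ≤ ∫ x in Ω, sourceIntegrand α β f k u φ x

/-- Weak solutions: functions that are both weak sub- and weak super-solutions. -/
def IsWeakSolution {N : ℕ} (s α β : ℝ) (G g : ℝ → ℝ) (Ω : Set (E N))
    (f k u : E N → ℝ) : Prop :=
  IsWeakSubSolution s α β G g Ω f k u ∧ IsWeakSuperSolution s α β G g Ω f k u

end FracGLaplace

end

/-!
# Uniqueness of weak solutions of a singular fractional `g`-Laplace problem

Two weak solutions `u`, `v` are compared by a discrete version of the Díaz–Saá argument. With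
`q = p⁻`, the test functions `φ = (u^q - v^q)⁺ / u^{q-1}` for `u` and `ψ = (u^q - v^q)⁺ / v^{q-1}`
for `v` satisfy, for almost every pair of points, an inequality between the energy densities
(`picone_le`): it follows from the convexity of `(X, A) ↦ X^q A^{1-q}` and the monotonicity of
`g(t) t^{1-q}`. Hence the source of `u` tested with `φ` dominates the source of `v` tested
with `ψ`. Since `t^{-α-q+1}` and `t^{β-q+1}` are decreasing and `k > 0`, this is only
possible if `u ≤ v` almost everywhere (`ProblemData.ae_le`).

These functions are neither bounded nor compactly supported, and `v` has no finite energy up to the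
boundary, so `u` is replaced by truncations `z_n` of `z = (u - ε)⁺`, cut off near the
boundary, while `v` is left as it is; `picone_le` holds exactly for `z_n` and `v`, and the whole
error is the difference of the energies of `z_n` and `u` tested with `φ_n`. Three facts make
it disappear in the limit.

* `z` has finite energy on the whole space, because the functions `Ψ` of the class `FC` expand
  increments above a positive level (`IsAdmissible.finitePair_levelPair`).
* The boundary of `Ω` is Lipschitz, so every point of `Ω` sees a ball of comparable size outside
  `Ω`, where `z` vanishes. This gives a Hardy inequality (`IsBoundedLipschitzDomain.hardy`), and
  with it a bound of the increments of all `z_n` by a single function of finite modular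
  (`IsBoundedLipschitzDomain.finitePair_hardyPair`).
* Testing the inequality of the super-solution `v` with `(z_n - v)⁺` gives a Caccioppoli
  estimate (`ProblemData.finitePair_posPart_sub`): `(z - v)⁺` has finite energy. As `φ_n` is a
  Lipschitz function of `z_n` and `(z_n - v)⁺`, its increments are dominated uniformly in `n`.

After dominated convergence and Fatou's lemma the singular terms may be dropped: they compare in
the favourable direction, and the one of `u` is finite because the source of `u` is integrable
against `z` (`ProblemData.lintegral_source_posLevel_lt_top`). The limit `ε → 0` then concerns only
the terms with `k`, where `k u^{β+1}` is an integrable majorant.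
-/

open MeasureTheory Set Filter Topology
open scoped ENNReal NNReal

namespace FracGLaplace

/-! ### Growth of `G` and `g` -/

/-- The growth properties of an `N`-function `G` with derivative `g` on which the comparison
argument rests: `g` is increasing, `g(t) t^{1-q}` is nondecreasing, and `G` grows at most like
the power `p`. -/
structure GrowthPair (G g : ℝ → ℝ) (q p : ℝ) : Prop where
  one_lt : 1 < q
  G_zero : G 0 = 0
  G_nonneg : ∀ t, 0 ≤ t → 0 ≤ G t
  G_cont : ContinuousOn G (Ici 0)
  G_mono : MonotoneOn G (Ici 0)
  G_smul_le : ∀ l t, 0 ≤ l → l ≤ 1 → 0 ≤ t → G (l * t) ≤ l * G t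
  G_mul_le : ∀ l t, 1 ≤ l → 0 ≤ t → G (l * t) ≤ l ^ p * G t
  g_zero : g 0 = 0
  g_nonneg : ∀ t, 0 ≤ t → 0 ≤ g t
  g_cont : ContinuousOn g (Ici 0)
  g_mono : MonotoneOn g (Ici 0)
  mul_g_le : ∀ t, 0 ≤ t → g t * t ≤ p * G t
  G_le : ∀ t, 0 ≤ t → G t ≤ g t * t
  g_ratio : ∀ R P, 0 < R → R ≤ P → g R * R ^ (1 - q) ≤ g P * P ^ (1 - q)

/-- If `t F'(t) ≥ m F(t)`, then `F(t) t^{-m}` is nondecreasing. -/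
lemma monotoneOn_mul_rpow_neg {F F' : ℝ → ℝ} {m : ℝ} (hF : ∀ t, 0 < t → HasDerivAt F (F' t) t)
    (h : ∀ t, 0 < t → m * F t ≤ t * F' t) : MonotoneOn (fun t => F t * t ^ (-m)) (Ioi 0) := by
  have hd : ∀ t : ℝ, 0 < t → HasDerivAt (fun t => F t * t ^ (-m))
      (F' t * t ^ (-m) + F t * (-m * t ^ (-m - 1))) t := fun t ht =>
    (hF t ht).mul (Real.hasDerivAt_rpow_const (Or.inl ht.ne'))
  refine monotoneOn_of_deriv_nonneg (convex_Ioi 0)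
    (fun t ht => (hd t ht).continuousAt.continuousWithinAt) ?_ ?_
  · rw [interior_Ioi]
    exact fun t ht => (hd t ht).differentiableAt.differentiableWithinAt
  · rw [interior_Ioi]
    intro t ht
    have ht' : 0 < t := ht
    rw [(hd t ht).deriv]
    have e : t ^ (-m) = t ^ (-m - 1) * t := by
      rw [← Real.rpow_add_one ht'.ne']; congr 1; ring
    rw [e]
    have := mul_nonneg (Real.rpow_nonneg ht'.le (-m - 1)) (sub_nonneg.2 (h t ht'))
    linarith

lemma GrowthPair.of_hypotheses {G g : ℝ → ℝ} (hG : IsNFunction G)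
    (hg : ∀ t, 0 ≤ t → HasDerivWithinAt G (g t) (Ici 0) t)
    (hgC1 : ContDiffOn ℝ 1 g (Ici 0)) {pm pp : ℝ} (h4 : GrowthBounds g pm pp) :
    GrowthPair G g pm pp ∧ 1 < pp := by
  have hG0 : G 0 = 0 := (hG.eq_zero_iff 0 le_rfl).2 rfl
  have hGd : ∀ t, 0 < t → HasDerivAt G (g t) t := fun t ht =>
    (hg t ht.le).hasDerivAt (Ici_mem_nhds ht)
  have hgd : ∀ t, 0 < t → HasDerivAt g (deriv g t) t := fun t ht =>
    ((hgC1.differentiableOn one_ne_zero).differentiableAt (Ici_mem_nhds ht)).hasDerivAt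
  have hgc : ContinuousOn g (Ici 0) := hgC1.continuousOn
  have hGpos : ∀ t, 0 < t → 0 < G t := fun t ht =>
    lt_of_le_of_ne (hG.nonneg t ht.le) fun h => ht.ne' ((hG.eq_zero_iff t ht.le).1 h.symm)
  have hsl : ∀ t, 0 < t → G t ≤ g t * t := by
    intro t ht
    have h := hG.convexOn.slope_le_of_hasDerivAt (x := 0) (y := t) self_mem_Ici ht.le ht
      (hGd t ht)
    rw [slope_def_field, hG0, sub_zero, sub_zero, div_le_iff₀ ht] at h
    exact h
  have hgpos : ∀ t, 0 < t → 0 < g t := fun t ht =>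
    pos_of_mul_pos_left ((hGpos t ht).trans_le (hsl t ht)) ht.le
  have hsmul : ∀ l t, 0 ≤ l → l ≤ 1 → 0 ≤ t → G (l * t) ≤ l * G t := by
    intro l t hl hl1 ht
    have h := hG.convexOn.2 (show t ∈ Ici (0 : ℝ) from ht) (show (0 : ℝ) ∈ Ici 0 from self_mem_Ici)
      hl (sub_nonneg.2 hl1) (by ring)
    simpa [hG0] using h
  have hpp : 2 < pp := by
    have h1 := h4.1
    have h2 := h4.2 1 one_pos
    linarith
  have hder : ∀ t, 0 < t → (pm - 1) * g t ≤ t * deriv g t ∧ t * deriv g t ≤ (pp - 1) * g t := by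
    intro t ht
    have h := h4.2 t ht
    rwa [le_div_iff₀ (hgpos t ht), div_le_iff₀ (hgpos t ht)] at h
  have hrat := monotoneOn_mul_rpow_neg hgd (fun t ht => (hder t ht).1)
  have hgnn : ∀ t, 0 < t → 0 ≤ deriv g t := by
    intro t ht
    have h := (mul_nonneg (by linarith [h4.1] : (0 : ℝ) ≤ pm - 1) (hgpos t ht).le).trans
      (hder t ht).1
    exact nonneg_of_mul_nonneg_right h ht
  have hgm : MonotoneOn g (Ici 0) := by
    refine monotoneOn_of_deriv_nonneg (convex_Ici 0) hgc ?_ ?_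
    · rw [interior_Ici]; exact fun t ht => (hgd t ht).differentiableAt.differentiableWithinAt
    · rw [interior_Ici]; exact fun t ht => hgnn t ht
  have hg0' : 0 ≤ g 0 := by
    have : Tendsto g (𝓝[>] 0) (𝓝 (g 0)) :=
      (hgc 0 self_mem_Ici).mono_left (nhdsWithin_mono _ Ioi_subset_Ici_self)
    exact ge_of_tendsto this (eventually_nhdsWithin_of_forall fun t ht => (hgpos t ht).le)
  have hg0 : g 0 = 0 := by
    have h1 := (hasDerivWithinAt_iff_tendsto_slope.1 (hg 0 le_rfl))
    have h2 : Tendsto (slope G 0) (𝓝[>] 0) (𝓝 (g 0)) := by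
      refine h1.mono_left (nhdsWithin_mono _ ?_)
      intro t ht
      exact ⟨mem_Ici.2 (le_of_lt ht), ne_of_gt ht⟩
    have h3 : slope G 0 = fun t => G t / t := by
      funext t; simp [slope_def_field, hG0]
    rw [h3] at h2
    exact tendsto_nhds_unique h2 hG.tendsto_zero
  have hGm : MonotoneOn G (Ici 0) := by
    refine monotoneOn_of_deriv_nonneg (convex_Ici 0) hG.continuousOn ?_ ?_
    · rw [interior_Ici]; exact fun t ht => (hGd t ht).differentiableAt.differentiableWithinAt
    · rw [interior_Ici]; exact fun t ht => by rw [(hGd t ht).deriv]; exact (hgpos t ht).le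
  have hmul : ∀ t, 0 ≤ t → g t * t ≤ pp * G t := by
    have hm : MonotoneOn (fun t => pp * G t - g t * t) (Ici 0) := by
      have hd : ∀ t, 0 < t → HasDerivAt (fun t => pp * G t - g t * t)
          (pp * g t - (deriv g t * t + g t * 1)) t := fun t ht =>
        ((hGd t ht).const_mul pp).sub ((hgd t ht).mul (hasDerivAt_id t))
      refine monotoneOn_of_deriv_nonneg (convex_Ici 0) ?_ ?_ ?_
      · exact (continuousOn_const.mul hG.continuousOn).sub (hgc.mul continuousOn_id)
      · rw [interior_Ici]; exact fun t ht => (hd t ht).differentiableAt.differentiableWithinAt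
      · rw [interior_Ici]
        intro t ht
        rw [(hd t ht).deriv]
        linarith [(hder t ht).2]
    intro t ht
    have := hm self_mem_Ici ht ht
    simp only [hG0] at this
    linarith
  refine ⟨⟨by linarith [h4.1], hG0, hG.nonneg, hG.continuousOn, hGm, hsmul, ?_, hg0, ?_, hgc, hgm,
    hmul, ?_, ?_⟩, by linarith⟩
  · intro l t hl ht
    rcases ht.eq_or_lt with rfl | ht
    · simp [hG0]
    -- `-G(t) t^{-p}` is nondecreasing because `t g(t) ≤ p G(t)`
    have hm := monotoneOn_mul_rpow_neg (F := fun t => -G t) (F' := fun t => -g t) (m := pp)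
      (fun t ht => (hGd t ht).neg) (fun t ht => by nlinarith [hmul t ht.le])
    have hl0 : 0 < l := by linarith
    have h := hm ht (mul_pos hl0 ht : l * t ∈ Ioi 0) (by nlinarith)
    simp only at h
    rw [Real.mul_rpow hl0.le ht.le, Real.rpow_neg hl0.le] at h
    have hlp : 0 < l ^ pp := Real.rpow_pos_of_pos hl0 _
    have htp : 0 < t ^ (-pp) := Real.rpow_pos_of_pos ht _
    have h' : G (l * t) * (l ^ pp)⁻¹ * t ^ (-pp) ≤ G t * t ^ (-pp) := by nlinarith
    have h'' := le_of_mul_le_mul_right h' htp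
    rw [← div_eq_mul_inv, div_le_iff₀ hlp] at h''
    linarith
  · intro t ht
    rcases ht.eq_or_lt with rfl | ht
    · exact hg0'
    · exact (hgpos t ht).le
  · intro t ht
    rcases ht.eq_or_lt with rfl | ht
    · simp [hG0]
    · exact hsl t ht
  · intro R P hR hRP
    have h := hrat (show R ∈ Ioi (0 : ℝ) from hR) (show P ∈ Ioi (0 : ℝ) from hR.trans_le hRP) hRP
    simpa [neg_sub] using h

namespace GrowthPair

variable {G g : ℝ → ℝ} {q p : ℝ}

/-- `G(l t) ≤ max(1, l)^p G(t)`. -/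
lemma G_const_mul_le (hGg : GrowthPair G g q p) {l t : ℝ} (hl : 0 ≤ l) (ht : 0 ≤ t) :
    G (l * t) ≤ max 1 l ^ p * G t := by
  refine le_trans (hGg.G_mono (mul_nonneg hl ht) ?_ ?_) (hGg.G_mul_le (max 1 l) t (le_max_left _ _) ht)
  · exact mul_nonneg (zero_le_one.trans (le_max_left _ _)) ht
  · exact mul_le_mul_of_nonneg_right (le_max_right _ _) ht

lemma G_add_le (hGg : GrowthPair G g q p) {a b : ℝ} (ha : 0 ≤ a) (hb : 0 ≤ b) :
    G (a + b) ≤ 2 ^ p * (G a + G b) := by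
  have key : ∀ c d, 0 ≤ c → c ≤ d → G (c + d) ≤ 2 ^ p * (G c + G d) := by
    intro c d hc hcd
    have hd := hc.trans hcd
    have h1 : G (c + d) ≤ G (2 * d) :=
      hGg.G_mono (add_nonneg hc hd) (mul_nonneg zero_le_two hd) (by linarith)
    have h2 := hGg.G_mul_le 2 d one_le_two hd
    have h3 : 0 ≤ (2 : ℝ) ^ p * G c := mul_nonneg (by positivity) (hGg.G_nonneg c hc)
    linarith
  rcases le_total a b with h | h
  · exact key a b ha h
  · rw [add_comm a, add_comm (G a)]; exact key b a hb h

lemma g_mul_le (hGg : GrowthPair G g q p) (hp : 0 ≤ p) {a b : ℝ} (ha : 0 ≤ a) (hb : 0 ≤ b) :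
    g a * b ≤ p * G a + p * G b := by
  have h1 := hGg.mul_g_le a ha
  have h2 := hGg.mul_g_le b hb
  rcases le_total a b with h | h
  · have := mul_le_mul_of_nonneg_right (hGg.g_mono ha hb h) hb
    have := mul_nonneg hp (hGg.G_nonneg a ha)
    linarith
  · have := mul_le_mul_of_nonneg_left h (hGg.g_nonneg a ha)
    have := mul_nonneg hp (hGg.G_nonneg b hb)
    linarith

end GrowthPair

/-! ### The modular of functions of two points -/

/-- The increment `(x, y) ↦ u(x) - u(y)`. -/
noncomputable def incr {N : ℕ} (u : E N → ℝ) (z : E N × E N) : ℝ := u z.1 - u z.2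

/-- The density of the Gagliardo modular of a function `P` of two points. -/
noncomputable def modDensity {N : ℕ} (s : ℝ) (G : ℝ → ℝ) (P : E N × E N → ℝ) (z : E N × E N) : ℝ :=
  G (|P z| / ‖z.1 - z.2‖ ^ s) / ‖z.1 - z.2‖ ^ N

/-- `P` is measurable and `∬ G(|P(x, y)| / |x - y|^s) dx dy / |x - y|^N` is finite. -/
structure FinitePair {N : ℕ} (s : ℝ) (G : ℝ → ℝ) (P : E N × E N → ℝ) : Prop where
  aemeasurable : AEMeasurable P ((volume : Measure (E N)).prod volume)
  lt_top : ∫⁻ z, ENNReal.ofReal (modDensity s G P z)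
    ∂((volume : Measure (E N)).prod volume) < ⊤

section

variable {N : ℕ} {s : ℝ} {G g : ℝ → ℝ} {q p : ℝ}

lemma aemeasurable_comp_fst {u : E N → ℝ} (hu : AEMeasurable u volume) :
    AEMeasurable (fun z : E N × E N => u z.1) ((volume : Measure (E N)).prod volume) :=
  hu.comp_quasiMeasurePreserving Measure.quasiMeasurePreserving_fst

lemma aemeasurable_comp_snd {u : E N → ℝ} (hu : AEMeasurable u volume) :
    AEMeasurable (fun z : E N × E N => u z.2) ((volume : Measure (E N)).prod volume) :=
  hu.comp_quasiMeasurePreserving Measure.quasiMeasurePreserving_snd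

lemma aemeasurable_incr {u : E N → ℝ} (hu : AEMeasurable u volume) :
    AEMeasurable (incr u) ((volume : Measure (E N)).prod volume) :=
  (aemeasurable_comp_fst hu).sub (aemeasurable_comp_snd hu)

/-- A property that holds almost everywhere holds at both points of almost every pair. -/
lemma ae_pair {P : E N → Prop} (h : ∀ᵐ x ∂(volume : Measure (E N)), P x) :
    ∀ᵐ z ∂((volume : Measure (E N)).prod volume), P z.1 ∧ P z.2 :=
  (Measure.quasiMeasurePreserving_fst.ae h).and (Measure.quasiMeasurePreserving_snd.ae h)

lemma measurable_norm_rpow (t : ℝ) : Measurable fun z : E N × E N => ‖z.1 - z.2‖ ^ t :=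
  ((measurable_fst.sub measurable_snd).norm).pow_const t

lemma measurable_norm_pow (n : ℕ) : Measurable fun z : E N × E N => ‖z.1 - z.2‖ ^ n :=
  ((measurable_fst.sub measurable_snd).norm).pow_const n

/-- Composition of a function continuous on `[0, ∞)` with a nonnegative measurable one. -/
lemma aemeasurable_comp_of_nonneg {X : Type*} [MeasurableSpace X] {μ : Measure X} {h : ℝ → ℝ}
    (hc : ContinuousOn h (Ici 0)) {f : X → ℝ} (hf : AEMeasurable f μ) (hf0 : ∀ x, 0 ≤ f x) :
    AEMeasurable (fun x => h (f x)) μ := by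
  have h1 : Continuous fun t : ℝ => h (max t 0) :=
    hc.comp_continuous (by fun_prop) fun t => mem_Ici.2 (le_max_right _ _)
  have h2 := h1.measurable.comp_aemeasurable hf
  refine h2.congr (Eventually.of_forall fun x => ?_)
  simp [max_eq_left (hf0 x)]

lemma aemeasurable_quot {P : E N × E N → ℝ}
    (hP : AEMeasurable P ((volume : Measure (E N)).prod volume)) :
    AEMeasurable (fun z : E N × E N => |P z| / ‖z.1 - z.2‖ ^ s)
      ((volume : Measure (E N)).prod volume) :=
  (continuous_abs.measurable.comp_aemeasurable hP).div (measurable_norm_rpow s).aemeasurable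

lemma quot_nonneg (P : E N × E N → ℝ) (z : E N × E N) : 0 ≤ |P z| / ‖z.1 - z.2‖ ^ s := by
  positivity

lemma GrowthPair.aemeasurable_modDensity (hGg : GrowthPair G g q p) {P : E N × E N → ℝ}
    (hP : AEMeasurable P ((volume : Measure (E N)).prod volume)) :
    AEMeasurable (modDensity s G P) ((volume : Measure (E N)).prod volume) :=
  (aemeasurable_comp_of_nonneg hGg.G_cont (aemeasurable_quot hP) (quot_nonneg P)).div
    (measurable_norm_pow N).aemeasurable

lemma GrowthPair.modDensity_nonneg (hGg : GrowthPair G g q p) (P : E N × E N → ℝ)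
    (z : E N × E N) : 0 ≤ modDensity s G P z :=
  div_nonneg (hGg.G_nonneg _ (quot_nonneg P z)) (by positivity)

lemma GrowthPair.modDensity_le (hGg : GrowthPair G g q p) {P Q : E N × E N → ℝ} {C : ℝ}
    (hC : 0 ≤ C) {z : E N × E N} (h : |P z| ≤ C * |Q z|) :
    modDensity s G P z ≤ max 1 C ^ p * modDensity s G Q z := by
  unfold modDensity
  rw [← mul_div_assoc]
  refine div_le_div_of_nonneg_right ?_ (by positivity)
  refine le_trans (hGg.G_mono (quot_nonneg P z) ?_ ?_)
    (hGg.G_const_mul_le hC (quot_nonneg Q z))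
  · exact mul_nonneg hC (quot_nonneg Q z)
  · rw [← mul_div_assoc]
    exact div_le_div_of_nonneg_right h (by positivity)

lemma GrowthPair.modDensity_add_le (hGg : GrowthPair G g q p) (P Q : E N × E N → ℝ)
    (z : E N × E N) : modDensity s G (fun z => |P z| + |Q z|) z
      ≤ 2 ^ p * (modDensity s G P z + modDensity s G Q z) := by
  unfold modDensity
  rw [← add_div, ← mul_div_assoc]
  refine div_le_div_of_nonneg_right ?_ (by positivity)
  rw [abs_of_nonneg (by positivity : 0 ≤ |P z| + |Q z|), add_div]
  exact hGg.G_add_le (quot_nonneg P z) (quot_nonneg Q z)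

namespace FinitePair

lemma integrable (hGg : GrowthPair G g q p) {P : E N × E N → ℝ} (hP : FinitePair s G P) :
    Integrable (modDensity s G P) ((volume : Measure (E N)).prod volume) := by
  refine ⟨(hGg.aemeasurable_modDensity hP.aemeasurable).aestronglyMeasurable, ?_⟩
  rw [hasFiniteIntegral_iff_ofReal (Eventually.of_forall (hGg.modDensity_nonneg P))]
  exact hP.lt_top

lemma of_integrable (hGg : GrowthPair G g q p) {P : E N × E N → ℝ}
    (hP : AEMeasurable P ((volume : Measure (E N)).prod volume))
    (h : Integrable (modDensity s G P) ((volume : Measure (E N)).prod volume)) :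
    FinitePair s G P :=
  ⟨hP, (hasFiniteIntegral_iff_ofReal (Eventually.of_forall (hGg.modDensity_nonneg P))).1 h.2⟩

lemma of_le_const_mul (hGg : GrowthPair G g q p) {P Q : E N × E N → ℝ} (hQ : FinitePair s G Q)
    {C : ℝ} (hC : 0 ≤ C) (hP : AEMeasurable P ((volume : Measure (E N)).prod volume))
    (h : ∀ᵐ z ∂((volume : Measure (E N)).prod volume), |P z| ≤ C * |Q z|) :
    FinitePair s G P := by
  refine of_integrable hGg hP (((hQ.integrable hGg).const_mul (max 1 C ^ p)).mono'
    (hGg.aemeasurable_modDensity hP).aestronglyMeasurable ?_)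
  filter_upwards [h] with z hz
  rw [Real.norm_of_nonneg (hGg.modDensity_nonneg P z)]
  exact hGg.modDensity_le hC hz

lemma of_le (hGg : GrowthPair G g q p) {P Q : E N × E N → ℝ} (hQ : FinitePair s G Q)
    (hP : AEMeasurable P ((volume : Measure (E N)).prod volume))
    (h : ∀ᵐ z ∂((volume : Measure (E N)).prod volume), |P z| ≤ |Q z|) :
    FinitePair s G P :=
  of_le_const_mul hGg hQ zero_le_one hP (h.mono fun z hz => by rwa [one_mul])

lemma abs_add_abs (hGg : GrowthPair G g q p) {P Q : E N × E N → ℝ} (hP : FinitePair s G P)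
    (hQ : FinitePair s G Q) : FinitePair s G (fun z => |P z| + |Q z|) := by
  have hm : AEMeasurable (fun z => |P z| + |Q z|) ((volume : Measure (E N)).prod volume) :=
    (continuous_abs.measurable.comp_aemeasurable hP.aemeasurable).add
      (continuous_abs.measurable.comp_aemeasurable hQ.aemeasurable)
  refine of_integrable hGg hm ((((hP.integrable hGg).add (hQ.integrable hGg)).const_mul
    ((2 : ℝ) ^ p)).mono' (hGg.aemeasurable_modDensity hm).aestronglyMeasurable ?_)
  refine Eventually.of_forall fun z => ?_
  rw [Real.norm_of_nonneg (hGg.modDensity_nonneg _ z)]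
  exact hGg.modDensity_add_le P Q z

lemma swap {P : E N × E N → ℝ} (hP : FinitePair s G P) :
    FinitePair s G (fun z => P z.swap) := by
  have hsw : MeasurePreserving (Prod.swap : E N × E N → E N × E N)
      ((volume : Measure (E N)).prod volume) ((volume : Measure (E N)).prod volume) :=
    Measure.measurePreserving_swap
  refine ⟨hP.aemeasurable.comp_quasiMeasurePreserving hsw.quasiMeasurePreserving, ?_⟩
  have h := hsw.lintegral_comp_emb (MeasurableEquiv.prodComm.measurableEmbedding)
    (fun z => ENNReal.ofReal (modDensity s G P z))
  have h2 := hP.lt_top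
  rw [← h] at h2
  convert h2 using 4 with z
  simp [modDensity, norm_sub_rev]

end FinitePair

/-! ### The pairing of `g(|P|)` with `Q` -/

/-- The odd extension of `g` as it enters the weak form. -/
noncomputable def oddExt (g : ℝ → ℝ) (t : ℝ) : ℝ := g |t| * (t / |t|)

/-- The integrand of the weak form with the increments of `u` and `φ` replaced by arbitrary
functions `P` and `Q` of two points. -/
noncomputable def pairing {N : ℕ} (s : ℝ) (g : ℝ → ℝ) (P Q : E N × E N → ℝ) (z : E N × E N) : ℝ :=
  g (|P z| / ‖z.1 - z.2‖ ^ s) * (P z / |P z|) * (Q z / ‖z.1 - z.2‖ ^ ((N : ℝ) + s))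

lemma energyIntegrand_eq_pairing (u φ : E N → ℝ) :
    energyIntegrand s g u φ = pairing s g (incr u) (incr φ) := rfl

lemma pairing_aemeasurable (hGg : GrowthPair G g q p) {P Q : E N × E N → ℝ}
    (hP : AEMeasurable P ((volume : Measure (E N)).prod volume))
    (hQ : AEMeasurable Q ((volume : Measure (E N)).prod volume)) :
    AEMeasurable (pairing s g P Q) ((volume : Measure (E N)).prod volume) :=
  ((aemeasurable_comp_of_nonneg hGg.g_cont (aemeasurable_quot hP) (quot_nonneg P)).mul
    (hP.div (continuous_abs.measurable.comp_aemeasurable hP))).mul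
    (hQ.div (measurable_norm_rpow _).aemeasurable)

lemma norm_rpow_add {z : E N × E N} (h : z.1 ≠ z.2) :
    ‖z.1 - z.2‖ ^ ((N : ℝ) + s) = ‖z.1 - z.2‖ ^ N * ‖z.1 - z.2‖ ^ s := by
  have hr : 0 < ‖z.1 - z.2‖ := norm_pos_iff.2 (sub_ne_zero.2 h)
  rw [Real.rpow_add hr, Real.rpow_natCast]

/-- Young's inequality for the integrand of the weak form. -/
lemma abs_pairing_le (hGg : GrowthPair G g q p) (hp : 0 ≤ p) {P Q P' Q' : E N × E N → ℝ}
    {z : E N × E N} (hz : z.1 ≠ z.2) (hP : |P z| ≤ |P' z|) (hQ : |Q z| ≤ |Q' z|) :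
    |pairing s g P Q z| ≤ p * modDensity s G P' z + p * modDensity s G Q' z := by
  have hr : 0 < ‖z.1 - z.2‖ := norm_pos_iff.2 (sub_ne_zero.2 hz)
  have hrs : 0 < ‖z.1 - z.2‖ ^ s := Real.rpow_pos_of_pos hr _
  have hrN : 0 < ‖z.1 - z.2‖ ^ N := pow_pos hr _
  have hsg : |(P z / |P z|)| ≤ 1 := by
    rw [abs_div, abs_abs]; exact div_self_le_one _
  have h1 : g (|P z| / ‖z.1 - z.2‖ ^ s) ≤ g (|P' z| / ‖z.1 - z.2‖ ^ s) :=
    hGg.g_mono (quot_nonneg P z) (quot_nonneg P' z) (div_le_div_of_nonneg_right hP hrs.le)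
  have h0 := hGg.g_nonneg _ (quot_nonneg (s := s) P z)
  have h0' := hGg.g_nonneg _ (quot_nonneg (s := s) P' z)
  have hy := hGg.g_mul_le hp (quot_nonneg (s := s) P' z) (quot_nonneg (s := s) Q' z)
  have h3 : |pairing s g P Q z| ≤
      g (|P' z| / ‖z.1 - z.2‖ ^ s) * (|Q' z| / ‖z.1 - z.2‖ ^ s) / ‖z.1 - z.2‖ ^ N := by
    unfold pairing
    rw [norm_rpow_add hz, abs_mul, abs_mul, abs_of_nonneg h0, abs_div (Q z),
      abs_of_pos (mul_pos hrN hrs), mul_div_assoc]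
    have e : |Q z| / (‖z.1 - z.2‖ ^ N * ‖z.1 - z.2‖ ^ s)
        = (|Q z| / ‖z.1 - z.2‖ ^ s) / ‖z.1 - z.2‖ ^ N := by
      rw [div_div, mul_comm]
    rw [e]
    refine mul_le_mul ?_ ?_ (by positivity) h0'
    · calc g (|P z| / ‖z.1 - z.2‖ ^ s) * |(P z / |P z|)|
          ≤ g (|P z| / ‖z.1 - z.2‖ ^ s) * 1 := mul_le_mul_of_nonneg_left hsg h0
        _ ≤ _ := by rw [mul_one]; exact h1
    · exact div_le_div_of_nonneg_right (div_le_div_of_nonneg_right hQ hrs.le) hrN.le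
  refine h3.trans ?_
  unfold modDensity
  refine (div_le_div_of_nonneg_right hy hrN.le).trans (le_of_eq ?_)
  ring

/-- The diagonal is a null set. -/
lemma ae_fst_ne_snd [Nonempty (Fin N)] :
    ∀ᵐ z ∂((volume : Measure (E N)).prod volume), z.1 ≠ z.2 := by
  have : MeasurableSet {z : E N × E N | z.1 ≠ z.2} :=
    (measurableSet_eq_fun measurable_fst measurable_snd).compl
  rw [Measure.ae_prod_iff_ae_ae this]
  refine Eventually.of_forall fun x => ?_
  have h : ∀ᵐ y ∂(volume : Measure (E N)), y ≠ x := by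
    rw [ae_iff]; simp
  exact h.mono fun y hy => hy.symm

end

/-! ### Inequalities between four numbers -/

section

variable {h : ℝ → ℝ}

lemma oddExt_of_pos {t : ℝ} (ht : 0 < t) : oddExt h t = h t := by
  rw [oddExt, abs_of_pos ht, div_self ht.ne', mul_one]

lemma oddExt_zero : oddExt h 0 = 0 := by simp [oddExt]

lemma oddExt_neg (t : ℝ) : oddExt h (-t) = -oddExt h t := by
  simp [oddExt, neg_div]

lemma oddExt_nonneg (h0 : ∀ t, 0 ≤ t → 0 ≤ h t) {t : ℝ} (ht : 0 ≤ t) : 0 ≤ oddExt h t := by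
  rcases ht.eq_or_lt with rfl | ht
  · rw [oddExt_zero]
  · rw [oddExt_of_pos ht]; exact h0 t ht.le

lemma oddExt_mono (h0 : ∀ t, 0 ≤ t → 0 ≤ h t) (hm : MonotoneOn h (Ici 0)) :
    Monotone (oddExt h) := by
  have key : ∀ a b : ℝ, 0 ≤ a → a ≤ b → oddExt h a ≤ oddExt h b := by
    intro a b ha hab
    rcases ha.eq_or_lt with rfl | ha
    · rw [oddExt_zero]; exact oddExt_nonneg h0 hab
    · rw [oddExt_of_pos ha, oddExt_of_pos (ha.trans_le hab)]
      exact hm ha.le (ha.le.trans hab) hab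
  intro a b hab
  rcases le_total 0 a with ha | ha
  · exact key a b ha hab
  rcases le_total 0 b with hb | hb
  · have h1 := oddExt_nonneg h0 (neg_nonneg.2 ha)
    rw [oddExt_neg] at h1
    linarith [oddExt_nonneg h0 hb]
  · have h1 := key (-b) (-a) (neg_nonneg.2 hb) (neg_le_neg hab)
    rw [oddExt_neg, oddExt_neg] at h1
    linarith

/-- The pointwise form of the Caccioppoli estimate: the increment `X` of the positive part of
the difference of two functions is controlled by the increment of the first function alone, up
to the energy density of the second one tested with that positive part. -/
lemma oddExt_mul_posPart_le (h0 : ∀ t, 0 ≤ t → 0 ≤ h t) (hm : MonotoneOn h (Ici 0))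
    (a b c d : ℝ) :
    oddExt h (c - d) * (max (a - c) 0 - max (b - d) 0) ≤ 4 * (h |a - b| * |a - b|)
      - h (|max (a - c) 0 - max (b - d) 0| / 2) * |max (a - c) 0 - max (b - d) 0| := by
  wlog hX : max (b - d) 0 ≤ max (a - c) 0 generalizing a b c d with H
  · have := H b a d c (le_of_not_ge hX)
    rw [abs_sub_comm b a, abs_sub_comm (max (b - d) 0), ← neg_sub c d, oddExt_neg] at this
    linarith
  rcases hX.eq_or_lt with hX | hX
  · rw [hX]
    simp only [sub_self, mul_zero, abs_zero, sub_zero]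
    have := mul_nonneg (h0 _ (abs_nonneg (a - b))) (abs_nonneg (a - b))
    linarith
  have hac : 0 < a - c := by
    by_contra hcon
    rw [max_eq_right (not_lt.1 hcon)] at hX
    exact absurd (le_max_right (b - d) 0) (not_le.2 hX)
  rw [max_eq_left hac.le] at hX ⊢
  set X := a - c - max (b - d) 0 with hXdef
  have hX0 : 0 < X := sub_pos.2 hX
  rw [abs_of_pos hX0]
  have hmon := oddExt_mono h0 hm
  have hY : c - d ≤ |a - b| - X := by
    have := le_max_left (b - d) 0
    have := le_abs_self (a - b)
    rw [hXdef]; linarith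
  have hA := h0 _ (abs_nonneg (a - b))
  by_cases hc : |a - b| ≤ X / 2
  · have h1 : oddExt h (c - d) ≤ -h (X / 2) := by
      rw [← oddExt_of_pos (h := h) (half_pos hX0), ← oddExt_neg]
      exact hmon (by linarith)
    have := mul_le_mul_of_nonneg_right h1 hX0.le
    have := mul_nonneg hA (abs_nonneg (a - b))
    linarith
  · have hc := not_le.1 hc
    have hpos : 0 < |a - b| := (half_pos hX0).trans hc
    have h1 : oddExt h (c - d) ≤ h |a - b| := by
      rw [← oddExt_of_pos (h := h) hpos]
      exact hmon (by linarith)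
    have h2 : h (X / 2) ≤ h |a - b| := hm (half_pos hX0).le hpos.le hc.le
    have h3 := mul_le_mul_of_nonneg_right h1 hX0.le
    have h4 := mul_le_mul_of_nonneg_right h2 hX0.le
    have h5 := mul_le_mul_of_nonneg_left (show X ≤ 2 * |a - b| by linarith) hA
    linarith

/-- Replacing `u` by `(u - ε)⁺` lowers the energy density against a nonnegative function
supported in `{u > ε}`. -/
lemma oddExt_trunc_mul_le (h0 : ∀ t, 0 ≤ t → 0 ≤ h t) (hm : MonotoneOn h (Ici 0))
    {a b e φ₁ φ₂ : ℝ} (hφ₁ : 0 ≤ φ₁) (hφ₂ : 0 ≤ φ₂)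
    (h1 : max (a - e) 0 = 0 → φ₁ = 0) (h2 : max (b - e) 0 = 0 → φ₂ = 0) :
    oddExt h (max (a - e) 0 - max (b - e) 0) * (φ₁ - φ₂) ≤ oddExt h (a - b) * (φ₁ - φ₂) := by
  wlog hX : φ₂ ≤ φ₁ generalizing a b φ₁ φ₂ with H
  · have := H hφ₂ hφ₁ h2 h1 (le_of_not_ge hX)
    rw [← neg_sub (max (a - e) 0), ← neg_sub a b, oddExt_neg, oddExt_neg] at this
    linarith
  rcases hX.eq_or_lt with rfl | hX
  · simp
  refine mul_le_mul_of_nonneg_right (oddExt_mono h0 hm ?_) (sub_nonneg.2 hX.le)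
  have ha : 0 < a - e := by
    by_contra hcon
    exact (hφ₂.trans_lt hX).ne' (h1 (max_eq_right (not_lt.1 hcon)))
  rw [max_eq_left ha.le]
  linarith [le_max_left (b - e) 0]

end

/-! ### The Picone test functions -/

section

variable {q : ℝ}

/-- The perspective `X^q A^{1-q}` of the power `q`, a convex function of `(X, A)`. -/
noncomputable def persp (q X A : ℝ) : ℝ := X ^ q * A ^ (1 - q)

/-- The test function `(a^q - c^q)⁺ / a^{q-1}` of the problem solved by `a`. -/
noncomputable def piconeFst (q a c : ℝ) : ℝ := max (a ^ q - c ^ q) 0 * a ^ (1 - q)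

/-- The test function `(a^q - c^q)⁺ / c^{q-1}` of the problem solved by `c`. -/
noncomputable def piconeSnd (q a c : ℝ) : ℝ := max (a ^ q - c ^ q) 0 * c ^ (1 - q)

lemma persp_eq {X A : ℝ} (hX : 0 ≤ X) (hA : 0 < A) : persp q X A = A * (X / A) ^ q := by
  rw [persp, Real.div_rpow hX hA.le, Real.rpow_sub hA, Real.rpow_one]
  field_simp

lemma rpow_tangent_le (hq : 1 < q) {x y : ℝ} (hx : 0 ≤ x) (hy : 0 ≤ y) :
    x ^ q + q * x ^ (q - 1) * (y - x) ≤ y ^ q := by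
  rcases hx.eq_or_lt with rfl | hx
  · rw [Real.zero_rpow (by linarith), Real.zero_rpow (by linarith)]
    simpa using Real.rpow_nonneg hy q
  have h := one_add_mul_self_le_rpow_one_add (s := y / x - 1)
    (by have := div_nonneg hy hx.le; linarith) hq.le
  rw [add_sub_cancel, Real.div_rpow hy hx.le, le_div_iff₀ (Real.rpow_pos_of_pos hx q)] at h
  refine le_trans (le_of_eq ?_) h
  rw [Real.rpow_sub hx, Real.rpow_one]
  field_simp

lemma persp_tangent (hq : 1 < q) {X X' A A' : ℝ} (hX : 0 ≤ X) (hX' : 0 ≤ X') (hA : 0 < A)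
    (hA' : 0 < A') : persp q X A - persp q X' A'
      ≤ q * (X / A) ^ (q - 1) * (X - X') - (q - 1) * (X / A) ^ q * (A - A') := by
  rw [persp_eq hX hA, persp_eq hX' hA']
  have h := mul_le_mul_of_nonneg_left
    (rpow_tangent_le hq (div_nonneg hX hA.le) (div_nonneg hX' hA'.le)) hA'.le
  have hρ : (X / A) ^ q * A = (X / A) ^ (q - 1) * X := by
    rcases hX.eq_or_lt with rfl | hX
    · simp [Real.zero_rpow (by linarith : q ≠ 0)]
    · have h0 := div_pos hX hA
      rw [Real.rpow_sub h0, Real.rpow_one]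
      field_simp
  have e : A' * (q * (X / A) ^ (q - 1) * (X' / A' - X / A))
      = q * (X / A) ^ (q - 1) * X' - q * A' * ((X / A) ^ q) := by
    have e2 : (X / A) ^ (q - 1) * (X / A) = (X / A) ^ q := by
      rw [← mul_div_assoc, ← hρ]; field_simp
    rw [← e2]; field_simp
  rw [mul_add, e] at h
  nlinarith [h, hρ]

/-- The perspective is Lipschitz on each cone `X ≤ B A`. -/
lemma abs_persp_sub_le (hq : 1 < q) {X X' A A' B : ℝ} (hX : 0 ≤ X) (hX' : 0 ≤ X') (hA : 0 < A)
    (hA' : 0 < A') (hB : 1 ≤ B) (h : X ≤ B * A) (h' : X' ≤ B * A') :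
    |persp q X A - persp q X' A'| ≤ q * B ^ q * (|X - X'| + |A - A'|) := by
  have key : ∀ X X' A A' : ℝ, 0 ≤ X → 0 ≤ X' → 0 < A → 0 < A' → X ≤ B * A →
      persp q X A - persp q X' A' ≤ q * B ^ q * (|X - X'| + |A - A'|) := by
    intro X X' A A' hX hX' hA hA' h
    have hρ0 : 0 ≤ X / A := div_nonneg hX hA.le
    have hρ : X / A ≤ B := (div_le_iff₀ hA).2 h
    have hB0 : 0 ≤ B := zero_le_one.trans hB
    have h1 : (X / A) ^ (q - 1) ≤ B ^ q :=
      (Real.rpow_le_rpow hρ0 hρ (by linarith)).trans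
        (Real.rpow_le_rpow_of_exponent_le hB (by linarith))
    have h2 : (X / A) ^ q ≤ B ^ q := Real.rpow_le_rpow hρ0 hρ (by linarith)
    have h3 : 0 ≤ (X / A) ^ (q - 1) := Real.rpow_nonneg hρ0 _
    have h4 : 0 ≤ (X / A) ^ q := Real.rpow_nonneg hρ0 _
    have h5 : (X / A) ^ (q - 1) * (X - X') ≤ B ^ q * |X - X'| :=
      (mul_le_mul_of_nonneg_left (le_abs_self _) h3).trans
        (mul_le_mul_of_nonneg_right h1 (abs_nonneg _))
    have h6 : -((X / A) ^ q * (A - A')) ≤ B ^ q * |A - A'| := by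
      rw [← mul_neg]
      exact (mul_le_mul_of_nonneg_left (neg_le_abs _) h4).trans
        (mul_le_mul_of_nonneg_right h2 (abs_nonneg _))
    have h7 := persp_tangent hq hX hX' hA hA'
    have h8 : 0 ≤ B ^ q * |A - A'| := by positivity
    have h9 := mul_le_mul_of_nonneg_left h5 (by linarith : 0 ≤ q)
    have h10 := mul_le_mul_of_nonneg_left h6 (by linarith : 0 ≤ q - 1)
    nlinarith
  rw [abs_le]
  constructor
  · have := key X' X A' A hX' hX hA' hA h'
    rw [abs_sub_comm X', abs_sub_comm A'] at this
    linarith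
  · exact key X X' A A' hX hX' hA hA' h

/-- Discrete Picone inequality. -/
lemma persp_add_le (hq : 1 < q) {X Y A B : ℝ} (hX : 0 ≤ X) (hY : 0 ≤ Y) (hA : 0 < A)
    (hB : 0 < B) : persp q (X + Y) (A + B) ≤ persp q X A + persp q Y B := by
  rw [persp_eq (add_nonneg hX hY) (add_pos hA hB), persp_eq hX hA, persp_eq hY hB]
  have hAB := add_pos hA hB
  have h := (convexOn_rpow hq.le).2 (mem_Ici.2 (div_nonneg hX hA.le))
    (mem_Ici.2 (div_nonneg hY hB.le)) (div_nonneg hA.le hAB.le) (div_nonneg hB.le hAB.le)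
    (by field_simp)
  simp only [smul_eq_mul] at h
  have e : A / (A + B) * (X / A) + B / (A + B) * (Y / B) = (X + Y) / (A + B) := by
    field_simp
  rw [e] at h
  refine (mul_le_mul_of_nonneg_left h hAB.le).trans (le_of_eq ?_)
  field_simp

lemma piconeFst_eq (hq : 1 < q) {a c : ℝ} (hc : 0 ≤ c) (ha : 0 < a) :
    piconeFst q a c = a - persp q (min a c) a := by
  have hs : a ^ q * a ^ (1 - q) = a := by
    rw [← Real.rpow_add ha]; simp
  rw [piconeFst, persp]
  rcases le_total c a with h | h
  · rw [max_eq_left (sub_nonneg.2 (Real.rpow_le_rpow hc h (by linarith))), min_eq_right h, sub_mul,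
      hs]
  · rw [max_eq_right (sub_nonpos.2 (Real.rpow_le_rpow ha.le h (by linarith))), min_eq_left h, hs]
    simp

lemma piconeSnd_eq (hq : 1 < q) {a c : ℝ} (ha : 0 ≤ a) (hc : 0 < c) :
    piconeSnd q a c = persp q (max a c) c - c := by
  have hs : c ^ q * c ^ (1 - q) = c := by
    rw [← Real.rpow_add hc]; simp
  rw [piconeSnd, persp]
  rcases le_total c a with h | h
  · rw [max_eq_left (sub_nonneg.2 (Real.rpow_le_rpow hc.le h (by linarith))), max_eq_left h,
      sub_mul, hs]
  · rw [max_eq_right (sub_nonpos.2 (Real.rpow_le_rpow ha h (by linarith))), max_eq_right h, hs]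
    simp

lemma piconeFst_zero_left (hq : 1 < q) {c : ℝ} : piconeFst q 0 c = 0 := by
  rw [piconeFst, Real.zero_rpow (by linarith : (1 - q) ≠ 0), mul_zero]

lemma piconeSnd_zero_left (hq : 1 < q) {c : ℝ} (hc : 0 ≤ c) : piconeSnd q 0 c = 0 := by
  rw [piconeSnd, Real.zero_rpow (by linarith : q ≠ 0), zero_sub,
    max_eq_right (neg_nonpos.2 (Real.rpow_nonneg hc _)), zero_mul]

lemma piconeFst_eq_zero (hq : 1 < q) {a c : ℝ} (ha : 0 ≤ a) (h : a ≤ c) :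
    piconeFst q a c = 0 := by
  rw [piconeFst, max_eq_right (sub_nonpos.2 (Real.rpow_le_rpow ha h (by linarith))), zero_mul]

lemma piconeSnd_eq_zero (hq : 1 < q) {a c : ℝ} (ha : 0 ≤ a) (h : a ≤ c) :
    piconeSnd q a c = 0 := by
  rw [piconeSnd, max_eq_right (sub_nonpos.2 (Real.rpow_le_rpow ha h (by linarith))), zero_mul]

lemma piconeFst_nonneg {a c : ℝ} (ha : 0 ≤ a) : 0 ≤ piconeFst q a c :=
  mul_nonneg (le_max_right _ _) (Real.rpow_nonneg ha _)

lemma piconeSnd_nonneg {a c : ℝ} (hc : 0 ≤ c) : 0 ≤ piconeSnd q a c :=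
  mul_nonneg (le_max_right _ _) (Real.rpow_nonneg hc _)

lemma piconeFst_le_self (hq : 1 < q) {a c : ℝ} (ha : 0 ≤ a) (hc : 0 ≤ c) :
    piconeFst q a c ≤ a := by
  rcases ha.eq_or_lt with rfl | ha
  · rw [piconeFst_zero_left hq]
  · rw [piconeFst_eq hq hc ha, persp]
    have : 0 ≤ min a c := le_min ha.le hc
    have : 0 ≤ min a c ^ q * a ^ (1 - q) := by positivity
    linarith

lemma piconeFst_le_piconeSnd (hq : 1 < q) {a c : ℝ} (ha : 0 ≤ a) (hc : 0 < c) :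
    piconeFst q a c ≤ piconeSnd q a c := by
  rcases le_total a c with h | h
  · rw [piconeFst_eq_zero hq ha h, piconeSnd_eq_zero hq ha h]
  · exact mul_le_mul_of_nonneg_left (Real.rpow_le_rpow_of_nonpos hc h (by linarith))
      (le_max_right _ _)

lemma piconeFst_mono (hq : 1 < q) {a b c : ℝ} (ha : 0 ≤ a) (hc : 0 ≤ c) (hab : a ≤ b) :
    piconeFst q a c ≤ piconeFst q b c := by
  rcases le_total a c with h | h
  · rw [piconeFst_eq_zero hq ha h]; exact piconeFst_nonneg (ha.trans hab)
  rcases ha.eq_or_lt with rfl | ha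
  · rw [piconeFst_zero_left hq]; exact piconeFst_nonneg hab
  rw [piconeFst_eq hq hc ha, piconeFst_eq hq hc (ha.trans_le hab), min_eq_right h,
    min_eq_right (h.trans hab)]
  have : persp q c b ≤ persp q c a := mul_le_mul_of_nonneg_left
    (Real.rpow_le_rpow_of_nonpos ha hab (by linarith)) (Real.rpow_nonneg hc _)
  linarith

lemma piconeFst_anti (hq : 1 < q) {a c d : ℝ} (ha : 0 ≤ a) (hc : 0 ≤ c) (hcd : c ≤ d) :
    piconeFst q a d ≤ piconeFst q a c :=
  mul_le_mul_of_nonneg_right (max_le_max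
    (sub_le_sub_left (Real.rpow_le_rpow hc hcd (by linarith)) _) le_rfl) (Real.rpow_nonneg ha _)

lemma piconeSnd_mono (hq : 1 < q) {a b c : ℝ} (ha : 0 ≤ a) (hc : 0 ≤ c) (hab : a ≤ b) :
    piconeSnd q a c ≤ piconeSnd q b c :=
  mul_le_mul_of_nonneg_right (max_le_max
    (sub_le_sub_right (Real.rpow_le_rpow ha hab (by linarith)) _) le_rfl) (Real.rpow_nonneg hc _)

lemma piconeSnd_anti (hq : 1 < q) {a c d : ℝ} (hc : 0 ≤ c) (hca : c = 0 → a = 0)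
    (hcd : c ≤ d) : piconeSnd q a d ≤ piconeSnd q a c := by
  rcases hc.eq_or_lt with rfl | hc
  · rw [hca rfl, piconeSnd_zero_left hq hcd, piconeSnd_zero_left hq le_rfl]
  · exact mul_le_mul (max_le_max
      (sub_le_sub_left (Real.rpow_le_rpow hc.le hcd (by linarith)) _) le_rfl)
      (Real.rpow_le_rpow_of_nonpos hc hcd (by linarith)) (Real.rpow_nonneg (hc.le.trans hcd) _)
      (le_max_right _ _)

/-- `piconeFst` is a Lipschitz function of `a` and `(a - c)⁺`. -/
lemma abs_piconeFst_sub_le (hq : 1 < q) {a b c d : ℝ} (ha : 0 ≤ a) (hb : 0 ≤ b) (hc : 0 ≤ c)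
    (hd : 0 ≤ d) : |piconeFst q a c - piconeFst q b d|
      ≤ (1 + 2 * q) * (|a - b| + |max (a - c) 0 - max (b - d) 0|) := by
  have hn1 := abs_nonneg (a - b)
  have hn2 := abs_nonneg (max (a - c) 0 - max (b - d) 0)
  have hn : |a - b| ≤ (1 + 2 * q) * (|a - b| + |max (a - c) 0 - max (b - d) 0|) := by nlinarith
  rcases ha.eq_or_lt with rfl | ha
  · refine le_trans ?_ hn
    rw [piconeFst_zero_left hq, zero_sub, zero_sub, abs_neg, abs_neg,
      abs_of_nonneg (piconeFst_nonneg hb), abs_of_nonneg hb]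
    exact piconeFst_le_self hq hb hd
  rcases hb.eq_or_lt with rfl | hb
  · refine le_trans ?_ hn
    rw [piconeFst_zero_left hq, sub_zero, sub_zero, abs_of_nonneg (piconeFst_nonneg ha.le),
      abs_of_pos ha]
    exact piconeFst_le_self hq ha.le hc
  rw [piconeFst_eq hq hc ha, piconeFst_eq hq hd hb]
  have h := abs_persp_sub_le hq (B := 1) (le_min ha.le hc) (le_min hb.le hd) ha hb le_rfl
    (by rw [one_mul]; exact min_le_left _ _) (by rw [one_mul]; exact min_le_left _ _)
  rw [Real.one_rpow, mul_one] at h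
  have hmin : ∀ x y : ℝ, min x y = x - max (x - y) 0 := by
    intro x y
    rcases le_total x y with h | h
    · rw [min_eq_left h, max_eq_right (sub_nonpos.2 h), sub_zero]
    · rw [min_eq_right h, max_eq_left (sub_nonneg.2 h)]; ring
  have h2 : |min a c - min b d| ≤ |a - b| + |max (a - c) 0 - max (b - d) 0| := by
    rw [hmin a c, hmin b d]
    refine le_trans (le_of_eq ?_) (abs_sub _ _)
    congr 1; ring
  have h3 : a - persp q (min a c) a - (b - persp q (min b d) b)
      = (a - b) - (persp q (min a c) a - persp q (min b d) b) := by ring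
  rw [h3]
  refine (abs_sub _ _).trans ?_
  nlinarith

/-- On bounded sets away from `c = 0`, `piconeSnd` is a Lipschitz function of `a` and `c`. -/
lemma abs_piconeSnd_sub_le (hq : 1 < q) {a b c d m M : ℝ} (hm : 0 < m) (hmM : m ≤ M)
    (ha : 0 ≤ a) (hb : 0 ≤ b) (haM : a ≤ M) (hbM : b ≤ M) (hc : m ≤ c) (hd : m ≤ d) :
    |piconeSnd q a c - piconeSnd q b d|
      ≤ (1 + 2 * q * (M / m) ^ q) * (|a - b| + |c - d|) := by
  have hc0 := hm.trans_le hc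
  have hd0 := hm.trans_le hd
  rw [piconeSnd_eq hq ha hc0, piconeSnd_eq hq hb hd0]
  have hB : 1 ≤ M / m := (one_le_div hm).2 hmM
  have key : ∀ x y, x ≤ M → m ≤ y → max x y ≤ M / m * y := by
    intro x y hx hy
    refine max_le ?_ ?_
    · refine hx.trans ?_
      rw [div_mul_eq_mul_div, le_div_iff₀ hm]
      exact mul_le_mul_of_nonneg_left hy (hm.le.trans hmM)
    · exact le_mul_of_one_le_left (hm.le.trans hy) hB
  have h := abs_persp_sub_le hq (ha.trans (le_max_left a c)) (hb.trans (le_max_left b d)) hc0 hd0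
    hB (key a c haM hc) (key b d hbM hd)
  have h2 : |max a c - max b d| ≤ |a - b| + |c - d| :=
    (abs_max_sub_max_le_max a c b d).trans
      (max_le (le_add_of_nonneg_right (abs_nonneg _)) (le_add_of_nonneg_left (abs_nonneg _)))
  have h3 : persp q (max a c) c - c - (persp q (max b d) d - d)
      = (persp q (max a c) c - persp q (max b d) d) - (c - d) := by ring
  rw [h3]
  refine (abs_sub _ _).trans ?_
  have hK : 0 ≤ q * (M / m) ^ q := by positivity
  have := abs_nonneg (a - b)
  have := mul_le_mul_of_nonneg_left h2 hK
  have := mul_nonneg hK (abs_nonneg (a - b))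
  nlinarith

/-- The pointwise comparison inequality. For increments of the same sign it is the discrete
Picone inequality, applied once to each pair of functions and combined with the monotonicity
of `h(t) t^{1-q}`; for increments of opposite signs both sides have a sign. -/
lemma picone_le {h : ℝ → ℝ} (hq : 1 < q) (h0 : ∀ t, 0 ≤ t → 0 ≤ h t)
    (hm : MonotoneOn h (Ici 0))
    (hr : ∀ R P, 0 < R → R ≤ P → h R * R ^ (1 - q) ≤ h P * P ^ (1 - q))
    {a b c d : ℝ} (ha : 0 ≤ a) (hb : 0 ≤ b) (hc : 0 ≤ c) (hd : 0 ≤ d)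
    (hca : c = 0 → a = 0) (hdb : d = 0 → b = 0) :
    oddExt h (c - d) * (piconeSnd q a c - piconeSnd q b d)
      ≤ oddExt h (a - b) * (piconeFst q a c - piconeFst q b d) := by
  wlog hab : b ≤ a generalizing a b c d with H
  · have := H hb ha hd hc hdb hca (le_of_not_ge hab)
    rw [← neg_sub a b, ← neg_sub c d, oddExt_neg, oddExt_neg] at this
    linarith
  -- increments of opposite signs
  rcases le_or_gt c d with hcd | hcd
  · have h1 : piconeSnd q b d ≤ piconeSnd q a c :=
      (piconeSnd_mono hq hb hd hab).trans (piconeSnd_anti hq hc hca hcd)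
    have h2 : piconeFst q b d ≤ piconeFst q a c :=
      (piconeFst_mono hq hb hd hab).trans (piconeFst_anti hq ha hc hcd)
    have h3 := oddExt_nonneg h0 (sub_nonneg.2 hcd)
    rw [← neg_sub c d, oddExt_neg] at h3
    have h4 := oddExt_nonneg h0 (sub_nonneg.2 hab)
    have h5 := mul_nonneg h4 (sub_nonneg.2 h2)
    have h6 := mul_nonneg h3 (sub_nonneg.2 h1)
    linarith
  rcases hab.eq_or_lt with rfl | hab
  · rw [sub_self, oddExt_zero, zero_mul]
    have h1 : piconeSnd q b c ≤ piconeSnd q b d := piconeSnd_anti hq hd hdb hcd.le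
    have h2 := oddExt_nonneg h0 (sub_nonneg.2 hcd.le)
    exact mul_nonpos_of_nonneg_of_nonpos h2 (sub_nonpos.2 h1)
  have hP : 0 < a - b := sub_pos.2 hab
  have hR : 0 < c - d := sub_pos.2 hcd
  have ha0 : 0 < a := hb.trans_lt hab
  have hc0 : 0 < c := hd.trans_lt hcd
  rw [oddExt_of_pos hP, oddExt_of_pos hR]
  have hgP := h0 _ hP.le
  have hgR := h0 _ hR.le
  rcases le_or_gt b d with hbd | hbd
  · rw [piconeSnd_eq_zero hq hb hbd, piconeFst_eq_zero hq hb hbd, sub_zero, sub_zero]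
    rcases le_total a c with hac | hac
    · rw [piconeSnd_eq_zero hq ha hac, piconeFst_eq_zero hq ha hac, mul_zero, mul_zero]
    -- here `(a - b) / (c - d) ≥ a / c`
    have h1 := hr (c - d) (a - b) hR (by linarith)
    have h2 : a * (c - d) ≤ (a - b) * c := by nlinarith
    unfold piconeFst piconeSnd
    have hM : 0 ≤ max (a ^ q - c ^ q) 0 := le_max_right _ _
    suffices hs : h (c - d) * c ^ (1 - q) ≤ h (a - b) * a ^ (1 - q) by
      have := mul_le_mul_of_nonneg_left hs hM
      linarith
    have h3 : (a - b) ^ (1 - q) * c ^ (1 - q) ≤ a ^ (1 - q) * (c - d) ^ (1 - q) := by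
      rw [← Real.mul_rpow hP.le hc, ← Real.mul_rpow ha hR.le]
      exact Real.rpow_le_rpow_of_nonpos (mul_pos ha0 hR) h2 (by linarith)
    have hRq : 0 < (c - d) ^ (1 - q) := Real.rpow_pos_of_pos hR _
    refine le_of_mul_le_mul_right ?_ hRq
    have h4 := mul_le_mul_of_nonneg_right h1 (Real.rpow_nonneg hc (1 - q))
    have h5 := mul_le_mul_of_nonneg_left h3 hgP
    linarith
  have hb0 : 0 < b := hd.trans_lt hbd
  have hd0 : 0 < d := lt_of_le_of_ne hd fun h => hb0.ne' (hdb h.symm)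
  rcases le_or_gt a c with hac | hac
  · rw [piconeSnd_eq_zero hq ha hac, piconeFst_eq_zero hq ha hac, zero_sub, zero_sub]
    have h1 := piconeFst_le_piconeSnd hq hb hd0
    have h2 : h (a - b) ≤ h (c - d) := hm hP.le hR.le (by linarith)
    have h3 := mul_le_mul h2 h1 (piconeFst_nonneg hb) hgR
    linarith
  rw [piconeSnd_eq hq ha hc0, piconeSnd_eq hq hb hd0, piconeFst_eq hq hc ha0,
    piconeFst_eq hq hd hb0, min_eq_right hac.le, min_eq_right hbd.le, max_eq_left hac.le,
    max_eq_left hbd.le]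
  have h1 := persp_add_le hq hd hR.le hb0 hP
  have h2 := persp_add_le hq hb hP.le hd0 hR
  rw [add_sub_cancel, add_sub_cancel] at h1 h2
  set P := a - b with hPdef
  set R := c - d with hRdef
  have hPP : P ^ q * P ^ (1 - q) = P := by rw [← Real.rpow_add hP]; simp
  have hRR : R ^ q * R ^ (1 - q) = R := by rw [← Real.rpow_add hR]; simp
  have h3 : h P * (P - persp q R P) ≤ h P * (a - persp q c a - (b - persp q d b)) :=
    mul_le_mul_of_nonneg_left (by linarith) hgP
  have h4 : h R * (persp q a c - c - (persp q b d - d)) ≤ h R * (persp q P R - R) :=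
    mul_le_mul_of_nonneg_left (by linarith) hgR
  refine h4.trans (le_trans ?_ h3)
  have e1 : persp q P R - R = (P ^ q - R ^ q) * R ^ (1 - q) := by
    rw [persp, sub_mul, hRR]
  have e2 : P - persp q R P = (P ^ q - R ^ q) * P ^ (1 - q) := by
    rw [persp, sub_mul, hPP]
  rw [e1, e2]
  have h5 : 0 ≤ (P ^ q - R ^ q) * (h P * P ^ (1 - q) - h R * R ^ (1 - q)) := by
    rcases le_total R P with hRP | hRP
    · exact mul_nonneg (sub_nonneg.2 (Real.rpow_le_rpow hR.le hRP (by linarith)))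
        (sub_nonneg.2 (hr R P hR hRP))
    · exact mul_nonneg_of_nonpos_of_nonpos
        (sub_nonpos.2 (Real.rpow_le_rpow hP.le hRP (by linarith)))
        (sub_nonpos.2 (hr P R hP hRP))
  linarith

end

/-! ### Exterior balls and the fractional Hardy inequality -/

section

variable {N : ℕ} {Ω : Set (E N)}

/-- Near a boundary point, the complement of a Lipschitz domain contains a cone. -/
lemma HasLipschitzBoundary.exists_ball_compl (hΩ : HasLipschitzBoundary Ω) (ho : IsOpen Ω)
    (hb : Bornology.IsBounded Ω) : ∃ κ t₀ : ℝ, 0 < κ ∧ κ ≤ 1 ∧ 0 < t₀ ∧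
      ∀ x ∈ frontier Ω, ∀ t, 0 < t → t ≤ t₀ → ∃ c, dist c x ≤ t ∧ Metric.ball c (κ * t) ⊆ Ωᶜ := by
  have hcpt : IsCompact (frontier Ω) :=
    Metric.isCompact_of_isClosed_isBounded isClosed_frontier
      (hb.closure.subset frontier_subset_closure)
  refine hcpt.induction_on (p := fun S => ∃ κ t₀ : ℝ, 0 < κ ∧ κ ≤ 1 ∧ 0 < t₀ ∧
      ∀ x ∈ S, ∀ t, 0 < t → t ≤ t₀ → ∃ c, dist c x ≤ t ∧ Metric.ball c (κ * t) ⊆ Ωᶜ)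
    ⟨1, 1, one_pos, le_rfl, one_pos, fun x hx => absurd hx (notMem_empty x)⟩ ?_ ?_ ?_
  · rintro S T hST ⟨κ, t₀, h1, h2, h3, h4⟩
    exact ⟨κ, t₀, h1, h2, h3, fun x hx => h4 x (hST hx)⟩
  · rintro S T ⟨κ, t₀, h1, h2, h3, h4⟩ ⟨κ', t₀', h1', h2', h3', h4'⟩
    refine ⟨min κ κ', min t₀ t₀', lt_min h1 h1', (min_le_left _ _).trans h2, lt_min h3 h3', ?_⟩
    rintro x (hx | hx) t ht htt
    · obtain ⟨c, hc, hc'⟩ := h4 x hx t ht (htt.trans (min_le_left _ _))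
      exact ⟨c, hc, (Metric.ball_subset_ball
        (mul_le_mul_of_nonneg_right (min_le_left _ _) ht.le)).trans hc'⟩
    · obtain ⟨c, hc, hc'⟩ := h4' x hx t ht (htt.trans (min_le_right _ _))
      exact ⟨c, hc, (Metric.ball_subset_ball
        (mul_le_mul_of_nonneg_right (min_le_right _ _) ht.le)).trans hc'⟩
  · intro x₀ hx₀
    obtain ⟨e, γ, L, r, he, hL, hr, hγ⟩ := hΩ x₀ hx₀
    have hL0 : (0 : ℝ) ≤ L := L.2
    have hk : 0 < 1 + 2 * (L : ℝ) := by positivity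
    refine ⟨Metric.ball x₀ (r / 2) ∩ frontier Ω,
      inter_mem (mem_nhdsWithin_of_mem_nhds (Metric.ball_mem_nhds _ (half_pos hr)))
        self_mem_nhdsWithin, 1 / (1 + 2 * L), r / 4, by positivity,
      (div_le_one hk).2 (by linarith), by positivity, ?_⟩
    rintro x ⟨hx, hxf⟩ t ht htr
    have hxΩ : x ∉ Ω := fun h => by
      rw [ho.frontier_eq] at hxf; exact hxf.2 h
    refine ⟨x - t • e, by simp [norm_smul, he, abs_of_pos ht], ?_⟩
    intro y hy hyΩ
    set w : E N := y - (x - t • e) with hw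
    have hwn : ‖w‖ < 1 / (1 + 2 * L) * t := by rwa [hw, ← dist_eq_norm]
    have hκ : 1 / (1 + 2 * (L : ℝ)) ≤ 1 := (div_le_one hk).2 (by linarith)
    have hwt : ‖w‖ < t := hwn.trans_le (by nlinarith)
    have hwk : (1 + 2 * L) * ‖w‖ < t := by
      rw [one_div, inv_mul_eq_div, lt_div_iff₀ hk] at hwn
      linarith
    have hy' : y = x - t • e + w := by rw [hw]; abel
    have hyb : y ∈ Metric.ball x₀ r := by
      rw [Metric.mem_ball, dist_eq_norm]
      rw [Metric.mem_ball, dist_eq_norm] at hx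
      have : y - x₀ = (x - x₀) + (w - t • e) := by rw [hy']; abel
      rw [this]
      have h1 := norm_add_le (x - x₀) (w - t • e)
      have h2 := norm_sub_le w (t • e)
      rw [norm_smul, he, Real.norm_of_nonneg ht.le] at h2
      linarith
    have hxb : x ∈ Metric.ball x₀ r := Metric.ball_subset_ball (by linarith) hx
    have h1 := (hγ y hyb).1 hyΩ
    have h2 : inner ℝ e x ≤ γ (x - (inner ℝ e x : ℝ) • e) :=
      not_lt.1 fun h => hxΩ ((hγ x hxb).2 h)
    have hee : (inner ℝ e e : ℝ) = 1 := by rw [real_inner_self_eq_norm_sq, he]; norm_num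
    have h3 : (inner ℝ e y : ℝ) = inner ℝ e x - t + inner ℝ e w := by
      rw [hy', inner_add_right, inner_sub_right, inner_smul_right, hee, mul_one]
    have h4 : (y - (inner ℝ e y : ℝ) • e) - (x - (inner ℝ e x : ℝ) • e)
        = w - (inner ℝ e w : ℝ) • e := by
      rw [h3, hy']
      module
    have h5 : |(inner ℝ e w : ℝ)| ≤ ‖w‖ := by
      have := abs_real_inner_le_norm e w
      rwa [he, one_mul] at this
    have h6 := hL.dist_le_mul (y - (inner ℝ e y : ℝ) • e) (x - (inner ℝ e x : ℝ) • e)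
    rw [dist_eq_norm (y - _), h4, Real.dist_eq] at h6
    have h7 := norm_sub_le w ((inner ℝ e w : ℝ) • e)
    rw [norm_smul, he, mul_one, Real.norm_eq_abs] at h7
    have h8 : (L : ℝ) * ‖w - (inner ℝ e w : ℝ) • e‖ ≤ L * (2 * ‖w‖) :=
      mul_le_mul_of_nonneg_left (by linarith) hL0
    have h9 := (neg_le_abs _).trans (h6.trans h8)
    have h10 := (le_abs_self _).trans h5
    linarith

lemma IsBoundedLipschitzDomain.compl_nonempty [Nonempty (Fin N)]
    (hΩ : IsBoundedLipschitzDomain Ω) : (Ωᶜ).Nonempty := by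
  rw [nonempty_compl]
  rintro rfl
  exact NormedSpace.unbounded_univ ℝ (E N) hΩ.isBounded

lemma IsBoundedLipschitzDomain.infDist_pos [Nonempty (Fin N)]
    (hΩ : IsBoundedLipschitzDomain Ω) {x : E N} (hx : x ∈ Ω) : 0 < Metric.infDist x Ωᶜ :=
  (hΩ.isOpen.isClosed_compl.notMem_iff_infDist_pos hΩ.compl_nonempty).1 (not_not.2 hx)

/-- Every point of a bounded Lipschitz domain sees, at a distance comparable with its distance
to the boundary, a ball of comparable radius outside the domain. -/
lemma IsBoundedLipschitzDomain.exists_exterior_ball [Nonempty (Fin N)]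
    (hΩ : IsBoundedLipschitzDomain Ω) : ∃ κ : ℝ, 0 < κ ∧ ∀ x ∈ Ω, ∃ c : E N,
      Metric.ball c (κ * Metric.infDist x Ωᶜ) ⊆ Ωᶜ ∧
      Metric.ball c (κ * Metric.infDist x Ωᶜ) ⊆ Metric.closedBall x (3 * Metric.infDist x Ωᶜ) := by
  obtain ⟨κ, t₀, hκ, hκ1, ht₀, h⟩ := hΩ.lipschitz.exists_ball_compl hΩ.isOpen hΩ.isBounded
  obtain ⟨o, ho⟩ := hΩ.compl_nonempty
  obtain ⟨D', hD'⟩ := hΩ.isBounded.subset_closedBall o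
  set D := max D' 1
  have hD : 0 < D := zero_lt_one.trans_le (le_max_right _ _)
  refine ⟨κ * min 1 (t₀ / D), mul_pos hκ (lt_min one_pos (div_pos ht₀ hD)), fun x hx => ?_⟩
  have hd := hΩ.infDist_pos hx
  obtain ⟨x₁, hx₁, hdx⟩ := hΩ.isOpen.isClosed_compl.exists_infDist_eq_dist hΩ.compl_nonempty x
  set d := Metric.infDist x Ωᶜ with hddef
  have hdD : d ≤ D := (Metric.infDist_le_dist_of_mem ho).trans ((hD' hx).trans (le_max_left _ _))
  have hball : Metric.ball x d ⊆ Ω := by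
    intro y hy
    by_contra hcon
    have := Metric.infDist_le_dist_of_mem (x := x) (s := Ωᶜ) hcon
    rw [Metric.mem_ball, dist_comm] at hy
    linarith
  have hfr : x₁ ∈ frontier Ω := by
    rw [hΩ.isOpen.frontier_eq]
    refine ⟨closure_mono hball ?_, hx₁⟩
    rw [closure_ball x hd.ne', Metric.mem_closedBall, dist_comm]
    exact hdx.ge
  obtain ⟨c, hc, hc'⟩ := h x₁ hfr (min d t₀) (lt_min hd ht₀) (min_le_right _ _)
  have hrad : κ * min 1 (t₀ / D) * d ≤ κ * min d t₀ := by
    rw [mul_assoc]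
    refine mul_le_mul_of_nonneg_left (le_min ?_ ?_) hκ.le
    · exact mul_le_of_le_one_left hd.le (min_le_left _ _)
    · calc min 1 (t₀ / D) * d ≤ t₀ / D * D :=
            mul_le_mul (min_le_right _ _) hdD hd.le (div_pos ht₀ hD).le
        _ = t₀ := div_mul_cancel₀ _ hD.ne'
  refine ⟨c, (Metric.ball_subset_ball hrad).trans hc', fun y hy => ?_⟩
  have h1 : dist y c < κ * min d t₀ := Metric.ball_subset_ball hrad hy
  have h2 : κ * min d t₀ ≤ d := by
    have := min_le_left d t₀
    have h0 : 0 < min d t₀ := lt_min hd ht₀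
    nlinarith
  have h3 := min_le_left d t₀
  have h4 := dist_triangle4 y c x₁ x
  rw [dist_comm x₁ x, ← hdx] at h4
  rw [Metric.mem_closedBall]
  linarith

variable {s : ℝ} {G g : ℝ → ℝ} {q p : ℝ}

/-- Fractional Hardy inequality: since `z` vanishes on the exterior ball seen from `x`, the
inner integral of the modular of `z` bounds `G(|z(x)| / d(x)^s)`. -/
lemma IsBoundedLipschitzDomain.hardy [Nonempty (Fin N)] (hΩ : IsBoundedLipschitzDomain Ω)
    (hs : 0 < s) (hGg : GrowthPair G g q p) {z : E N → ℝ}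
    (hz : FinitePair s G (incr z))
    (hz0 : ∀ᵐ x ∂(volume : Measure (E N)), x ∉ Ω → z x = 0) :
    ∫⁻ x in Ω, ENNReal.ofReal (G (|z x| / Metric.infDist x Ωᶜ ^ s)) < ⊤ := by
  obtain ⟨κ, hκ, hball⟩ := hΩ.exists_exterior_ball
  set V : ℝ≥0∞ := volume (Metric.ball (0 : E N) 1) with hV
  have hV0 : V ≠ 0 := (Metric.measure_ball_pos _ _ one_pos).ne'
  have hVt : V ≠ ⊤ := measure_ball_lt_top.ne
  set A : ℝ≥0∞ := ENNReal.ofReal ((κ / 3) ^ N) * V with hA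
  have hA0 : A ≠ 0 := mul_ne_zero (by rw [Ne, ENNReal.ofReal_eq_zero, not_le]; positivity) hV0
  have hAt : A ≠ ⊤ := ENNReal.mul_ne_top ENNReal.ofReal_ne_top hVt
  set B : ℝ≥0∞ := ENNReal.ofReal (max 1 ((3 : ℝ) ^ s) ^ p) with hB
  have key : ∀ x ∈ Ω, ENNReal.ofReal (G (|z x| / Metric.infDist x Ωᶜ ^ s))
      ≤ (B * A⁻¹) * ∫⁻ y, ENNReal.ofReal (modDensity s G (incr z) (x, y)) := by
    intro x hx
    have hd := hΩ.infDist_pos hx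
    obtain ⟨c, hc1, hc2⟩ := hball x hx
    set d := Metric.infDist x Ωᶜ
    have h3d : 0 < 3 * d := by positivity
    have hlow : ENNReal.ofReal (G (|z x| / (3 * d) ^ s)) * A
        ≤ ∫⁻ y, ENNReal.ofReal (modDensity s G (incr z) (x, y)) := by
      calc ENNReal.ofReal (G (|z x| / (3 * d) ^ s)) * A
          = ENNReal.ofReal (G (|z x| / (3 * d) ^ s) / (3 * d) ^ N)
              * volume (Metric.ball c (κ * d)) := by
            rw [Measure.addHaar_ball volume c (by positivity : 0 ≤ κ * d), hA, ← mul_assoc,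
              ← mul_assoc, ← ENNReal.ofReal_mul (hGg.G_nonneg _ (by positivity)),
              ← ENNReal.ofReal_mul (div_nonneg (hGg.G_nonneg _ (by positivity)) (by positivity)),
              finrank_euclideanSpace_fin]
            congr 2
            rw [div_pow, mul_pow, mul_pow]
            field_simp
        _ = ∫⁻ _ in Metric.ball c (κ * d),
              ENNReal.ofReal (G (|z x| / (3 * d) ^ s) / (3 * d) ^ N) :=
            (setLIntegral_const _ _).symm
        _ ≤ ∫⁻ y in Metric.ball c (κ * d), ENNReal.ofReal (modDensity s G (incr z) (x, y)) := by
            refine lintegral_mono_ae ?_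
            rw [ae_restrict_iff' measurableSet_ball]
            filter_upwards [hz0] with y hy0 hy
            have hyΩ : y ∉ Ω := hc1 hy
            have hxy : 0 < ‖x - y‖ := norm_pos_iff.2 (sub_ne_zero.2 fun h => hyΩ (h ▸ hx))
            have hxy3 : ‖x - y‖ ≤ 3 * d := by
              have := hc2 hy
              rwa [Metric.mem_closedBall, dist_comm, dist_eq_norm] at this
            refine ENNReal.ofReal_le_ofReal ?_
            simp only [modDensity, incr, hy0 hyΩ, sub_zero]
            refine div_le_div₀ (hGg.G_nonneg _ (by positivity)) ?_ (by positivity)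
              (pow_le_pow_left₀ hxy.le hxy3 N)
            refine hGg.G_mono (mem_Ici.2 (by positivity)) (mem_Ici.2 (by positivity)) ?_
            exact div_le_div_of_nonneg_left (abs_nonneg _) (Real.rpow_pos_of_pos hxy s)
              (Real.rpow_le_rpow hxy.le hxy3 hs.le)
        _ ≤ _ := setLIntegral_le_lintegral _ _
    have hup : ENNReal.ofReal (G (|z x| / d ^ s))
        ≤ B * ENNReal.ofReal (G (|z x| / (3 * d) ^ s)) := by
      rw [hB, ← ENNReal.ofReal_mul (by positivity)]
      refine ENNReal.ofReal_le_ofReal ?_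
      have h := hGg.G_const_mul_le (l := (3 : ℝ) ^ s) (t := |z x| / (3 * d) ^ s) (by positivity)
        (by positivity)
      refine le_trans (le_of_eq ?_) h
      congr 1
      rw [Real.mul_rpow (by norm_num) hd.le]
      have h3 : (0 : ℝ) < 3 ^ s := by positivity
      have hds : 0 < d ^ s := Real.rpow_pos_of_pos hd _
      field_simp
    refine hup.trans ?_
    rw [mul_assoc]
    refine mul_le_mul_right ?_ B
    rw [← ENNReal.div_eq_inv_mul]
    exact (ENNReal.le_div_iff_mul_le (Or.inl hA0) (Or.inl hAt)).2 hlow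
  have hBA : B * A⁻¹ ≠ ⊤ := ENNReal.mul_ne_top ENNReal.ofReal_ne_top (ENNReal.inv_ne_top.2 hA0)
  have hfin := hz.lt_top
  rw [lintegral_prod _ (hGg.aemeasurable_modDensity hz.aemeasurable).ennreal_ofReal] at hfin
  calc ∫⁻ x in Ω, ENNReal.ofReal (G (|z x| / Metric.infDist x Ωᶜ ^ s))
      ≤ ∫⁻ x in Ω, (B * A⁻¹) * ∫⁻ y, ENNReal.ofReal (modDensity s G (incr z) (x, y)) :=
        setLIntegral_mono_ae' hΩ.isOpen.measurableSet (Eventually.of_forall key)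
    _ = (B * A⁻¹) * ∫⁻ x in Ω, ∫⁻ y, ENNReal.ofReal (modDensity s G (incr z) (x, y)) :=
        lintegral_const_mul' _ _ hBA
    _ ≤ (B * A⁻¹) * ∫⁻ x, ∫⁻ y, ENNReal.ofReal (modDensity s G (incr z) (x, y)) :=
        mul_le_mul_right (setLIntegral_le_lintegral _ _) _
    _ < ⊤ := ENNReal.mul_lt_top hBA.lt_top hfin

/-- The kernel `min(1, ρ) ρ^{-s} / ρ^N`, integrable on `ℝ^N` as a function of `ρ = |h|`. -/
noncomputable def hardyKernel (N : ℕ) (s ρ : ℝ) : ℝ := min 1 ρ * ρ ^ (-s) / ρ ^ N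

lemma measurable_hardyKernel : Measurable (hardyKernel N s) := by
  unfold hardyKernel
  fun_prop

lemma integrable_hardyKernel [Nonempty (Fin N)] (hs : 0 < s) (hs1 : s < 1) :
    Integrable (fun h : E N => hardyKernel N s ‖h‖) volume := by
  rw [integrable_fun_norm_addHaar, finrank_euclideanSpace_fin]
  have hN : 0 < N := Fin.pos_iff_nonempty.2 ‹_›
  have e : ∀ ρ : ℝ, 0 < ρ → ρ ^ (N - 1) • hardyKernel N s ρ = min 1 ρ * ρ ^ (-s - 1) := by
    intro ρ hρ
    obtain ⟨m, rfl⟩ : ∃ m, N = m + 1 := ⟨N - 1, by omega⟩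
    rw [hardyKernel, smul_eq_mul, Nat.add_sub_cancel, Real.rpow_sub hρ, Real.rpow_one, pow_succ]
    field_simp
  rw [← Ioc_union_Ioi_eq_Ioi (zero_le_one' ℝ)]
  refine IntegrableOn.union ?_ ?_
  · have h : IntegrableOn (fun ρ : ℝ => ρ ^ (-s)) (Ioc 0 1) :=
      (intervalIntegrable_iff_integrableOn_Ioc_of_le zero_le_one).1
        (intervalIntegral.intervalIntegrable_rpow' (by linarith))
    refine h.congr_fun (fun ρ hρ => ?_) measurableSet_Ioc
    simp only
    rw [e ρ hρ.1, min_eq_right hρ.2, mul_comm, ← Real.rpow_add_one hρ.1.ne']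
    congr 1; ring
  · have h : IntegrableOn (fun ρ : ℝ => ρ ^ (-s - 1)) (Ioi 1) :=
      integrableOn_Ioi_rpow_of_lt (by linarith) one_pos
    refine h.congr_fun (fun ρ hρ => ?_) measurableSet_Ioi
    simp only
    rw [e ρ (zero_lt_one.trans hρ), min_eq_left (le_of_lt hρ), one_mul]

lemma lintegral_hardyKernel_scaled (x : E N) {d : ℝ} (hd : 0 < d) :
    ∫⁻ y : E N, ENNReal.ofReal (hardyKernel N s (‖x - y‖ / d) / d ^ N)
      = ∫⁻ h : E N, ENNReal.ofReal (hardyKernel N s ‖h‖) := by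
  have hF : Measurable fun h : E N => ENNReal.ofReal (hardyKernel N s ‖h‖) :=
    (measurable_hardyKernel.comp measurable_norm).ennreal_ofReal
  have h1 : ∀ y : E N, ENNReal.ofReal (hardyKernel N s (‖x - y‖ / d) / d ^ N)
      = ENNReal.ofReal ((d ^ N)⁻¹) * ENNReal.ofReal (hardyKernel N s ‖d⁻¹ • (x - y)‖) := by
    intro y
    rw [← ENNReal.ofReal_mul (by positivity), norm_smul, Real.norm_of_nonneg (by positivity),
      div_eq_inv_mul, div_eq_inv_mul]
  simp_rw [h1]
  rw [lintegral_const_mul' _ _ ENNReal.ofReal_ne_top, lintegral_sub_left_eq_self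
    (fun y : E N => ENNReal.ofReal (hardyKernel N s ‖d⁻¹ • y‖))]
  have h2 := lintegral_map (μ := (volume : Measure (E N))) hF (measurable_const_smul d⁻¹)
  rw [← h2, Measure.map_addHaar_smul volume (inv_ne_zero hd.ne'), lintegral_smul_measure,
    finrank_euclideanSpace_fin, smul_eq_mul, ← mul_assoc, ← ENNReal.ofReal_mul (by positivity)]
  have : (d ^ N)⁻¹ * |((d⁻¹ ^ N)⁻¹)| = 1 := by
    rw [abs_of_pos (by positivity), inv_pow, inv_inv, inv_mul_cancel₀ (by positivity)]
  rw [this, ENNReal.ofReal_one, one_mul]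

/-- The bound of the contribution of the cutoff to the increments of a cut-off function. -/
noncomputable def hardyPair (Ω : Set (E N)) (z : E N → ℝ) (w : E N × E N) : ℝ :=
  4 * z w.1 * min 1 (‖w.1 - w.2‖ / Metric.infDist w.1 Ωᶜ)

lemma IsBoundedLipschitzDomain.finitePair_hardyPair [Nonempty (Fin N)]
    (hΩ : IsBoundedLipschitzDomain Ω)
    (hs : 0 < s) (hs1 : s < 1) (hGg : GrowthPair G g q p) {z : E N → ℝ}
    (hzm : AEMeasurable z volume) (hz : FinitePair s G (incr z))
    (hz0 : ∀ᵐ x ∂(volume : Measure (E N)), x ∉ Ω → z x = 0) :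
    FinitePair s G (hardyPair Ω z) := by
  have hm : AEMeasurable (hardyPair Ω z) ((volume : Measure (E N)).prod volume) := by
    have hd : Measurable fun w : E N × E N => min 1 (‖w.1 - w.2‖ / Metric.infDist w.1 Ωᶜ) := by
      have : Measurable fun x : E N => Metric.infDist x Ωᶜ := measurable_infDist
      fun_prop
    exact ((aemeasurable_comp_fst hzm).const_mul 4).mul hd.aemeasurable
  refine ⟨hm, ?_⟩
  rw [lintegral_prod _ (hGg.aemeasurable_modDensity hm).ennreal_ofReal]
  set K : ℝ≥0∞ := ∫⁻ h : E N, ENNReal.ofReal (hardyKernel N s ‖h‖) with hK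
  have hKt : K < ⊤ := by
    have h := (integrable_hardyKernel (N := N) hs hs1).2
    rwa [hasFiniteIntegral_iff_ofReal (Eventually.of_forall fun h => by
      unfold hardyKernel; positivity)] at h
  have key : ∀ x ∈ Ω, ∫⁻ y, ENNReal.ofReal (modDensity s G (hardyPair Ω z) (x, y))
      ≤ (ENNReal.ofReal (max 1 4 ^ p) * K)
        * ENNReal.ofReal (G (|z x| / Metric.infDist x Ωᶜ ^ s)) := by
    intro x hx
    have hd := hΩ.infDist_pos hx
    have hne : ∀ᵐ y ∂(volume : Measure (E N)), y ≠ x := by rw [ae_iff]; simp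
    set d := Metric.infDist x Ωᶜ with hddef
    set T := |z x| / d ^ s with hT
    have hT0 : 0 ≤ T := by positivity
    have hGT := hGg.G_nonneg T hT0
    calc ∫⁻ y, ENNReal.ofReal (modDensity s G (hardyPair Ω z) (x, y))
        ≤ ∫⁻ y, ENNReal.ofReal (max 1 4 ^ p * G T)
            * ENNReal.ofReal (hardyKernel N s (‖x - y‖ / d) / d ^ N) := by
          refine lintegral_mono_ae (hne.mono fun y hy => ?_)
          rw [← ENNReal.ofReal_mul (by positivity)]
          refine ENNReal.ofReal_le_ofReal ?_
          have hr : 0 < ‖x - y‖ := norm_pos_iff.2 (sub_ne_zero.2 hy.symm)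
          set ρ := ‖x - y‖ / d with hρ
          have hρ0 : 0 < ρ := div_pos hr hd
          have hrρ : ‖x - y‖ = ρ * d := by rw [hρ]; field_simp
          have hl0 : 0 ≤ min 1 ρ * ρ ^ (-s) := by positivity
          have hl1 : min 1 ρ * ρ ^ (-s) ≤ 1 := by
            rcases le_total 1 ρ with h | h
            · rw [min_eq_left h, one_mul]
              exact Real.rpow_le_one_of_one_le_of_nonpos h (by linarith)
            · rw [min_eq_right h, mul_comm, ← Real.rpow_add_one hρ0.ne']
              exact Real.rpow_le_one hρ0.le h (by linarith)
          have harg : |hardyPair Ω z (x, y)| / ‖x - y‖ ^ s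
              = 4 * (min 1 ρ * ρ ^ (-s) * T) := by
            simp only [hardyPair]
            rw [← hddef, ← hρ, abs_mul, abs_mul, abs_of_nonneg (by positivity : 0 ≤ min 1 ρ),
              abs_of_pos (by norm_num : (0 : ℝ) < 4), hrρ, Real.mul_rpow hρ0.le hd.le,
              Real.rpow_neg hρ0.le, hT]
            field_simp
          have h1 := hGg.G_const_mul_le (l := 4) (t := min 1 ρ * ρ ^ (-s) * T) (by norm_num)
            (mul_nonneg hl0 hT0)
          have h2 := hGg.G_smul_le _ T hl0 hl1 hT0
          have h3 : G (4 * (min 1 ρ * ρ ^ (-s) * T))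
              ≤ max 1 4 ^ p * (min 1 ρ * ρ ^ (-s) * G T) :=
            h1.trans (mul_le_mul_of_nonneg_left h2 (by positivity))
          unfold modDensity
          rw [show ((x, y) : E N × E N).1 = x from rfl, show ((x, y) : E N × E N).2 = y from rfl,
            harg, hardyKernel]
          refine (div_le_div_of_nonneg_right h3 (by positivity)).trans (le_of_eq ?_)
          rw [hrρ, mul_pow]
          field_simp
      _ = ENNReal.ofReal (max 1 4 ^ p * G T) * K := by
          rw [lintegral_const_mul' _ _ ENNReal.ofReal_ne_top, lintegral_hardyKernel_scaled x hd]
      _ = _ := by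
          rw [ENNReal.ofReal_mul (by positivity)]
          ring
  have hout : ∀ᵐ x ∂(volume : Measure (E N)), x ∉ Ω →
      ∫⁻ y, ENNReal.ofReal (modDensity s G (hardyPair Ω z) (x, y)) = 0 := by
    filter_upwards [hz0] with x hx hxΩ
    simp [modDensity, hardyPair, hx hxΩ, hGg.G_zero]
  have hC : ENNReal.ofReal (max 1 4 ^ p) * K < ⊤ := ENNReal.mul_lt_top ENNReal.ofReal_lt_top hKt
  calc ∫⁻ x, ∫⁻ y, ENNReal.ofReal (modDensity s G (hardyPair Ω z) (x, y))
      ≤ ∫⁻ x, Ω.indicator (fun x => (ENNReal.ofReal (max 1 4 ^ p) * K)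
        * ENNReal.ofReal (G (|z x| / Metric.infDist x Ωᶜ ^ s))) x := by
        refine lintegral_mono_ae (hout.mono fun x hx => ?_)
        by_cases hxΩ : x ∈ Ω
        · rw [indicator_of_mem hxΩ]; exact key x hxΩ
        · rw [hx hxΩ]; exact zero_le
    _ = (ENNReal.ofReal (max 1 4 ^ p) * K)
        * ∫⁻ x in Ω, ENNReal.ofReal (G (|z x| / Metric.infDist x Ωᶜ ^ s)) := by
        rw [lintegral_indicator hΩ.isOpen.measurableSet, lintegral_const_mul' _ _ hC.ne]
    _ < ⊤ := ENNReal.mul_lt_top hC (hΩ.hardy hs hGg hz hz0)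

end

/-! ### Cutoffs and test functions -/

section

variable {N : ℕ} {Ω : Set (E N)} {s : ℝ} {G g : ℝ → ℝ} {q p : ℝ}

/-- The points of `Ω` at distance at least `1 / (n + 1)` from the complement. -/
def coreSet (Ω : Set (E N)) (n : ℕ) : Set (E N) := {x | 1 / ((n : ℝ) + 1) ≤ Metric.infDist x Ωᶜ}

/-- A Lipschitz cutoff function supported in `coreSet Ω n`. -/
noncomputable def cutoff (Ω : Set (E N)) (n : ℕ) (x : E N) : ℝ :=
  min 1 (max 0 (((n : ℝ) + 1) * Metric.infDist x Ωᶜ - 1))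

/-- `z` truncated at height `n` and cut off near the boundary of `Ω`. -/
noncomputable def cutTrunc (Ω : Set (E N)) (z : E N → ℝ) (n : ℕ) (x : E N) : ℝ :=
  min (z x) n * cutoff Ω n x

lemma coreSet_subset (n : ℕ) : coreSet Ω n ⊆ Ω := by
  intro x hx
  by_contra hcon
  have h0 : Metric.infDist x Ωᶜ = 0 := Metric.infDist_zero_of_mem hcon
  have h1 : 1 / ((n : ℝ) + 1) ≤ Metric.infDist x Ωᶜ := hx
  rw [h0] at h1
  exact absurd h1 (not_le.2 (by positivity))

lemma isCompact_coreSet (hb : Bornology.IsBounded Ω) (n : ℕ) : IsCompact (coreSet Ω n) :=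
  Metric.isCompact_of_isClosed_isBounded
    (isClosed_le continuous_const (Metric.continuous_infDist_pt _)) (hb.subset (coreSet_subset n))

lemma cutoff_nonneg (n : ℕ) (x : E N) : 0 ≤ cutoff Ω n x := le_min zero_le_one (le_max_left _ _)

lemma cutoff_le_one (n : ℕ) (x : E N) : cutoff Ω n x ≤ 1 := min_le_left _ _

lemma measurable_cutoff (n : ℕ) : Measurable (cutoff Ω n) := by
  have : Measurable fun x : E N => Metric.infDist x Ωᶜ := measurable_infDist
  unfold cutoff
  fun_prop

lemma cutoff_eq_zero {n : ℕ} {x : E N} (hx : x ∉ coreSet Ω n) : cutoff Ω n x = 0 := by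
  have h1 : Metric.infDist x Ωᶜ < 1 / ((n : ℝ) + 1) := not_le.1 hx
  rw [lt_div_iff₀ (by positivity)] at h1
  rw [cutoff, max_eq_left (by linarith), min_eq_right zero_le_one]

/-- The increments of all the cutoffs are bounded by a single function of two points. -/
lemma abs_cutoff_sub_le (n : ℕ) (x y : E N) (hd : 0 < Metric.infDist x Ωᶜ) :
    |cutoff Ω n x - cutoff Ω n y| ≤ 4 * min 1 (‖x - y‖ / Metric.infDist x Ωᶜ) := by
  have hlip : |Metric.infDist x Ωᶜ - Metric.infDist y Ωᶜ| ≤ ‖x - y‖ := by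
    have := (Metric.lipschitz_infDist_pt Ωᶜ).dist_le_mul x y
    rwa [NNReal.coe_one, one_mul, Real.dist_eq, dist_eq_norm] at this
  set d := Metric.infDist x Ωᶜ with hdd
  set d' := Metric.infDist y Ωᶜ with hdd'
  have h1 : |cutoff Ω n x - cutoff Ω n y| ≤ 1 := by
    have := cutoff_nonneg (Ω := Ω) n x
    have := cutoff_nonneg (Ω := Ω) n y
    have := cutoff_le_one (Ω := Ω) n x
    have := cutoff_le_one (Ω := Ω) n y
    rw [abs_le]; constructor <;> linarith
  rcases le_or_gt (d / 4) ‖x - y‖ with hr | hr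
  · refine h1.trans ?_
    have : 1 / 4 ≤ min 1 (‖x - y‖ / d) := by
      refine le_min (by norm_num) ?_
      rw [le_div_iff₀ hd]; linarith
    linarith
  have hd' : 3 / 4 * d ≤ d' := by
    have := (le_abs_self _).trans hlip
    linarith
  have hmin : min 1 (‖x - y‖ / d) = ‖x - y‖ / d := by
    refine min_eq_right ?_
    rw [div_le_one hd]; linarith
  rw [hmin]
  have hn : (0 : ℝ) < (n : ℝ) + 1 := by positivity
  rcases le_or_gt 2 (((n : ℝ) + 1) * (3 / 4 * d)) with h2 | h2
  · have e1 : cutoff Ω n x = 1 := by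
      rw [cutoff, ← hdd]
      refine min_eq_left (le_max_of_le_right ?_)
      nlinarith
    have e2 : cutoff Ω n y = 1 := by
      rw [cutoff, ← hdd']
      refine min_eq_left (le_max_of_le_right ?_)
      nlinarith
    rw [e1, e2, sub_self, abs_zero]
    positivity
  · have h3 : |cutoff Ω n x - cutoff Ω n y| ≤ ((n : ℝ) + 1) * ‖x - y‖ := by
      rw [cutoff, cutoff, ← hdd, ← hdd']
      have a1 := abs_min_sub_min_le_max 1 (max 0 (((n : ℝ) + 1) * d - 1)) 1
        (max 0 (((n : ℝ) + 1) * d' - 1))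
      have a2 := abs_max_sub_max_le_max 0 (((n : ℝ) + 1) * d - 1) 0 (((n : ℝ) + 1) * d' - 1)
      replace a1 := a1.trans (max_le (by simp) le_rfl)
      replace a2 := a2.trans (max_le (by simp) le_rfl)
      refine a1.trans (a2.trans ?_)
      have e : ((n : ℝ) + 1) * d - 1 - (((n : ℝ) + 1) * d' - 1) = ((n : ℝ) + 1) * (d - d') := by
        ring
      rw [e, abs_mul, abs_of_pos hn]
      exact mul_le_mul_of_nonneg_left hlip hn.le
    refine h3.trans ?_
    rw [← mul_div_assoc, le_div_iff₀ hd]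
    have := norm_nonneg (x - y)
    nlinarith

lemma cutTrunc_nonneg {z : E N → ℝ} (hz : ∀ x, 0 ≤ z x) (n : ℕ) (x : E N) :
    0 ≤ cutTrunc Ω z n x :=
  mul_nonneg (le_min (hz x) (Nat.cast_nonneg n)) (cutoff_nonneg n x)

lemma cutTrunc_le {z : E N → ℝ} (hz : ∀ x, 0 ≤ z x) (n : ℕ) (x : E N) :
    cutTrunc Ω z n x ≤ z x :=
  (mul_le_of_le_one_right (le_min (hz x) (Nat.cast_nonneg n)) (cutoff_le_one n x)).trans
    (min_le_left _ _)

lemma cutTrunc_le_nat {z : E N → ℝ} (hz : ∀ x, 0 ≤ z x) (n : ℕ) (x : E N) :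
    cutTrunc Ω z n x ≤ n :=
  (mul_le_of_le_one_right (le_min (hz x) (Nat.cast_nonneg n)) (cutoff_le_one n x)).trans
    (min_le_right _ _)

lemma cutTrunc_eq_zero {z : E N → ℝ} {n : ℕ} {x : E N} (hx : x ∉ coreSet Ω n) :
    cutTrunc Ω z n x = 0 := by
  rw [cutTrunc, cutoff_eq_zero hx, mul_zero]

lemma aemeasurable_cutTrunc {z : E N → ℝ} (hz : AEMeasurable z volume) (n : ℕ) :
    AEMeasurable (cutTrunc Ω z n) volume :=
  (hz.min aemeasurable_const).mul (measurable_cutoff n).aemeasurable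

/-- At each point of `Ω` the truncations are eventually equal to `z`. -/
lemma eventually_cutTrunc_eq (z : E N → ℝ) {x : E N} (hx : 0 < Metric.infDist x Ωᶜ) :
    ∀ᶠ n : ℕ in atTop, cutTrunc Ω z n x = z x := by
  have h1 : ∀ᶠ n : ℕ in atTop, z x ≤ n :=
    tendsto_natCast_atTop_atTop.eventually (eventually_ge_atTop (z x))
  have h2 : ∀ᶠ n : ℕ in atTop, 2 / Metric.infDist x Ωᶜ ≤ (n : ℝ) :=
    tendsto_natCast_atTop_atTop.eventually (eventually_ge_atTop _)
  filter_upwards [h1, h2] with n h1 h2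
  rw [div_le_iff₀ hx] at h2
  rw [cutTrunc, min_eq_left h1, cutoff, min_eq_left (le_max_of_le_right (by nlinarith)), mul_one]

lemma abs_incr_cutTrunc_le [Nonempty (Fin N)] (hΩ : IsBoundedLipschitzDomain Ω) {z : E N → ℝ}
    (hz : ∀ x, 0 ≤ z x) (n : ℕ) {w : E N × E N} (hw : w.1 ∉ Ω → z w.1 = 0) :
    |incr (cutTrunc Ω z n) w| ≤ |(|incr z w| + |hardyPair Ω z w|)| := by
  obtain ⟨x, y⟩ := w
  simp only [incr, hardyPair] at hw ⊢
  rw [abs_of_nonneg (by positivity : 0 ≤ |z x - z y| + _)]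
  have e : cutTrunc Ω z n x - cutTrunc Ω z n y
      = (min (z x) n - min (z y) n) * cutoff Ω n y
        + min (z x) n * (cutoff Ω n x - cutoff Ω n y) := by
    unfold cutTrunc; ring
  rw [e]
  refine (abs_add_le _ _).trans (add_le_add ?_ ?_)
  · rw [abs_mul, abs_of_nonneg (cutoff_nonneg n y)]
    have h1 := abs_min_sub_min_le_max (z x) (n : ℝ) (z y) n
    rw [sub_self, abs_zero, max_eq_left (abs_nonneg _)] at h1
    exact (mul_le_of_le_one_right (abs_nonneg _) (cutoff_le_one n y)).trans h1
  · by_cases hx : x ∈ Ω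
    · have hd := hΩ.infDist_pos hx
      have h1 := abs_cutoff_sub_le n x y hd
      have h2 : 0 ≤ min (z x) (n : ℝ) := le_min (hz x) (Nat.cast_nonneg n)
      rw [abs_mul, abs_of_nonneg h2]
      refine le_trans ?_ (le_abs_self _)
      calc min (z x) (n : ℝ) * |cutoff Ω n x - cutoff Ω n y|
          ≤ z x * (4 * min 1 (‖x - y‖ / Metric.infDist x Ωᶜ)) :=
            mul_le_mul (min_le_left _ _) h1 (abs_nonneg _) (hz x)
        _ = _ := by ring
    · rw [hw hx, min_eq_left (Nat.cast_nonneg n)]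
      simp

/-- The bounds collected in `IsTest` follow from boundedness, compact support and finiteness of
the modular of the increments. -/
lemma GrowthPair.isTest (hGg : GrowthPair G g q p) {φ : E N → ℝ} (hm : AEMeasurable φ volume)
    (h0 : ∀ᵐ x ∂(volume : Measure (E N)), 0 ≤ φ x) {M : ℝ}
    (hM : ∀ᵐ x ∂(volume : Measure (E N)), φ x ≤ M)
    {K : Set (E N)} (hK : IsCompact K) (hKΩ : K ⊆ Ω)
    (hφK : ∀ᵐ x ∂(volume : Measure (E N)), x ∉ K → φ x = 0)
    (hfin : FinitePair s G (incr φ)) : IsTest s G Ω φ := by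
  refine ⟨⟨⟨⟨hm.restrict, 1, one_pos, ?_⟩, 1, one_pos, ?_⟩, ?_⟩, ⟨hm, ⟨M, ?_⟩, K, hK, hKΩ, hφK⟩, h0⟩
  · rw [Measure.restrict_univ]
    calc ∫⁻ x, ENNReal.ofReal (G (|φ x| / 1))
        ≤ ∫⁻ x, K.indicator (fun _ => ENNReal.ofReal (G (max M 0))) x := by
          refine lintegral_mono_ae ?_
          filter_upwards [h0, hM, hφK] with x h0 hM hφK
          by_cases hx : x ∈ K
          · rw [indicator_of_mem hx, div_one, abs_of_nonneg h0]
            exact ENNReal.ofReal_le_ofReal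
              (hGg.G_mono h0 (mem_Ici.2 (le_max_right _ _)) (hM.trans (le_max_left _ _)))
          · rw [indicator_of_notMem hx, hφK hx]
            simp [hGg.G_zero]
      _ = ENNReal.ofReal (G (max M 0)) * volume K := by
          rw [lintegral_indicator hK.measurableSet, setLIntegral_const]
      _ < ⊤ := ENNReal.mul_lt_top ENNReal.ofReal_lt_top hK.measure_lt_top
  · have h := hfin.lt_top
    rw [lintegral_prod _ (hGg.aemeasurable_modDensity hfin.aemeasurable).ennreal_ofReal] at h
    simpa [gagliardoModular, modDensity, incr] using h
  · exact hφK.mono fun x hx hxΩ => hx fun h => hxΩ (hKΩ h)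
  · filter_upwards [h0, hM] with x h0 hM
    rwa [abs_of_nonneg h0]

/-- Membership in `W^{s,G}(U)` bounds the modular of the increments on `U × U`. -/
lemma MemFracSobolev.finitePair (hGg : GrowthPair G g q p) {U : Set (E N)}
    (hU : MeasurableSet U) {w : E N → ℝ} (hw : AEMeasurable w volume)
    (h : MemFracSobolev s G U w) : FinitePair s G ((U ×ˢ U).indicator (incr w)) := by
  obtain ⟨-, l, hl, hfin⟩ := h
  have hm : AEMeasurable (incr fun x => w x / l) ((volume : Measure (E N)).prod volume) :=
    aemeasurable_incr (hw.div_const l)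
  have hUU : MeasurableSet (U ×ˢ U) := hU.prod hU
  have h1 : FinitePair s G ((U ×ˢ U).indicator (incr fun x => w x / l)) := by
    refine ⟨hm.indicator hUU, ?_⟩
    have e : ∀ z : E N × E N,
        ENNReal.ofReal (modDensity s G ((U ×ˢ U).indicator (incr fun x => w x / l)) z)
        = (U ×ˢ U).indicator
          (fun z => ENNReal.ofReal (modDensity s G (incr fun x => w x / l) z)) z := by
      intro z
      by_cases hz : z ∈ U ×ˢ U
      · simp [modDensity, indicator_of_mem hz]
      · simp [modDensity, indicator_of_notMem hz, hGg.G_zero]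
    simp_rw [e]
    rw [lintegral_indicator hUU, ← Measure.prod_restrict,
      lintegral_prod _ (by
        rw [Measure.prod_restrict]
        exact (hGg.aemeasurable_modDensity hm).ennreal_ofReal.restrict)]
    exact hfin
  refine h1.of_le_const_mul hGg hl.le ((aemeasurable_incr hw).indicator hUU)
    (Eventually.of_forall fun z => ?_)
  by_cases hz : z ∈ U ×ˢ U
  · rw [indicator_of_mem hz, indicator_of_mem hz]
    have : incr (fun x => w x / l) z = incr w z / l := by simp [incr, sub_div]
    rw [this, abs_div, abs_of_pos hl, mul_div_cancel₀ _ hl.ne']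
  · simp [indicator_of_notMem hz]

/-- A bounded contribution of the pairs at distance at least `δ` has finite modular. -/
lemma GrowthPair.finitePair_far [Nonempty (Fin N)] (hGg : GrowthPair G g q p)
    (hs : 0 < s) (hs1 : s < 1) {K : Set (E N)} (hK : IsCompact K) {M δ : ℝ} (hM : 0 ≤ M)
    (hδ : 0 < δ) :
    FinitePair s G ({z : E N × E N | z.1 ∈ K ∧ δ ≤ ‖z.1 - z.2‖}.indicator fun _ => M) := by
  set S : Set (E N × E N) := {z | z.1 ∈ K ∧ δ ≤ ‖z.1 - z.2‖} with hS
  have hSm : MeasurableSet S :=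
    (measurable_fst hK.measurableSet).inter
      (measurableSet_le measurable_const (measurable_fst.sub measurable_snd).norm)
  have hm : AEMeasurable (S.indicator fun _ => M) ((volume : Measure (E N)).prod volume) :=
    aemeasurable_const.indicator hSm
  refine ⟨hm, ?_⟩
  rw [lintegral_prod _ (hGg.aemeasurable_modDensity hm).ennreal_ofReal]
  have hKt : ∫⁻ h : E N, ENNReal.ofReal (hardyKernel N s ‖h‖) < ⊤ := by
    have h := (integrable_hardyKernel (N := N) hs hs1).2
    rwa [hasFiniteIntegral_iff_ofReal (Eventually.of_forall fun h => by
      unfold hardyKernel; positivity)] at h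
  have hGM := hGg.G_nonneg (M / δ ^ s) (by positivity)
  calc ∫⁻ x, ∫⁻ y, ENNReal.ofReal (modDensity s G (S.indicator fun _ => M) (x, y))
      ≤ ∫⁻ x, K.indicator (fun _ => ENNReal.ofReal (G (M / δ ^ s))
          * ∫⁻ h : E N, ENNReal.ofReal (hardyKernel N s ‖h‖)) x := by
        refine lintegral_mono fun x => ?_
        by_cases hx : x ∈ K
        · rw [indicator_of_mem hx, ← lintegral_hardyKernel_scaled x hδ,
            ← lintegral_const_mul' _ _ ENNReal.ofReal_ne_top]
          refine lintegral_mono fun y => ?_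
          rw [← ENNReal.ofReal_mul hGM]
          refine ENNReal.ofReal_le_ofReal ?_
          by_cases hy : (x, y) ∈ S
          · have hr : δ ≤ ‖x - y‖ := hy.2
            have hr0 : 0 < ‖x - y‖ := hδ.trans_le hr
            simp only [modDensity, indicator_of_mem hy, abs_of_nonneg hM]
            have hρ : 1 ≤ ‖x - y‖ / δ := (one_le_div hδ).2 hr
            rw [hardyKernel, min_eq_left hρ, one_mul]
            set ρ := ‖x - y‖ / δ with hρd
            have hρ0 : 0 < ρ := div_pos hr0 hδ
            have hrρ : ‖x - y‖ = ρ * δ := by rw [hρd]; field_simp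
            have h1 := hGg.G_smul_le (ρ ^ (-s)) (M / δ ^ s) (by positivity)
              (Real.rpow_le_one_of_one_le_of_nonpos hρ (by linarith)) (by positivity)
            have e : M / (ρ * δ) ^ s = ρ ^ (-s) * (M / δ ^ s) := by
              rw [Real.mul_rpow hρ0.le hδ.le, Real.rpow_neg hρ0.le]
              field_simp
            rw [hrρ, e, mul_pow]
            refine (div_le_div_of_nonneg_right h1 (by positivity)).trans (le_of_eq ?_)
            field_simp
          · simp only [modDensity, indicator_of_notMem hy, abs_zero, zero_div, hGg.G_zero]
            unfold hardyKernel
            positivity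
        · rw [indicator_of_notMem hx]
          have : ∀ y, (x, y) ∉ S := fun y h => hx h.1
          simp [modDensity, this, hGg.G_zero]
    _ = ENNReal.ofReal (G (M / δ ^ s)) * (∫⁻ h : E N, ENNReal.ofReal (hardyKernel N s ‖h‖))
          * volume K := by
        rw [lintegral_indicator hK.measurableSet, setLIntegral_const]
    _ < ⊤ := ENNReal.mul_lt_top (ENNReal.mul_lt_top ENNReal.ofReal_lt_top hKt) hK.measure_lt_top

/-- A bounded function with compact support in `Ω` whose increments are controlled by those of
a function in `W^{s,G}_loc(Ω)`, up to a finite pair, has increments of finite modular. -/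
lemma GrowthPair.finitePair_incr_of_loc [Nonempty (Fin N)] (hGg : GrowthPair G g q p)
    (hs : 0 < s) (hs1 : s < 1) (ho : IsOpen Ω) {v φ : E N → ℝ} (hv : AEMeasurable v volume)
    (hvloc : MemFracSobolevLoc s G Ω v) (hm : AEMeasurable φ volume) {M : ℝ} (hM0 : 0 ≤ M)
    (hM : ∀ᵐ x ∂(volume : Measure (E N)), |φ x| ≤ M)
    {K : Set (E N)} (hK : IsCompact K) (hKΩ : K ⊆ Ω)
    (hφK : ∀ᵐ x ∂(volume : Measure (E N)), x ∉ K → φ x = 0)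
    {Q : E N × E N → ℝ} (hQ : FinitePair s G Q) {L : ℝ} (hL : 0 ≤ L)
    (hb : ∀ᵐ z ∂((volume : Measure (E N)).prod volume),
      |incr φ z| ≤ L * (|Q z| + |incr v z|)) : FinitePair s G (incr φ) := by
  obtain ⟨V, hVo, hKV, hVΩ, hVc⟩ := exists_open_between_and_isCompact_closure hK ho hKΩ
  obtain ⟨δ, hδ, hδV⟩ := hK.exists_thickening_subset_open hVo hKV
  have h1 := MemFracSobolev.finitePair hGg hVo.measurableSet hv (hvloc V hVo hVc hVΩ)
  have h2 := hGg.finitePair_far hs hs1 hK hM0 hδ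
  have h3 := (hQ.abs_add_abs hGg h1).abs_add_abs hGg (h2.abs_add_abs hGg h2.swap)
  refine h3.of_le_const_mul hGg (C := max L 1) (hL.trans (le_max_left _ _)) (aemeasurable_incr hm) ?_
  filter_upwards [hb, ae_pair hM, ae_pair hφK] with z hb hM hφK
  obtain ⟨x, y⟩ := z
  have hfar : ∀ x y : E N, x ∈ K → y ∉ V → δ ≤ ‖x - y‖ := by
    intro x y hx hy
    by_contra hcon
    refine hy (hδV (Metric.mem_thickening_iff.2 ⟨x, hx, ?_⟩))
    rw [dist_comm, dist_eq_norm]; exact not_le.1 hcon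
  set S : Set (E N × E N) := {z | z.1 ∈ K ∧ δ ≤ ‖z.1 - z.2‖}
  set F : E N × E N → ℝ := S.indicator fun _ => M with hF
  set A := (V ×ˢ V).indicator (incr v) (x, y) with hA
  have hL1 : 1 ≤ max L 1 := le_max_right _ _
  have hsum : |(|(|Q (x, y)| + |A|)| + |(|F (x, y)| + |F (Prod.swap (x, y))|)|)|
      = (|Q (x, y)| + |A|) + (|F (x, y)| + |F (y, x)|) := by
    rw [Prod.swap_prod_mk, abs_of_nonneg (a := _ + _) (by positivity),
      abs_of_nonneg (a := |Q (x, y)| + |A|) (by positivity),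
      abs_of_nonneg (a := |F (x, y)| + |F (y, x)|) (by positivity)]
  rw [hsum]
  have hn1 := abs_nonneg (Q (x, y))
  have hn2 := abs_nonneg A
  have hn3 := abs_nonneg (F (x, y))
  have hn4 := abs_nonneg (F (y, x))
  have hbig : ∀ T, 0 ≤ T → T ≤ max L 1 * T := fun T hT => le_mul_of_one_le_left hT hL1
  by_cases hxy : (x, y) ∈ V ×ˢ V
  · rw [hA, indicator_of_mem hxy] at hn2 ⊢
    refine hb.trans (mul_le_mul (le_max_left _ _) (by linarith) (by positivity) (by positivity))
  · refine le_trans ?_ (hbig _ (by positivity))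
    by_cases hx : x ∈ K
    · have hy : y ∉ V := fun h => hxy ⟨hKV hx, h⟩
      have hy0 : φ y = 0 := hφK.2 fun h => hy (hKV h)
      have hFx : F (x, y) = M := by
        rw [hF]; exact indicator_of_mem (show (x, y) ∈ S from ⟨hx, hfar x y hx hy⟩) _
      have h4 := hM.1
      simp only at h4
      simp only [incr, hy0, sub_zero, hFx, abs_of_nonneg hM0]
      linarith
    · have hx0 : φ x = 0 := hφK.1 hx
      by_cases hy : y ∈ K
      · have hxV : x ∉ V := fun h => hxy ⟨h, hKV hy⟩
        have hFy : F (y, x) = M := by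
          rw [hF]; exact indicator_of_mem (show (y, x) ∈ S from ⟨hy, hfar y x hy hxV⟩) _
        have h4 := hM.2
        simp only at h4
        simp only [incr, hx0, zero_sub, abs_neg, hFy, abs_of_nonneg hM0]
        linarith
      · have hy0 : φ y = 0 := hφK.2 hy
        simp only [incr, hx0, hy0, sub_zero, abs_zero]
        positivity

end

/-! ### Truncations of admissible functions -/

section

variable {N : ℕ} {Ω : Set (E N)} {s α β : ℝ} {G g : ℝ → ℝ} {q p : ℝ} {f k u v : E N → ℝ}

/-- Nonnegative functions vanishing outside `Ω` whose increments on the whole space have finite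
modular. -/
structure ZeroTrace (Ω : Set (E N)) (s : ℝ) (G : ℝ → ℝ) (z : E N → ℝ) : Prop where
  nonneg : ∀ x, 0 ≤ z x
  aemeasurable : AEMeasurable z volume
  zero_outside : ∀ᵐ x ∂(volume : Measure (E N)), x ∉ Ω → z x = 0
  finite : FinitePair s G (incr z)

/-- Functions in `W^{s,G}_loc(Ω)` vanishing outside `Ω` and bounded below by a positive constant
on every compact subset of `Ω`. -/
structure PositiveInside (Ω : Set (E N)) (s : ℝ) (G : ℝ → ℝ) (v : E N → ℝ) : Prop where
  aemeasurable : AEMeasurable v volume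
  zero_outside : ∀ᵐ x ∂(volume : Measure (E N)), x ∉ Ω → v x = 0
  pos : ∀ᵐ x ∂(volume : Measure (E N)), x ∈ Ω → 0 < v x
  mem_loc : MemFracSobolevLoc s G Ω v
  lower_bound : ∀ K : Set (E N), IsCompact K → K ⊆ Ω →
    ∃ C : ℝ, 0 < C ∧ ∀ᵐ x ∂(volume : Measure (E N)), x ∈ K → C ≤ v x

lemma PositiveInside.nonneg (hv : PositiveInside Ω s G v) :
    ∀ᵐ x ∂(volume : Measure (E N)), 0 ≤ v x := by
  filter_upwards [hv.zero_outside, hv.pos] with x h0 h1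
  by_cases hx : x ∈ Ω
  · exact (h1 hx).le
  · rw [h0 hx]

lemma IsBoundedLipschitzDomain.exists_mem_coreSet [Nonempty (Fin N)]
    (hΩ : IsBoundedLipschitzDomain Ω) {x : E N} (hx : x ∈ Ω) : ∃ n, x ∈ coreSet Ω n := by
  obtain ⟨n, hn⟩ := exists_nat_one_div_lt (hΩ.infDist_pos hx)
  exact ⟨n, hn.le⟩

lemma IsAdmissible.positiveInside [Nonempty (Fin N)] (hΩ : IsBoundedLipschitzDomain Ω)
    (hu : IsAdmissible s α β G g Ω f k u) : PositiveInside Ω s G u := by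
  have hU : (⋃ n, coreSet Ω n) = Ω := by
    refine subset_antisymm (iUnion_subset fun n => coreSet_subset n) fun x hx => ?_
    exact mem_iUnion.2 (hΩ.exists_mem_coreSet hx)
  refine ⟨?_, hu.zero_outside, ?_, hu.mem_loc, hu.lower_bound⟩
  · have h1 : AEMeasurable u (volume.restrict Ω) := by
      rw [← hU, aemeasurable_iUnion_iff]
      intro n
      obtain ⟨V, hVo, hKV, hVΩ, hVc⟩ := exists_open_between_and_isCompact_closure
        (isCompact_coreSet hΩ.isBounded n) hΩ.isOpen (coreSet_subset n)
      exact (hu.mem_loc V hVo hVc hVΩ).1.1.mono_measure (Measure.restrict_mono hKV le_rfl)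
    refine ((aemeasurable_indicator_iff hΩ.isOpen.measurableSet).2 h1).congr ?_
    filter_upwards [hu.zero_outside] with x hx
    by_cases hxΩ : x ∈ Ω
    · rw [indicator_of_mem hxΩ]
    · rw [indicator_of_notMem hxΩ, hx hxΩ]
  · choose C hC hCx using fun n => hu.lower_bound _ (isCompact_coreSet hΩ.isBounded n)
      (coreSet_subset n)
    filter_upwards [ae_all_iff.2 hCx] with x hx hxΩ
    obtain ⟨n, hn⟩ := hΩ.exists_mem_coreSet hxΩ
    exact (hC n).trans_le (hx n hn)

/-- A function of the class `FC` expands increments starting above a positive level. -/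
lemma IsFC.exists_le_mul_sub {Ψ : ℝ → ℝ} (hΨ : IsFC Ψ) {ε : ℝ} (hε : 0 < ε) :
    ∃ C : ℝ, 0 ≤ C ∧ (∀ a b, ε ≤ a → 0 < b → b ≤ a → a - b ≤ C * (Ψ a - Ψ b)) ∧
      ∀ a, ε ≤ a → a ≤ C * Ψ a := by
  have hmono : MonotoneOn Ψ (Ioi 0) := by
    refine monotoneOn_of_deriv_nonneg (convex_Ioi 0) hΨ.contDiffOn.continuousOn ?_ ?_
    · rw [interior_Ioi]; exact hΨ.contDiffOn.differentiableOn one_ne_zero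
    · rw [interior_Ioi]
      intro x hx
      obtain ⟨θ₁, θ₂, h1, -, h⟩ := hΨ.growth
      exact (mul_nonneg h1 (div_nonneg (hΨ.pos x hx).le (le_of_lt hx))).trans (h x hx).1
  have hcv := hΨ.strictConvexOn
  have m8 : ε / 8 ∈ Ioi (0 : ℝ) := mem_Ioi.2 (by positivity)
  have m4 : ε / 4 ∈ Ioi (0 : ℝ) := mem_Ioi.2 (by positivity)
  have m2 : ε / 2 ∈ Ioi (0 : ℝ) := mem_Ioi.2 (by positivity)
  set m := (Ψ (ε / 2) - Ψ (ε / 4)) / (ε / 2 - ε / 4) with hm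
  have hmpos : 0 < m := by
    refine lt_of_le_of_lt ?_ (hcv.slope_strict_mono_adjacent m8 m2 (by linarith) (by linarith))
    exact div_nonneg (sub_nonneg.2 (hmono m8 m4 (by linarith))) (by linarith)
  have hslope : ∀ a b, ε / 2 ≤ b → b < a → m * (a - b) ≤ Ψ a - Ψ b := by
    intro a b hb hba
    have hb0 : b ∈ Ioi (0 : ℝ) := mem_Ioi.2 (by linarith)
    have ha0 : a ∈ Ioi (0 : ℝ) := mem_Ioi.2 (by linarith)
    rw [← le_div_iff₀ (sub_pos.2 hba)]
    rcases hb.eq_or_lt with rfl | hb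
    · exact hcv.convexOn.slope_mono_adjacent m4 ha0 (by linarith) hba
    · exact (hcv.convexOn.slope_mono_adjacent m4 hb0 (by linarith) hb).trans
        (hcv.convexOn.slope_mono_adjacent m2 ha0 hb hba)
  have hhalf : ∀ a, ε ≤ a → m / 2 * a ≤ Ψ a - Ψ (ε / 2) := by
    intro a ha
    have := hslope a (ε / 2) le_rfl (by linarith)
    nlinarith
  have hscale : ∀ t T, m / 2 * t ≤ T → t ≤ 2 / m * T := by
    intro t T h
    rw [div_mul_eq_mul_div, le_div_iff₀ hmpos]
    linarith
  refine ⟨2 / m, by positivity, ?_, ?_⟩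
  · intro a b ha hb hba
    refine hscale _ _ ?_
    rcases hba.eq_or_lt with rfl | hba
    · simp
    rcases le_or_gt (ε / 2) b with h | h
    · have := hslope a b h hba
      have : 0 ≤ m * (a - b) := mul_nonneg hmpos.le (sub_nonneg.2 hba.le)
      linarith
    · have h1 := hhalf a ha
      have h2 := hmono hb m2 h.le
      have h3 : 0 ≤ m / 2 * b := by positivity
      linarith
  · intro a ha
    refine hscale _ _ ?_
    have h1 := hhalf a ha
    have h2 := hΨ.pos (ε / 2) m2
    linarith

/-- The increments of `u` between pairs of points one of which lies in `{u ≥ ε}`. -/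
noncomputable def levelPair (ε : ℝ) (u : E N → ℝ) (z : E N × E N) : ℝ :=
  if ε ≤ max (u z.1) (u z.2) then incr u z else 0

/-- The positive part of `u - ε`. -/
noncomputable def posLevel (ε : ℝ) (u : E N → ℝ) (x : E N) : ℝ := max (u x - ε) 0

lemma posLevel_eq_zero {ε : ℝ} {x : E N} (h : u x ≤ ε) : posLevel ε u x = 0 :=
  max_eq_right (sub_nonpos.2 h)

lemma abs_incr_posLevel_le (ε : ℝ) (u : E N → ℝ) (z : E N × E N) :
    |incr (posLevel ε u) z| ≤ |levelPair ε u z| := by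
  unfold levelPair
  split_ifs with h
  · have h1 := abs_max_sub_max_le_abs (u z.1 - ε) (u z.2 - ε) 0
    rw [sub_sub_sub_cancel_right] at h1
    exact h1
  · have h := max_lt_iff.1 (not_le.1 h)
    simp [incr, posLevel_eq_zero h.1.le, posLevel_eq_zero h.2.le]

lemma IsAdmissible.finitePair_levelPair [Nonempty (Fin N)] (hΩ : IsBoundedLipschitzDomain Ω)
    (hGg : GrowthPair G g q p) (hu : IsAdmissible s α β G g Ω f k u) {ε : ℝ} (hε : 0 < ε) :
    FinitePair s G (levelPair ε u) := by
  have hup := hu.positiveInside hΩ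
  obtain ⟨Ψ, hΨ, hw⟩ := hu.exists_FC
  obtain ⟨C, hC, hC1, hC2⟩ := hΨ.exists_le_mul_sub hε
  set w : E N → ℝ := Ω.indicator fun x => Ψ (u x) with hwdef
  have hwm : AEMeasurable w volume := by
    have := hw.1.1.1; rwa [Measure.restrict_univ] at this
  have hfin : FinitePair s G (incr w) := by
    have := hw.1.finitePair hGg MeasurableSet.univ hwm
    rwa [univ_prod_univ, indicator_univ] at this
  have hm : AEMeasurable (levelPair ε u) ((volume : Measure (E N)).prod volume) := by
    obtain ⟨u', hu', hu'e⟩ := hup.aemeasurable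
    have h1 : Measurable (levelPair ε u') := by
      refine Measurable.ite ?_ ((hu'.comp measurable_fst).sub (hu'.comp measurable_snd))
        measurable_const
      exact measurableSet_le measurable_const
        ((hu'.comp measurable_fst).max (hu'.comp measurable_snd))
    refine ⟨_, h1, ?_⟩
    filter_upwards [ae_pair hu'e] with z hz
    simp only [levelPair, incr, hz.1, hz.2]
  have key : ∀ x y : E N, u y ≤ u x → ε ≤ u x → (x ∉ Ω → u x = 0) → (y ∉ Ω → u y = 0) →
      (y ∈ Ω → 0 < u y) → |u x - u y| ≤ C * |w x - w y| := by
    intro x y hyx hx hx0 hy0 hy1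
    have hxΩ : x ∈ Ω := by
      by_contra hcon; rw [hx0 hcon] at hx; linarith
    rw [abs_of_nonneg (sub_nonneg.2 hyx)]
    by_cases hyΩ : y ∈ Ω
    · rw [hwdef, indicator_of_mem hxΩ, indicator_of_mem hyΩ]
      exact (hC1 _ _ hx (hy1 hyΩ) hyx).trans (mul_le_mul_of_nonneg_left (le_abs_self _) hC)
    · rw [hwdef, indicator_of_mem hxΩ, indicator_of_notMem hyΩ, hy0 hyΩ, sub_zero, sub_zero]
      exact (hC2 _ hx).trans (mul_le_mul_of_nonneg_left (le_abs_self _) hC)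
  refine hfin.of_le_const_mul hGg hC hm ?_
  filter_upwards [ae_pair hup.zero_outside, ae_pair hup.pos] with z h0 h1
  unfold levelPair
  split_ifs with h
  · rcases le_total (u z.2) (u z.1) with h2 | h2
    · rw [max_eq_left h2] at h
      exact key z.1 z.2 h2 h h0.1 h0.2 h1.2
    · rw [max_eq_right h2] at h
      have := key z.2 z.1 h2 h h0.2 h0.1 h1.1
      rwa [abs_sub_comm, abs_sub_comm (w z.2)] at this
  · rw [abs_zero]; positivity

lemma IsAdmissible.zeroTrace_posLevel [Nonempty (Fin N)] (hΩ : IsBoundedLipschitzDomain Ω)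
    (hGg : GrowthPair G g q p) (hu : IsAdmissible s α β G g Ω f k u) {ε : ℝ} (hε : 0 < ε) :
    ZeroTrace Ω s G (posLevel ε u) := by
  have hum := (hu.positiveInside hΩ).aemeasurable
  have hm : AEMeasurable (posLevel ε u) volume := (hum.sub_const ε).max aemeasurable_const
  refine ⟨fun x => le_max_right _ _, hm, ?_, ?_⟩
  · filter_upwards [hu.zero_outside] with x hx hxΩ
    exact posLevel_eq_zero (by rw [hx hxΩ]; exact hε.le)
  · exact (hu.finitePair_levelPair hΩ hGg hε).of_le hGg (aemeasurable_incr hm)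
      (Eventually.of_forall fun z => abs_incr_posLevel_le ε u z)

/-! ### The four families of test functions -/

/-- A bound, uniform in `n`, of the increments of the truncations of `z`. -/
noncomputable def cutBound (Ω : Set (E N)) (z : E N → ℝ) (w : E N × E N) : ℝ :=
  |incr z w| + |hardyPair Ω z w|

variable {z : E N → ℝ}

lemma ZeroTrace.finitePair_cutBound [Nonempty (Fin N)] (hz : ZeroTrace Ω s G z)
    (hΩ : IsBoundedLipschitzDomain Ω) (hs : 0 < s) (hs1 : s < 1) (hGg : GrowthPair G g q p) :
    FinitePair s G (cutBound Ω z) :=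
  hz.finite.abs_add_abs hGg
    (hΩ.finitePair_hardyPair hs hs1 hGg hz.aemeasurable hz.finite hz.zero_outside)

lemma ZeroTrace.abs_incr_cutTrunc_le [Nonempty (Fin N)] (hz : ZeroTrace Ω s G z)
    (hΩ : IsBoundedLipschitzDomain Ω) :
    ∀ᵐ w ∂((volume : Measure (E N)).prod volume), ∀ n,
      |incr (cutTrunc Ω z n) w| ≤ |cutBound Ω z w| := by
  filter_upwards [ae_pair hz.zero_outside] with w hw n
  exact FracGLaplace.abs_incr_cutTrunc_le hΩ hz.nonneg n hw.1

lemma ZeroTrace.finitePair_cutTrunc [Nonempty (Fin N)] (hz : ZeroTrace Ω s G z)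
    (hΩ : IsBoundedLipschitzDomain Ω) (hs : 0 < s) (hs1 : s < 1) (hGg : GrowthPair G g q p)
    (n : ℕ) : FinitePair s G (incr (cutTrunc Ω z n)) :=
  (hz.finitePair_cutBound hΩ hs hs1 hGg).of_le hGg
    (aemeasurable_incr (aemeasurable_cutTrunc hz.aemeasurable n))
    ((hz.abs_incr_cutTrunc_le hΩ).mono fun _ hw => hw n)

lemma ZeroTrace.eventually_cutTrunc_eq [Nonempty (Fin N)] (hz : ZeroTrace Ω s G z)
    (hΩ : IsBoundedLipschitzDomain Ω) :
    ∀ᵐ x ∂(volume : Measure (E N)), ∀ᶠ n in atTop, cutTrunc Ω z n x = z x := by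
  filter_upwards [hz.zero_outside] with x hx
  by_cases hxΩ : x ∈ Ω
  · exact FracGLaplace.eventually_cutTrunc_eq z (hΩ.infDist_pos hxΩ)
  · refine Eventually.of_forall fun n => ?_
    rw [cutTrunc_eq_zero fun h => hxΩ (coreSet_subset n h), hx hxΩ]

lemma ZeroTrace.isTest_cutTrunc [Nonempty (Fin N)] (hz : ZeroTrace Ω s G z)
    (hΩ : IsBoundedLipschitzDomain Ω) (hs : 0 < s) (hs1 : s < 1) (hGg : GrowthPair G g q p)
    (n : ℕ) : IsTest s G Ω (cutTrunc Ω z n) :=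
  hGg.isTest (aemeasurable_cutTrunc hz.aemeasurable n)
    (Eventually.of_forall (cutTrunc_nonneg hz.nonneg n))
    (Eventually.of_forall (cutTrunc_le_nat hz.nonneg n)) (isCompact_coreSet hΩ.isBounded n)
    (coreSet_subset n) (Eventually.of_forall fun _ hx => cutTrunc_eq_zero hx)
    (hz.finitePair_cutTrunc hΩ hs hs1 hGg n)

/-- The positive part of the difference of a truncation of `z` and `v`. -/
noncomputable def cutDiff (Ω : Set (E N)) (z v : E N → ℝ) (n : ℕ) (x : E N) : ℝ :=
  max (cutTrunc Ω z n x - v x) 0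

lemma cutDiff_le (hz : ∀ x, 0 ≤ z x) {x : E N} (hv : 0 ≤ v x) (n : ℕ) :
    cutDiff Ω z v n x ≤ n :=
  max_le (by have := cutTrunc_le_nat (Ω := Ω) hz n x; linarith) (Nat.cast_nonneg n)

lemma cutDiff_eq_zero {x : E N} (hv : 0 ≤ v x) {n : ℕ} (hx : x ∉ coreSet Ω n) :
    cutDiff Ω z v n x = 0 := by
  rw [cutDiff, cutTrunc_eq_zero hx]; exact max_eq_right (by linarith)

lemma aemeasurable_cutDiff (hz : AEMeasurable z volume) (hv : AEMeasurable v volume) (n : ℕ) :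
    AEMeasurable (cutDiff Ω z v n) volume :=
  ((aemeasurable_cutTrunc hz n).sub hv).max aemeasurable_const

lemma ZeroTrace.finitePair_cutDiff [Nonempty (Fin N)] (hz : ZeroTrace Ω s G z)
    (hv : PositiveInside Ω s G v)
    (hΩ : IsBoundedLipschitzDomain Ω) (hs : 0 < s) (hs1 : s < 1) (hGg : GrowthPair G g q p)
    (n : ℕ) : FinitePair s G (incr (cutDiff Ω z v n)) := by
  refine hGg.finitePair_incr_of_loc hs hs1 hΩ.isOpen hv.aemeasurable hv.mem_loc
    (aemeasurable_cutDiff hz.aemeasurable hv.aemeasurable n) (Nat.cast_nonneg n) ?_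
    (isCompact_coreSet hΩ.isBounded n) (coreSet_subset n) ?_
    (hz.finitePair_cutTrunc hΩ hs hs1 hGg n) zero_le_one (Eventually.of_forall fun w => ?_)
  · filter_upwards [hv.nonneg] with x hx
    rw [abs_of_nonneg (le_max_right _ _)]
    exact cutDiff_le hz.nonneg hx n
  · filter_upwards [hv.nonneg] with x hx hxK
    exact cutDiff_eq_zero hx hxK
  · have h1 := abs_max_sub_max_le_abs (cutTrunc Ω z n w.1 - v w.1)
      (cutTrunc Ω z n w.2 - v w.2) 0
    rw [one_mul]
    refine h1.trans (le_trans (le_of_eq ?_) (abs_sub _ _))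
    simp only [incr]
    congr 1; ring

lemma ZeroTrace.isTest_cutDiff [Nonempty (Fin N)] (hz : ZeroTrace Ω s G z)
    (hv : PositiveInside Ω s G v)
    (hΩ : IsBoundedLipschitzDomain Ω) (hs : 0 < s) (hs1 : s < 1) (hGg : GrowthPair G g q p)
    (n : ℕ) : IsTest s G Ω (cutDiff Ω z v n) := by
  refine hGg.isTest (M := n) (aemeasurable_cutDiff hz.aemeasurable hv.aemeasurable n)
    (Eventually.of_forall fun x => le_max_right _ _) ?_ (isCompact_coreSet hΩ.isBounded n)
    (coreSet_subset n) ?_ (hz.finitePair_cutDiff hv hΩ hs hs1 hGg n)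
  · filter_upwards [hv.nonneg] with x hx
    exact cutDiff_le hz.nonneg hx n
  · filter_upwards [hv.nonneg] with x hx hxK
    exact cutDiff_eq_zero hx hxK

/-- The Picone test function of the problem solved by `u`, built from a truncation. -/
noncomputable def cutFst (q : ℝ) (Ω : Set (E N)) (z v : E N → ℝ) (n : ℕ) (x : E N) : ℝ :=
  piconeFst q (cutTrunc Ω z n x) (v x)

/-- The Picone test function of the problem solved by `v`, built from a truncation. -/
noncomputable def cutSnd (q : ℝ) (Ω : Set (E N)) (z v : E N → ℝ) (n : ℕ) (x : E N) : ℝ :=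
  piconeSnd q (cutTrunc Ω z n x) (v x)

lemma aemeasurable_piconeFst {a c : E N → ℝ} {μ : Measure (E N)} (ha : AEMeasurable a μ)
    (hc : AEMeasurable c μ) : AEMeasurable (fun x => piconeFst q (a x) (c x)) μ :=
  (((ha.pow_const q).sub (hc.pow_const q)).max aemeasurable_const).mul (ha.pow_const (1 - q))

lemma aemeasurable_piconeSnd {a c : E N → ℝ} {μ : Measure (E N)} (ha : AEMeasurable a μ)
    (hc : AEMeasurable c μ) : AEMeasurable (fun x => piconeSnd q (a x) (c x)) μ :=
  (((ha.pow_const q).sub (hc.pow_const q)).max aemeasurable_const).mul (hc.pow_const (1 - q))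

lemma ZeroTrace.abs_incr_cutFst_le (hq : 1 < q) (hz : ZeroTrace Ω s G z)
    (hv : PositiveInside Ω s G v) : ∀ᵐ w ∂((volume : Measure (E N)).prod volume), ∀ n,
      |incr (cutFst q Ω z v n) w|
        ≤ (1 + 2 * q) * (|incr (cutTrunc Ω z n) w| + |incr (cutDiff Ω z v n) w|) := by
  filter_upwards [ae_pair hv.nonneg] with w hw n
  exact abs_piconeFst_sub_le hq (cutTrunc_nonneg hz.nonneg n _) (cutTrunc_nonneg hz.nonneg n _)
    hw.1 hw.2

lemma ZeroTrace.isTest_cutFst [Nonempty (Fin N)] (hz : ZeroTrace Ω s G z)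
    (hv : PositiveInside Ω s G v)
    (hΩ : IsBoundedLipschitzDomain Ω) (hs : 0 < s) (hs1 : s < 1) (hGg : GrowthPair G g q p)
    (n : ℕ) : IsTest s G Ω (cutFst q Ω z v n) := by
  have hq := hGg.one_lt
  have hm : AEMeasurable (cutFst q Ω z v n) volume :=
    aemeasurable_piconeFst (aemeasurable_cutTrunc hz.aemeasurable n) hv.aemeasurable
  refine hGg.isTest (M := n) hm ?_ ?_ (isCompact_coreSet hΩ.isBounded n) (coreSet_subset n) ?_ ?_
  · exact Eventually.of_forall fun x => piconeFst_nonneg (cutTrunc_nonneg hz.nonneg n x)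
  · filter_upwards [hv.nonneg] with x hx
    exact (piconeFst_le_self hq (cutTrunc_nonneg hz.nonneg n x) hx).trans
      (cutTrunc_le_nat hz.nonneg n x)
  · refine Eventually.of_forall fun x hx => ?_
    rw [cutFst, cutTrunc_eq_zero hx, piconeFst_zero_left hq]
  · have h1 := (hz.finitePair_cutTrunc hΩ hs hs1 hGg n).abs_add_abs hGg
      (hz.finitePair_cutDiff hv hΩ hs hs1 hGg n)
    refine h1.of_le_const_mul hGg (C := 1 + 2 * q) (by linarith) (aemeasurable_incr hm) ?_
    filter_upwards [hz.abs_incr_cutFst_le hq hv] with w hw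
    rw [abs_of_nonneg (by positivity : 0 ≤ |incr (cutTrunc Ω z n) w| + _)]
    exact hw n

lemma ZeroTrace.isTest_cutSnd [Nonempty (Fin N)] (hz : ZeroTrace Ω s G z)
    (hv : PositiveInside Ω s G v)
    (hΩ : IsBoundedLipschitzDomain Ω) (hs : 0 < s) (hs1 : s < 1) (hGg : GrowthPair G g q p)
    (n : ℕ) : IsTest s G Ω (cutSnd q Ω z v n) := by
  have hq := hGg.one_lt
  obtain ⟨C, hC, hCv⟩ := hv.lower_bound _ (isCompact_coreSet hΩ.isBounded n) (coreSet_subset n)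
  have hm : AEMeasurable (cutSnd q Ω z v n) volume :=
    aemeasurable_piconeSnd (aemeasurable_cutTrunc hz.aemeasurable n) hv.aemeasurable
  have ht0 := cutTrunc_nonneg (Ω := Ω) hz.nonneg n
  have htn := cutTrunc_le_nat (Ω := Ω) hz.nonneg n
  have h0 : ∀ᵐ x ∂(volume : Measure (E N)), 0 ≤ cutSnd q Ω z v n x := by
    filter_upwards [hv.nonneg] with x hx
    exact piconeSnd_nonneg hx
  have hsupp : ∀ᵐ x ∂(volume : Measure (E N)), x ∉ coreSet Ω n → cutSnd q Ω z v n x = 0 := by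
    filter_upwards [hv.nonneg] with x hx hxK
    rw [cutSnd, cutTrunc_eq_zero hxK, piconeSnd_zero_left hq hx]
  have hbd : ∀ᵐ x ∂(volume : Measure (E N)),
      cutSnd q Ω z v n x ≤ (n : ℝ) ^ q * C ^ (1 - q) := by
    filter_upwards [hv.nonneg, hCv, hsupp] with x hx hCx hs
    by_cases hxK : x ∈ coreSet Ω n
    · have h1 : cutTrunc Ω z n x ^ q ≤ (n : ℝ) ^ q :=
        Real.rpow_le_rpow (ht0 x) (htn x) (by linarith)
      have h2 : 0 ≤ v x ^ q := Real.rpow_nonneg hx _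
      exact mul_le_mul (max_le (by linarith) (by positivity))
        (Real.rpow_le_rpow_of_nonpos hC (hCx hxK) (by linarith)) (Real.rpow_nonneg hx _)
        (by positivity)
    · rw [hs hxK]; positivity
  refine hGg.isTest hm h0 hbd (isCompact_coreSet hΩ.isBounded n) (coreSet_subset n) hsupp ?_
  set M : ℝ := max n C
  have hCM : C ≤ M := le_max_right _ _
  -- on the support of the truncation `v` may be replaced by `max v C`
  have hrepl : ∀ᵐ x ∂(volume : Measure (E N)),
      cutSnd q Ω z v n x = piconeSnd q (cutTrunc Ω z n x) (max (v x) C) := by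
    filter_upwards [hv.nonneg, hCv, hsupp] with x hx hCx hs
    by_cases hxK : x ∈ coreSet Ω n
    · rw [max_eq_left (hCx hxK), cutSnd]
    · rw [hs hxK, cutTrunc_eq_zero hxK, piconeSnd_zero_left hq (hC.le.trans (le_max_right _ _))]
  have hL : 0 ≤ 1 + 2 * q * (M / C) ^ q := by
    have : 0 ≤ M / C := div_nonneg (hC.le.trans hCM) hC.le
    positivity
  refine hGg.finitePair_incr_of_loc hs hs1 hΩ.isOpen hv.aemeasurable hv.mem_loc hm
    (M := (n : ℝ) ^ q * C ^ (1 - q)) (by positivity) ?_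
    (isCompact_coreSet hΩ.isBounded n) (coreSet_subset n) hsupp
    (hz.finitePair_cutTrunc hΩ hs hs1 hGg n) hL ?_
  · filter_upwards [h0, hbd] with x h0 hbd
    rwa [abs_of_nonneg h0]
  · filter_upwards [ae_pair hrepl] with w hw
    rw [incr, hw.1, hw.2]
    refine (abs_piconeSnd_sub_le hq hC hCM (ht0 _) (ht0 _) ((htn _).trans (le_max_left _ _))
      ((htn _).trans (le_max_left _ _)) (le_max_right _ _) (le_max_right _ _)).trans ?_
    refine mul_le_mul_of_nonneg_left (add_le_add le_rfl ?_) hL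
    exact abs_max_sub_max_le_abs _ _ _

end

/-! ### Passage to the limit in the weak formulations -/

section

variable {N : ℕ} {Ω : Set (E N)} {s α β : ℝ} {G g : ℝ → ℝ} {q p : ℝ} {f k u v z : E N → ℝ}

/-- The data of the problem, as far as the comparison argument uses them. -/
structure ProblemData (Ω : Set (E N)) (s α β : ℝ) (G g : ℝ → ℝ) (q p : ℝ) (f k : E N → ℝ) :
    Prop where
  domain : IsBoundedLipschitzDomain Ω
  s_pos : 0 < s
  s_lt_one : s < 1
  growth : GrowthPair G g q p
  p_nonneg : 0 ≤ p
  α_pos : 0 < α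
  β_pos : 0 < β
  β_lt : β < q - 1
  f_aemeasurable : AEMeasurable f (volume.restrict Ω)
  f_nonneg : ∀ᵐ x ∂(volume.restrict Ω), 0 ≤ f x
  k_integrable : IntegrableOn k Ω
  k_pos : ∀ᵐ x ∂(volume.restrict Ω), 0 < k x

/-- A form of Fatou's lemma. -/
lemma lintegral_le_of_tendsto_of_le {X : Type*} [MeasurableSpace X] {μ : Measure X}
    {F : ℕ → X → ℝ≥0∞} {F₀ : X → ℝ≥0∞} {c : ℕ → ℝ≥0∞} {c₀ : ℝ≥0∞}
    (hm : ∀ n, AEMeasurable (F n) μ)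
    (hF : ∀ᵐ x ∂μ, Tendsto (fun n => F n x) atTop (𝓝 (F₀ x))) (hc : ∀ n, ∫⁻ x, F n x ∂μ ≤ c n)
    (hlim : Tendsto c atTop (𝓝 c₀)) : ∫⁻ x, F₀ x ∂μ ≤ c₀ :=
  calc ∫⁻ x, F₀ x ∂μ = ∫⁻ x, liminf (fun n => F n x) atTop ∂μ :=
        lintegral_congr_ae (hF.mono fun _ hx => hx.liminf_eq.symm)
    _ ≤ liminf (fun n => ∫⁻ x, F n x ∂μ) atTop := lintegral_liminf_le' hm
    _ ≤ liminf c atTop := liminf_le_liminf (Eventually.of_forall hc)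
    _ = c₀ := hlim.liminf_eq

lemma GrowthPair.scaled_nonneg (hGg : GrowthPair G g q p) {R : ℝ} (hR : 0 < R) :
    ∀ t, 0 ≤ t → 0 ≤ g (t / R) := fun _ ht => hGg.g_nonneg _ (div_nonneg ht hR.le)

lemma GrowthPair.scaled_mono (hGg : GrowthPair G g q p) {R : ℝ} (hR : 0 < R) :
    MonotoneOn (fun t => g (t / R)) (Ici 0) := fun _ ha _ hb hab =>
  hGg.g_mono (mem_Ici.2 (div_nonneg ha hR.le)) (mem_Ici.2 (div_nonneg hb hR.le))
    (div_le_div_of_nonneg_right hab hR.le)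

lemma GrowthPair.scaled_ratio (hGg : GrowthPair G g q p) {R : ℝ} (hR : 0 < R) (a b : ℝ)
    (ha : 0 < a) (hab : a ≤ b) : g (a / R) * a ^ (1 - q) ≤ g (b / R) * b ^ (1 - q) := by
  have h := hGg.g_ratio (a / R) (b / R) (div_pos ha hR) (div_le_div_of_nonneg_right hab hR.le)
  rw [Real.div_rpow ha.le hR.le, Real.div_rpow (ha.le.trans hab) hR.le, ← mul_div_assoc,
    ← mul_div_assoc] at h
  exact (div_le_div_iff_of_pos_right (Real.rpow_pos_of_pos hR _)).1 h

lemma pairing_le_pairing {P Q P' Q' : E N × E N → ℝ} {w : E N × E N}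
    (h : oddExt (fun t => g (t / ‖w.1 - w.2‖ ^ s)) (P w) * Q w
      ≤ oddExt (fun t => g (t / ‖w.1 - w.2‖ ^ s)) (P' w) * Q' w) :
    pairing s g P Q w ≤ pairing s g P' Q' w := by
  have h1 := div_le_div_of_nonneg_right h
    (by positivity : 0 ≤ ‖w.1 - w.2‖ ^ ((N : ℝ) + s))
  rwa [mul_div_assoc, mul_div_assoc] at h1

lemma norm_rpow_pos {w : E N × E N} (hw : w.1 ≠ w.2) : 0 < ‖w.1 - w.2‖ ^ s :=
  Real.rpow_pos_of_pos (norm_pos_iff.2 (sub_ne_zero.2 hw)) _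

/-- The density form of the Caccioppoli estimate. -/
lemma GrowthPair.modDensity_posPart_le (hGg : GrowthPair G g q p) (a c : E N → ℝ)
    {w : E N × E N} (hw : w.1 ≠ w.2) :
    modDensity s G (incr fun x => max (a x - c x) 0) w
      ≤ 2 ^ p * (4 * p * modDensity s G (incr a) w
        - pairing s g (incr c) (incr fun x => max (a x - c x) 0) w) := by
  have hR := norm_rpow_pos (s := s) hw
  have hD : 0 < ‖w.1 - w.2‖ ^ N := pow_pos (norm_pos_iff.2 (sub_ne_zero.2 hw)) _
  have h := oddExt_mul_posPart_le (hGg.scaled_nonneg hR) (hGg.scaled_mono hR) (a w.1) (a w.2)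
    (c w.1) (c w.2)
  set X := max (a w.1 - c w.1) 0 - max (a w.2 - c w.2) 0 with hX
  set A := a w.1 - a w.2 with hA
  set R := ‖w.1 - w.2‖ ^ s with hRdef
  set D := ‖w.1 - w.2‖ ^ N with hDdef
  have hpair : pairing s g (incr c) (incr fun x => max (a x - c x) 0) w
      = (oddExt (fun t => g (t / R)) (c w.1 - c w.2) * X) / R / D := by
    rw [div_div, mul_comm R D, hRdef, hDdef, ← norm_rpow_add hw, mul_div_assoc]
    rfl
  have hmA : modDensity s G (incr a) w = G (|A| / R) / D := rfl
  have hmX : modDensity s G (incr fun x => max (a x - c x) 0) w = G (|X| / R) / D := rfl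
  rw [hpair, hmA, hmX]
  have h1 := hGg.mul_g_le (|A| / R) (by positivity)
  have hX0 : 0 ≤ |X| / R / 2 := by positivity
  have h2 := hGg.G_le (|X| / R / 2) hX0
  have h3 := hGg.G_mul_le 2 (|X| / R / 2) one_le_two hX0
  rw [mul_div_cancel₀ _ (two_ne_zero' ℝ)] at h3
  have h4 := hGg.g_nonneg _ hX0
  have h5 : (oddExt (fun t => g (t / R)) (c w.1 - c w.2) * X) / R
      ≤ 4 * (g (|A| / R) * (|A| / R)) - g (|X| / R / 2) * (|X| / R) := by
    refine (div_le_div_of_nonneg_right h hR.le).trans (le_of_eq ?_)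
    rw [div_right_comm |X| 2 R]
    field_simp
  have h6 : g (|X| / R / 2) * (|X| / R / 2) ≤ g (|X| / R / 2) * (|X| / R) :=
    mul_le_mul_of_nonneg_left (by have : 0 ≤ |X| / R := by positivity
                                  linarith) h4
  have h7 : G (|X| / R / 2) ≤ 4 * (p * G (|A| / R))
      - (oddExt (fun t => g (t / R)) (c w.1 - c w.2) * X) / R := by linarith
  have h8 : (0 : ℝ) ≤ 2 ^ p := by positivity
  have h9 := h3.trans (mul_le_mul_of_nonneg_left h7 h8)
  refine (div_le_div_of_nonneg_right h9 hD.le).trans (le_of_eq ?_)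
  ring

lemma sourceIntegrand_nonneg {φ : E N → ℝ} {x : E N} (hf : 0 ≤ f x) (hk : 0 < k x)
    (hu : 0 ≤ u x) (hφ : 0 ≤ φ x) : 0 ≤ sourceIntegrand α β f k u φ x := by
  unfold sourceIntegrand
  positivity

namespace ProblemData

lemma ae_source_nonneg (D : ProblemData Ω s α β G g q p f k) (hu : PositiveInside Ω s G u)
    {φ : E N → ℝ} (hφ : ∀ᵐ x ∂(volume : Measure (E N)), 0 ≤ φ x) :
    ∀ᵐ x ∂(volume.restrict Ω), 0 ≤ sourceIntegrand α β f k u φ x := by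
  filter_upwards [D.f_nonneg, D.k_pos, ae_restrict_of_ae hu.nonneg, ae_restrict_of_ae hφ]
    with x h1 h2 h3 h4
  exact sourceIntegrand_nonneg h1 h2 h3 h4

lemma lintegral_source (D : ProblemData Ω s α β G g q p f k) (hu : PositiveInside Ω s G u)
    (hadm : IsAdmissible s α β G g Ω f k u) {φ : E N → ℝ} (hφ : IsTest s G Ω φ) :
    ∫⁻ x in Ω, ENNReal.ofReal (sourceIntegrand α β f k u φ x)
      = ENNReal.ofReal (∫ x in Ω, sourceIntegrand α β f k u φ x) :=
  (ofReal_integral_eq_lintegral_ofReal (hadm.integrable_source φ hφ)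
    (D.ae_source_nonneg hu hφ.nonneg)).symm

variable [Nonempty (Fin N)]

/-- The source of a super-solution `u` is integrable against `(u - ε)⁺`, although this function
need not be an admissible test function. -/
lemma lintegral_source_posLevel_lt_top (D : ProblemData Ω s α β G g q p f k)
    (hu : IsWeakSuperSolution s α β G g Ω f k u) {ε : ℝ} (hε : 0 < ε) :
    ∫⁻ x in Ω, ENNReal.ofReal (sourceIntegrand α β f k u (posLevel ε u) x) < ⊤ := by
  have hGg := D.growth
  have hup := hu.1.positiveInside D.domain
  have hz := hu.1.zeroTrace_posLevel D.domain hGg hε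
  have hlev := hu.1.finitePair_levelPair D.domain hGg hε
  have hcut := hz.finitePair_cutBound D.domain D.s_pos D.s_lt_one hGg
  set B : E N × E N → ℝ := fun w =>
    p * modDensity s G (levelPair ε u) w + p * modDensity s G (cutBound Ω (posLevel ε u)) w
  have hB : Integrable B ((volume : Measure (E N)).prod volume) :=
    ((hlev.integrable hGg).const_mul p).add ((hcut.integrable hGg).const_mul p)
  have htest := fun n => hz.isTest_cutTrunc D.domain D.s_pos D.s_lt_one hGg n
  have hbound : ∀ n, ∫⁻ x in Ω, ENNReal.ofReal
      (sourceIntegrand α β f k u (cutTrunc Ω (posLevel ε u) n) x)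
      ≤ ENNReal.ofReal (∫ w, B w ∂((volume : Measure (E N)).prod volume)) := by
    intro n
    rw [D.lintegral_source hup hu.1 (htest n)]
    refine ENNReal.ofReal_le_ofReal ((hu.2 _ (htest n)).trans ?_)
    refine integral_mono_ae (hu.1.integrable_energy _ (htest n)) hB ?_
    filter_upwards [ae_fst_ne_snd, hz.abs_incr_cutTrunc_le D.domain] with w hw hw'
    have e : energyIntegrand s g u (cutTrunc Ω (posLevel ε u) n) w
        = pairing s g (levelPair ε u) (incr (cutTrunc Ω (posLevel ε u) n)) w := by
      rw [energyIntegrand_eq_pairing]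
      unfold pairing levelPair
      split_ifs with h
      · rfl
      · have h' := max_lt_iff.1 (not_le.1 h)
        have h1 : ∀ x, u x < ε → cutTrunc Ω (posLevel ε u) n x = 0 := by
          intro x hx
          rw [cutTrunc, posLevel_eq_zero hx.le, min_eq_left (Nat.cast_nonneg n), zero_mul]
        have h2 : incr (cutTrunc Ω (posLevel ε u) n) w = 0 := by
          rw [incr, h1 _ h'.1, h1 _ h'.2, sub_zero]
        rw [h2]; simp
    rw [e]
    exact (le_abs_self _).trans (abs_pairing_le hGg D.p_nonneg hw le_rfl (hw' n))
  refine lt_of_le_of_lt (lintegral_le_of_tendsto_of_le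
    (fun n => (hu.1.integrable_source _ (htest n)).1.aemeasurable.ennreal_ofReal) ?_ hbound
    tendsto_const_nhds) ENNReal.ofReal_lt_top
  filter_upwards [ae_restrict_of_ae (hz.eventually_cutTrunc_eq D.domain)] with x hx
  refine tendsto_const_nhds.congr' (hx.mono fun n hn => ?_)
  simp only [sourceIntegrand, hn]

/-- Caccioppoli estimate: the difference of a function with finite energy and a super-solution
has, where it is positive, finite energy up to the boundary. -/
lemma finitePair_posPart_sub (D : ProblemData Ω s α β G g q p f k)
    (hv : IsWeakSuperSolution s α β G g Ω f k v) (hz : ZeroTrace Ω s G z) :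
    FinitePair s G (incr fun x => max (z x - v x) 0) := by
  have hGg := D.growth
  have hvp := hv.1.positiveInside D.domain
  have hcut := hz.finitePair_cutBound D.domain D.s_pos D.s_lt_one hGg
  have htest := fun n => hz.isTest_cutDiff hvp D.domain D.s_pos D.s_lt_one hGg n
  have hm : AEMeasurable (fun x => max (z x - v x) 0) volume :=
    (hz.aemeasurable.sub hvp.aemeasurable).max aemeasurable_const
  refine ⟨aemeasurable_incr hm, ?_⟩
  set I := ∫ w, modDensity s G (cutBound Ω z) w ∂((volume : Measure (E N)).prod volume) with hI
  refine lt_of_le_of_lt (lintegral_le_of_tendsto_of_le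
    (F := fun n w => ENNReal.ofReal (modDensity s G (incr (cutDiff Ω z v n)) w))
    (c := fun _ => ENNReal.ofReal (2 ^ p * (4 * p * I)))
    (fun n => (hGg.aemeasurable_modDensity (aemeasurable_incr
      (aemeasurable_cutDiff hz.aemeasurable hvp.aemeasurable n))).ennreal_ofReal) ?_ ?_
    tendsto_const_nhds) ENNReal.ofReal_lt_top
  · filter_upwards [ae_pair (hz.eventually_cutTrunc_eq D.domain)] with w hw
    refine tendsto_const_nhds.congr' ((hw.1.and hw.2).mono fun n hn => ?_)
    simp only [modDensity, incr, cutDiff, hn.1, hn.2]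
  · intro n
    have hfin := hz.finitePair_cutDiff hvp D.domain D.s_pos D.s_lt_one hGg n
    have hfinT := hz.finitePair_cutTrunc D.domain D.s_pos D.s_lt_one hGg n
    rw [← ofReal_integral_eq_lintegral_ofReal (hfin.integrable hGg)
      (Eventually.of_forall fun w => hGg.modDensity_nonneg _ w)]
    refine ENNReal.ofReal_le_ofReal ?_
    have hen := hv.1.integrable_energy _ (htest n)
    have h1 : ∫ w, modDensity s G (incr (cutDiff Ω z v n)) w
          ∂((volume : Measure (E N)).prod volume)
        ≤ ∫ w, 2 ^ p * (4 * p * modDensity s G (incr (cutTrunc Ω z n)) w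
          - energyIntegrand s g v (cutDiff Ω z v n) w)
          ∂((volume : Measure (E N)).prod volume) := by
      refine integral_mono_ae (hfin.integrable hGg)
        ((((hfinT.integrable hGg).const_mul (4 * p)).sub hen).const_mul _) ?_
      filter_upwards [ae_fst_ne_snd] with w hw
      exact hGg.modDensity_posPart_le (cutTrunc Ω z n) v hw
    rw [integral_const_mul, integral_sub ((hfinT.integrable hGg).const_mul (4 * p)) hen,
      integral_const_mul] at h1
    have h2 : 0 ≤ ∫ w, energyIntegrand s g v (cutDiff Ω z v n) w
        ∂((volume : Measure (E N)).prod volume) :=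
      (integral_nonneg_of_ae (D.ae_source_nonneg hvp (htest n).nonneg)).trans (hv.2 _ (htest n))
    have h3 : ∫ w, modDensity s G (incr (cutTrunc Ω z n)) w
        ∂((volume : Measure (E N)).prod volume) ≤ I := by
      refine integral_mono_ae (hfinT.integrable hGg) (hcut.integrable hGg) ?_
      filter_upwards [hz.abs_incr_cutTrunc_le D.domain] with w hw
      have := hGg.modDensity_le (s := s) zero_le_one ((hw n).trans_eq (one_mul _).symm)
      rwa [max_self, Real.one_rpow, one_mul] at this
    refine h1.trans (mul_le_mul_of_nonneg_left ?_ (by positivity))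
    have h4 := mul_le_mul_of_nonneg_left h3 (by linarith [D.p_nonneg] : 0 ≤ 4 * p)
    linarith

/-- A bound, uniform in `n`, of the increments of the Picone test functions. -/
lemma abs_incr_cutFst_le (D : ProblemData Ω s α β G g q p f k) (hz : ZeroTrace Ω s G z)
    (hv : PositiveInside Ω s G v) :
    ∀ᵐ w ∂((volume : Measure (E N)).prod volume), ∀ n, |incr (cutFst q Ω z v n) w|
      ≤ |(3 * (1 + 2 * q)) * (|cutBound Ω z w| + |incr (fun x => max (z x - v x) 0) w|)| := by
  have hq := D.growth.one_lt
  filter_upwards [hz.abs_incr_cutFst_le hq hv, hz.abs_incr_cutTrunc_le D.domain] with w h1 h2 n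
  have hq0 : 0 < q := by linarith
  rw [abs_of_nonneg (a := 3 * (1 + 2 * q) * _) (by positivity)]
  refine (h1 n).trans ?_
  have hz' : |incr z w| ≤ |cutBound Ω z w| := by
    rw [cutBound, abs_of_nonneg (by positivity : 0 ≤ |incr z w| + _)]
    exact le_add_of_nonneg_right (abs_nonneg _)
  -- the positive part of the difference loses at most `z - z_n`
  have hpos : ∀ x, cutDiff Ω z v n x = max (max (z x - v x) 0 - (z x - cutTrunc Ω z n x)) 0 := by
    intro x
    have h3 := cutTrunc_le (Ω := Ω) hz.nonneg n x
    rw [cutDiff]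
    rcases le_total (z x) (v x) with h | h
    · rw [max_eq_right (sub_nonpos.2 h), max_eq_right (by linarith), max_eq_right (by linarith)]
    · rw [max_eq_left (sub_nonneg.2 h)]; congr 1; ring
  have h4 : |incr (cutDiff Ω z v n) w| ≤ |incr (fun x => max (z x - v x) 0) w|
      + (|incr z w| + |incr (cutTrunc Ω z n) w|) := by
    simp only [incr]
    rw [hpos, hpos]
    refine (abs_max_sub_max_le_abs _ _ _).trans ?_
    have e : max (z w.1 - v w.1) 0 - (z w.1 - cutTrunc Ω z n w.1)
        - (max (z w.2 - v w.2) 0 - (z w.2 - cutTrunc Ω z n w.2))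
        = (max (z w.1 - v w.1) 0 - max (z w.2 - v w.2) 0)
          - ((z w.1 - z w.2) - (cutTrunc Ω z n w.1 - cutTrunc Ω z n w.2)) := by ring
    rw [e]
    exact (abs_sub _ _).trans (add_le_add le_rfl (abs_sub _ _))
  have h5 := h2 n
  have h6 := abs_nonneg (incr (fun x => max (z x - v x) 0) w)
  have h7 : |incr (cutTrunc Ω z n) w| + |incr (cutDiff Ω z v n) w|
      ≤ 3 * (|cutBound Ω z w| + |incr (fun x => max (z x - v x) 0) w|) := by linarith
  have h8 := mul_le_mul_of_nonneg_left h7 (by linarith : 0 ≤ 1 + 2 * q)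
  linarith

/-- The comparison of the sources of a sub- and super-solution tested with the Picone test
functions of `(u - ε)⁺` and `v`. -/
lemma lintegral_source_le (D : ProblemData Ω s α β G g q p f k)
    (hu : IsWeakSubSolution s α β G g Ω f k u) (hv : IsWeakSuperSolution s α β G g Ω f k v)
    {ε : ℝ} (hε : 0 < ε) :
    ∫⁻ x in Ω, ENNReal.ofReal
        (sourceIntegrand α β f k v (fun x => piconeSnd q (posLevel ε u x) (v x)) x)
      ≤ ∫⁻ x in Ω, ENNReal.ofReal
        (sourceIntegrand α β f k u (fun x => piconeFst q (posLevel ε u x) (v x)) x) := by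
  have hGg := D.growth
  have hq := hGg.one_lt
  have hup := hu.1.positiveInside D.domain
  have hvp := hv.1.positiveInside D.domain
  have hz := hu.1.zeroTrace_posLevel D.domain hGg hε
  set z := posLevel ε u with hzdef
  have hcut := hz.finitePair_cutBound D.domain D.s_pos D.s_lt_one hGg
  have hdiff := D.finitePair_posPart_sub hv hz
  have htF := fun n => hz.isTest_cutFst hvp D.domain D.s_pos D.s_lt_one hGg n
  have htS := fun n => hz.isTest_cutSnd hvp D.domain D.s_pos D.s_lt_one hGg n
  set Q : E N × E N → ℝ := fun w =>
    (3 * (1 + 2 * q)) * (|cutBound Ω z w| + |incr (fun x => max (z x - v x) 0) w|) with hQdef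
  have hQ : FinitePair s G Q := by
    have h1 := hcut.abs_add_abs hGg hdiff
    refine h1.of_le_const_mul hGg (C := 3 * (1 + 2 * q)) (by linarith)
      (h1.aemeasurable.const_mul _) (Eventually.of_forall fun w => ?_)
    rw [hQdef, abs_mul, abs_of_nonneg (by linarith : 0 ≤ 3 * (1 + 2 * q))]
  set B : E N × E N → ℝ := fun w =>
    p * modDensity s G (cutBound Ω z) w + p * modDensity s G Q w
  have hB : Integrable B ((volume : Measure (E N)).prod volume) :=
    ((hcut.integrable hGg).const_mul p).add ((hQ.integrable hGg).const_mul p)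
  have hφQ := D.abs_incr_cutFst_le hz hvp
  have hφm : ∀ n, AEMeasurable (incr (cutFst q Ω z v n))
      ((volume : Measure (E N)).prod volume) := fun n =>
    aemeasurable_incr (aemeasurable_piconeFst (aemeasurable_cutTrunc hz.aemeasurable n)
      hvp.aemeasurable)
  have hzcut : ∀ w, |incr z w| ≤ |cutBound Ω z w| := by
    intro w
    rw [cutBound, abs_of_nonneg (by positivity : 0 ≤ |incr z w| + _)]
    exact le_add_of_nonneg_right (abs_nonneg _)
  -- both truncated energies converge to the same limit
  have hmA : ∀ n, AEStronglyMeasurable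
      (pairing s g (incr (cutTrunc Ω z n)) (incr (cutFst q Ω z v n)))
      ((volume : Measure (E N)).prod volume) := fun n =>
    (pairing_aemeasurable hGg (aemeasurable_incr (aemeasurable_cutTrunc hz.aemeasurable n))
      (hφm n)).aestronglyMeasurable
  have hmB : ∀ n, AEStronglyMeasurable (pairing s g (incr z) (incr (cutFst q Ω z v n)))
      ((volume : Measure (E N)).prod volume) := fun n =>
    (pairing_aemeasurable hGg (aemeasurable_incr hz.aemeasurable) (hφm n)).aestronglyMeasurable
  have hbA : ∀ n, ∀ᵐ w ∂((volume : Measure (E N)).prod volume),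
      ‖pairing s g (incr (cutTrunc Ω z n)) (incr (cutFst q Ω z v n)) w‖ ≤ B w := by
    intro n
    filter_upwards [ae_fst_ne_snd, hφQ, hz.abs_incr_cutTrunc_le D.domain] with w h1 h2 h3
    exact abs_pairing_le hGg D.p_nonneg h1 (h3 n) (h2 n)
  have hbB : ∀ n, ∀ᵐ w ∂((volume : Measure (E N)).prod volume),
      ‖pairing s g (incr z) (incr (cutFst q Ω z v n)) w‖ ≤ B w := by
    intro n
    filter_upwards [ae_fst_ne_snd, hφQ] with w h1 h2
    exact abs_pairing_le hGg D.p_nonneg h1 (hzcut w) (h2 n)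
  have hlimA := tendsto_integral_of_dominated_convergence
    (f := pairing s g (incr z) (incr fun x => piconeFst q (z x) (v x))) B hmA hB hbA (by
      filter_upwards [ae_pair (hz.eventually_cutTrunc_eq D.domain)] with w hw
      refine tendsto_const_nhds.congr' ((hw.1.and hw.2).mono fun n hn => ?_)
      simp only [pairing, incr, cutFst, hn.1, hn.2])
  have hlimB := tendsto_integral_of_dominated_convergence
    (f := pairing s g (incr z) (incr fun x => piconeFst q (z x) (v x))) B hmB hB hbB (by
      filter_upwards [ae_pair (hz.eventually_cutTrunc_eq D.domain)] with w hw
      refine tendsto_const_nhds.congr' ((hw.1.and hw.2).mono fun n hn => ?_)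
      simp only [pairing, incr, cutFst, hn.1, hn.2])
  have hlim := hlimA.sub hlimB
  rw [sub_self] at hlim
  set δ : ℕ → ℝ := fun n =>
    (∫ w, pairing s g (incr (cutTrunc Ω z n)) (incr (cutFst q Ω z v n)) w
      ∂((volume : Measure (E N)).prod volume))
    - ∫ w, pairing s g (incr z) (incr (cutFst q Ω z v n)) w
      ∂((volume : Measure (E N)).prod volume) with hδ
  have hstep : ∀ n, ∫ x in Ω, sourceIntegrand α β f k v (cutSnd q Ω z v n) x
      ≤ (∫ x in Ω, sourceIntegrand α β f k u (cutFst q Ω z v n) x) + δ n := by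
    intro n
    have h1 : (∫ w, energyIntegrand s g v (cutSnd q Ω z v n) w
          ∂((volume : Measure (E N)).prod volume))
        ≤ ∫ w, pairing s g (incr (cutTrunc Ω z n)) (incr (cutFst q Ω z v n)) w
          ∂((volume : Measure (E N)).prod volume) := by
      refine integral_mono_ae (hv.1.integrable_energy _ (htS n)) (hB.mono' (hmA n) (hbA n)) ?_
      filter_upwards [ae_fst_ne_snd, ae_pair hvp.nonneg, ae_pair hvp.pos,
        ae_pair hz.zero_outside] with w hw hv0 hv1 hz0
      have hR := norm_rpow_pos (s := s) hw
      rw [energyIntegrand_eq_pairing]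
      have hcz : ∀ x, (x ∈ Ω → 0 < v x) → v x = 0 → cutTrunc Ω z n x = 0 := by
        intro x h1 h2
        by_cases hx : x ∈ Ω
        · exact absurd h2 (h1 hx).ne'
        · exact cutTrunc_eq_zero fun h => hx (coreSet_subset n h)
      exact pairing_le_pairing (picone_le hq (hGg.scaled_nonneg hR) (hGg.scaled_mono hR)
        (hGg.scaled_ratio hR) (cutTrunc_nonneg hz.nonneg n _) (cutTrunc_nonneg hz.nonneg n _)
        hv0.1 hv0.2 (hcz _ hv1.1) (hcz _ hv1.2))
    have h2 : (∫ w, pairing s g (incr z) (incr (cutFst q Ω z v n)) w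
          ∂((volume : Measure (E N)).prod volume))
        ≤ ∫ w, energyIntegrand s g u (cutFst q Ω z v n) w
          ∂((volume : Measure (E N)).prod volume) := by
      refine integral_mono_ae (hB.mono' (hmB n) (hbB n)) (hu.1.integrable_energy _ (htF n)) ?_
      filter_upwards [ae_fst_ne_snd] with w hw
      have hR := norm_rpow_pos (s := s) hw
      rw [energyIntegrand_eq_pairing]
      have hc0 : ∀ x, z x = 0 → cutFst q Ω z v n x = 0 := by
        intro x hx
        rw [cutFst, cutTrunc, hx, min_eq_left (Nat.cast_nonneg n), zero_mul,
          piconeFst_zero_left hq]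
      exact pairing_le_pairing (oddExt_trunc_mul_le (hGg.scaled_nonneg hR) (hGg.scaled_mono hR)
        (piconeFst_nonneg (cutTrunc_nonneg hz.nonneg n _))
        (piconeFst_nonneg (cutTrunc_nonneg hz.nonneg n _)) (hc0 _) (hc0 _))
    have h3 := hv.2 _ (htS n)
    have h4 := hu.2 _ (htF n)
    rw [hδ]
    linarith
  have hlimE : Tendsto (fun n => (∫⁻ x in Ω, ENNReal.ofReal
        (sourceIntegrand α β f k u (fun x => piconeFst q (z x) (v x)) x)) + ENNReal.ofReal (δ n))
      atTop (𝓝 ((∫⁻ x in Ω, ENNReal.ofReal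
        (sourceIntegrand α β f k u (fun x => piconeFst q (z x) (v x)) x)) + 0)) := by
    refine Tendsto.add tendsto_const_nhds ?_
    rw [← ENNReal.ofReal_zero]
    exact ENNReal.tendsto_ofReal hlim
  rw [add_zero] at hlimE
  refine lintegral_le_of_tendsto_of_le
    (F := fun n x => ENNReal.ofReal (sourceIntegrand α β f k v (cutSnd q Ω z v n) x))
    (fun n => (hv.1.integrable_source _ (htS n)).1.aemeasurable.ennreal_ofReal) ?_ ?_ hlimE
  · filter_upwards [ae_restrict_of_ae (hz.eventually_cutTrunc_eq D.domain)] with x hx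
    refine tendsto_const_nhds.congr' (hx.mono fun n hn => ?_)
    simp only [sourceIntegrand, cutSnd, hn]
  · intro n
    rw [D.lintegral_source hvp hv.1 (htS n)]
    refine (ENNReal.ofReal_le_ofReal (hstep n)).trans
      (ENNReal.ofReal_add_le.trans (add_le_add ?_ le_rfl))
    rw [← D.lintegral_source hup hu.1 (htF n)]
    refine lintegral_mono_ae ?_
    filter_upwards [D.f_nonneg, D.k_pos, ae_restrict_of_ae hup.nonneg,
      ae_restrict_of_ae hvp.nonneg] with x h1 h2 h3 h4
    refine ENNReal.ofReal_le_ofReal (mul_le_mul_of_nonneg_left ?_ (by positivity))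
    exact piconeFst_mono hq (cutTrunc_nonneg hz.nonneg n x) h4 (cutTrunc_le hz.nonneg n x)

end ProblemData

end

/-! ### Comparison and uniqueness -/

section

variable {N : ℕ} {Ω : Set (E N)} {s α β : ℝ} {G g : ℝ → ℝ} {q p : ℝ} {f k u v z : E N → ℝ}

lemma posLevel_le {ε : ℝ} (hε : 0 ≤ ε) {x : E N} (hu : 0 ≤ u x) : posLevel ε u x ≤ u x :=
  max_le (by linarith) hu

lemma ofReal_source {φ : E N → ℝ} {x : E N} (hf : 0 ≤ f x) (hk : 0 < k x) (hu : 0 ≤ u x)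
    (hφ : 0 ≤ φ x) : ENNReal.ofReal (sourceIntegrand α β f k u φ x)
      = ENNReal.ofReal (f x * u x ^ (-α) * φ x) + ENNReal.ofReal (k x * u x ^ β * φ x) := by
  rw [← ENNReal.ofReal_add (by positivity) (by positivity), sourceIntegrand, add_mul]

/-- The powers `u^β / u^{q-1}` are decreasing in `u`, strictly so since `β < q - 1`. -/
lemma rpow_mul_piconeFst_lt {a b : ℝ} (hβ : β < q - 1) (hβ0 : 0 < β) (hb : 0 < b)
    (hab : b < a) : a ^ β * piconeFst q a b < b ^ β * piconeSnd q a b := by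
  have ha : 0 < a := hb.trans hab
  have hpow : b ^ q < a ^ q := Real.rpow_lt_rpow hb.le hab (by linarith)
  rw [piconeFst, piconeSnd, max_eq_left (sub_pos.2 hpow).le]
  have h1 : a ^ β * a ^ (1 - q) < b ^ β * b ^ (1 - q) := by
    rw [← Real.rpow_add ha, ← Real.rpow_add hb]
    exact Real.rpow_lt_rpow_of_neg hb hab (by linarith)
  have h2 := mul_lt_mul_of_pos_left h1 (sub_pos.2 hpow)
  linarith

namespace ProblemData

variable [Nonempty (Fin N)]

/-- The singular terms may be dropped from the comparison of the sources. -/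
lemma lintegral_k_le (D : ProblemData Ω s α β G g q p f k)
    (hu : IsWeakSolution s α β G g Ω f k u) (hv : IsWeakSuperSolution s α β G g Ω f k v)
    {ε : ℝ} (hε : 0 < ε) :
    ∫⁻ x in Ω, ENNReal.ofReal (k x * v x ^ β * piconeSnd q (posLevel ε u x) (v x))
      ≤ ∫⁻ x in Ω, ENNReal.ofReal (k x * u x ^ β * piconeFst q (posLevel ε u x) (v x)) := by
  have hq := D.growth.one_lt
  have hup := hu.1.1.positiveInside D.domain
  have hvp := hv.1.positiveInside D.domain
  have hz := hu.1.1.zeroTrace_posLevel D.domain D.growth hε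
  have hmain := D.lintegral_source_le hu.1 hv hε
  have hfin := D.lintegral_source_posLevel_lt_top hu.2 hε
  have hum := hup.aemeasurable.restrict (s := Ω)
  have hvm := hvp.aemeasurable.restrict (s := Ω)
  have hzm := hz.aemeasurable.restrict (s := Ω)
  have ae := (ae_restrict_mem (μ := (volume : Measure (E N))) D.domain.isOpen.measurableSet).and
    ((ae_restrict_of_ae hup.pos).and (ae_restrict_of_ae hvp.pos))
  have e1 : ∫⁻ x in Ω, ENNReal.ofReal
        (sourceIntegrand α β f k v (fun x => piconeSnd q (posLevel ε u x) (v x)) x)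
      = (∫⁻ x in Ω, ENNReal.ofReal (f x * v x ^ (-α) * piconeSnd q (posLevel ε u x) (v x)))
        + ∫⁻ x in Ω, ENNReal.ofReal (k x * v x ^ β * piconeSnd q (posLevel ε u x) (v x)) := by
    have hm : AEMeasurable (fun x => ENNReal.ofReal
        (f x * v x ^ (-α) * piconeSnd q (posLevel ε u x) (v x))) (volume.restrict Ω) :=
      ((D.f_aemeasurable.mul (hvm.pow_const _)).mul
        (aemeasurable_piconeSnd hzm hvm)).ennreal_ofReal
    rw [← lintegral_add_left' hm]
    refine lintegral_congr_ae ?_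
    filter_upwards [D.f_nonneg, D.k_pos, ae] with x h1 h2 h3
    exact ofReal_source h1 h2 (h3.2.2 h3.1).le (piconeSnd_nonneg (h3.2.2 h3.1).le)
  have e2 : ∫⁻ x in Ω, ENNReal.ofReal
        (sourceIntegrand α β f k u (fun x => piconeFst q (posLevel ε u x) (v x)) x)
      = (∫⁻ x in Ω, ENNReal.ofReal (f x * u x ^ (-α) * piconeFst q (posLevel ε u x) (v x)))
        + ∫⁻ x in Ω, ENNReal.ofReal (k x * u x ^ β * piconeFst q (posLevel ε u x) (v x)) := by
    have hm : AEMeasurable (fun x => ENNReal.ofReal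
        (f x * u x ^ (-α) * piconeFst q (posLevel ε u x) (v x))) (volume.restrict Ω) :=
      ((D.f_aemeasurable.mul (hum.pow_const _)).mul
        (aemeasurable_piconeFst hzm hvm)).ennreal_ofReal
    rw [← lintegral_add_left' hm]
    refine lintegral_congr_ae ?_
    filter_upwards [D.f_nonneg, D.k_pos, ae] with x h1 h2 h3
    exact ofReal_source h1 h2 (h3.2.1 h3.1).le (piconeFst_nonneg (hz.nonneg x))
  have hFle : ∫⁻ x in Ω, ENNReal.ofReal (f x * u x ^ (-α) * piconeFst q (posLevel ε u x) (v x))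
      ≤ ∫⁻ x in Ω, ENNReal.ofReal
        (f x * v x ^ (-α) * piconeSnd q (posLevel ε u x) (v x)) := by
    refine lintegral_mono_ae ?_
    filter_upwards [D.f_nonneg, ae] with x h1 h3
    have hvx := h3.2.2 h3.1
    have hux := h3.2.1 h3.1
    refine ENNReal.ofReal_le_ofReal ?_
    rcases le_total (posLevel ε u x) (v x) with h | h
    · rw [piconeFst_eq_zero hq (hz.nonneg x) h, piconeSnd_eq_zero hq (hz.nonneg x) h]; simp
    · have h4 : v x ≤ u x := h.trans (posLevel_le hε.le hux.le)
      have h5 : u x ^ (-α) ≤ v x ^ (-α) :=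
        Real.rpow_le_rpow_of_nonpos hvx h4 (by linarith [D.α_pos])
      exact mul_le_mul (mul_le_mul_of_nonneg_left h5 h1)
        (piconeFst_le_piconeSnd hq (hz.nonneg x) hvx) (piconeFst_nonneg (hz.nonneg x))
        (by positivity)
  have hFfin : ∫⁻ x in Ω, ENNReal.ofReal
      (f x * u x ^ (-α) * piconeFst q (posLevel ε u x) (v x)) < ⊤ := by
    refine lt_of_le_of_lt (lintegral_mono_ae ?_) hfin
    filter_upwards [D.f_nonneg, D.k_pos, ae] with x h1 h2 h3
    have hux := h3.2.1 h3.1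
    rw [ofReal_source h1 h2 hux.le (hz.nonneg x)]
    refine le_trans (ENNReal.ofReal_le_ofReal ?_) le_self_add
    exact mul_le_mul_of_nonneg_left (piconeFst_le_self hq (hz.nonneg x) (h3.2.2 h3.1).le)
      (by positivity)
  rw [e1, e2] at hmain
  exact ENNReal.le_of_add_le_add_left hFfin.ne ((add_le_add hFle le_rfl).trans hmain)

lemma lintegral_k_rpow_lt_top (D : ProblemData Ω s α β G g q p f k)
    (hu : IsWeakSuperSolution s α β G g Ω f k u) :
    ∫⁻ x in Ω, ENNReal.ofReal (k x * u x ^ β * u x) < ⊤ := by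
  have hup := hu.1.positiveInside D.domain
  have hfin := D.lintegral_source_posLevel_lt_top hu one_pos
  have hkfin : ∫⁻ x in Ω, ENNReal.ofReal (k x) < ⊤ :=
    (hasFiniteIntegral_iff_ofReal (D.k_pos.mono fun _ h => h.le)).1 D.k_integrable.2
  have hkm : AEMeasurable (fun x => ENNReal.ofReal (2 ^ β * 2 * k x)) (volume.restrict Ω) :=
    (D.k_integrable.1.aemeasurable.const_mul _).ennreal_ofReal
  calc ∫⁻ x in Ω, ENNReal.ofReal (k x * u x ^ β * u x)
      ≤ ∫⁻ x in Ω, (ENNReal.ofReal (2 ^ β * 2 * k x)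
          + 2 * ENNReal.ofReal (sourceIntegrand α β f k u (posLevel 1 u) x)) := by
        refine lintegral_mono_ae ?_
        filter_upwards [D.f_nonneg, D.k_pos, ae_restrict_of_ae hup.nonneg] with x h1 h2 h3
        rcases le_or_gt (u x) 2 with h | h
        · refine le_trans (ENNReal.ofReal_le_ofReal ?_) le_self_add
          have h4 : u x ^ β ≤ 2 ^ β := Real.rpow_le_rpow h3 h D.β_pos.le
          have h5 : u x ^ β * u x ≤ 2 ^ β * 2 := mul_le_mul h4 h h3 (by positivity)
          have h6 := mul_le_mul_of_nonneg_left h5 h2.le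
          linarith
        · refine le_trans ?_ le_add_self
          rw [ofReal_source h1 h2 h3 (le_max_right _ _), mul_add]
          refine le_trans ?_ le_add_self
          rw [← ENNReal.ofReal_ofNat, ← ENNReal.ofReal_mul zero_le_two]
          refine ENNReal.ofReal_le_ofReal ?_
          have h4 : u x ≤ 2 * posLevel 1 u x := by
            have := le_max_left (u x - 1) 0
            unfold posLevel
            linarith
          have h5 := mul_le_mul_of_nonneg_left h4 (by positivity : 0 ≤ k x * u x ^ β)
          linarith
    _ = (∫⁻ x in Ω, ENNReal.ofReal (2 ^ β * 2 * k x))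
          + 2 * ∫⁻ x in Ω, ENNReal.ofReal (sourceIntegrand α β f k u (posLevel 1 u) x) := by
        rw [lintegral_add_left' hkm, lintegral_const_mul' _ _ ENNReal.ofNat_ne_top]
    _ < ⊤ := by
        refine ENNReal.add_lt_top.2 ⟨?_, ENNReal.mul_lt_top ENNReal.ofNat_lt_top hfin⟩
        have : ∀ x, ENNReal.ofReal (2 ^ β * 2 * k x)
            = ENNReal.ofReal (2 ^ β * 2) * ENNReal.ofReal (k x) := fun x =>
          ENNReal.ofReal_mul (by positivity)
        simp_rw [this]
        rw [lintegral_const_mul' _ _ ENNReal.ofReal_ne_top]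
        exact ENNReal.mul_lt_top ENNReal.ofReal_lt_top hkfin

/-- A solution lies below every super-solution. -/
lemma ae_le (D : ProblemData Ω s α β G g q p f k)
    (hu : IsWeakSolution s α β G g Ω f k u) (hv : IsWeakSuperSolution s α β G g Ω f k v) :
    ∀ᵐ x ∂(volume.restrict Ω), u x ≤ v x := by
  have hq := D.growth.one_lt
  have hup := hu.1.1.positiveInside D.domain
  have hvp := hv.1.positiveInside D.domain
  have hum := hup.aemeasurable.restrict (s := Ω)
  have hvm := hvp.aemeasurable.restrict (s := Ω)
  have hkm := D.k_integrable.1.aemeasurable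
  have ae := (ae_restrict_mem (μ := (volume : Measure (E N))) D.domain.isOpen.measurableSet).and
    ((ae_restrict_of_ae hup.pos).and (ae_restrict_of_ae hvp.pos))
  have hle : ∫⁻ x in Ω, ENNReal.ofReal (k x * v x ^ β * piconeSnd q (u x) (v x))
      ≤ ∫⁻ x in Ω, ENNReal.ofReal (k x * u x ^ β * piconeFst q (u x) (v x)) := by
    have hε : ∀ n : ℕ, (0 : ℝ) < 1 / ((n : ℝ) + 1) := fun n => by positivity
    refine lintegral_le_of_tendsto_of_le
      (F := fun n x => ENNReal.ofReal
        (k x * v x ^ β * piconeSnd q (posLevel (1 / ((n : ℝ) + 1)) u x) (v x)))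
      (fun n => ((hkm.mul (hvm.pow_const _)).mul (aemeasurable_piconeSnd
        ((hum.sub_const _).max aemeasurable_const) hvm)).ennreal_ofReal) ?_ (fun n => ?_)
      tendsto_const_nhds
    · filter_upwards [ae_restrict_of_ae hup.nonneg] with x hx
      refine ENNReal.tendsto_ofReal (Tendsto.const_mul _ ?_)
      have h1 : Tendsto (fun n : ℕ => posLevel (1 / ((n : ℝ) + 1)) u x) atTop (𝓝 (u x)) := by
        have h2 : Tendsto (fun n : ℕ => max (u x - 1 / ((n : ℝ) + 1)) 0) atTop
            (𝓝 (max (u x - 0) 0)) :=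
          (tendsto_const_nhds.sub tendsto_one_div_add_atTop_nhds_zero_nat).max tendsto_const_nhds
        rwa [sub_zero, max_eq_left hx] at h2
      have h3 := (Real.continuous_rpow_const (by linarith : 0 ≤ q)).continuousAt.tendsto.comp h1
      exact ((h3.sub tendsto_const_nhds).max tendsto_const_nhds).mul_const _
    · refine (D.lintegral_k_le hu hv (hε n)).trans (lintegral_mono_ae ?_)
      filter_upwards [D.k_pos, ae] with x h1 h3
      have hux := h3.2.1 h3.1
      exact ENNReal.ofReal_le_ofReal (mul_le_mul_of_nonneg_left
        (piconeFst_mono hq (le_max_right _ _) (h3.2.2 h3.1).le (posLevel_le (hε n).le hux.le))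
        (by positivity))
  have hfin : ∫⁻ x in Ω, ENNReal.ofReal (k x * u x ^ β * piconeFst q (u x) (v x)) < ⊤ := by
    refine lt_of_le_of_lt (lintegral_mono_ae ?_) (D.lintegral_k_rpow_lt_top hu.2)
    filter_upwards [D.k_pos, ae] with x h1 h3
    have hux := h3.2.1 h3.1
    exact ENNReal.ofReal_le_ofReal (mul_le_mul_of_nonneg_left
      (piconeFst_le_self hq hux.le (h3.2.2 h3.1).le) (by positivity))
  have hae : ∀ᵐ x ∂(volume.restrict Ω),
      ENNReal.ofReal (k x * u x ^ β * piconeFst q (u x) (v x))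
        ≤ ENNReal.ofReal (k x * v x ^ β * piconeSnd q (u x) (v x)) := by
    filter_upwards [D.k_pos, ae] with x h1 h3
    have hux := h3.2.1 h3.1
    refine ENNReal.ofReal_le_ofReal ?_
    rcases le_or_gt (u x) (v x) with h | h
    · rw [piconeFst_eq_zero hq hux.le h, piconeSnd_eq_zero hq hux.le h]; simp
    · have := mul_le_mul_of_nonneg_left
        (rpow_mul_piconeFst_lt D.β_lt D.β_pos (h3.2.2 h3.1) h).le h1.le
      linarith
  have heq := ae_eq_of_ae_le_of_lintegral_le hae hfin.ne
    ((hkm.mul (hvm.pow_const _)).mul (aemeasurable_piconeSnd hum hvm)).ennreal_ofReal hle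
  filter_upwards [heq, D.k_pos, ae] with x hx h1 h3
  by_contra hcon
  have hux := h3.2.1 h3.1
  have hvx := h3.2.2 h3.1
  have h4 := mul_lt_mul_of_pos_left
    (rpow_mul_piconeFst_lt D.β_lt D.β_pos hvx (not_le.1 hcon)) h1
  have h5 : 0 ≤ k x * (u x ^ β * piconeFst q (u x) (v x)) := by
    have := piconeFst_nonneg (q := q) (c := v x) hux.le
    positivity
  have h6 := (ENNReal.ofReal_lt_ofReal_iff (h5.trans_lt h4)).2 h4
  rw [← mul_assoc, ← mul_assoc] at h6
  exact h6.ne hx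

end ProblemData

/-- On a bounded set, the Orlicz space of a complementary function consists of integrable
functions, by Young's inequality with the constant `1`. -/
lemma MemOrlicz.integrableOn_of_complementary {A : ℝ → ℝ} {U : Set (E N)} {w : E N → ℝ}
    (hU : Bornology.IsBounded U) (h : MemOrlicz (complementary A) U w) : IntegrableOn w U := by
  obtain ⟨hm, l, hl, hfin⟩ := h
  have hUt : volume U < ⊤ := hU.measure_lt_top
  refine ⟨hm.aestronglyMeasurable, ?_⟩
  rw [hasFiniteIntegral_iff_norm]
  have key : ∀ x, ENNReal.ofReal ‖w x‖ ≤ ENNReal.ofReal l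
      * (complementary A (|w x| / l) + ENNReal.ofReal |A 1|) := by
    intro x
    have h1 : ENNReal.ofReal (|w x| / l * 1 - A 1) ≤ complementary A (|w x| / l) :=
      le_iSup₂ (f := fun (τ : ℝ) (_ : 0 ≤ τ) => ENNReal.ofReal (|w x| / l * τ - A τ)) 1
        zero_le_one
    calc ENNReal.ofReal ‖w x‖ = ENNReal.ofReal l * ENNReal.ofReal (|w x| / l) := by
          rw [← ENNReal.ofReal_mul hl.le, Real.norm_eq_abs, mul_div_cancel₀ _ hl.ne']
      _ ≤ ENNReal.ofReal l * ENNReal.ofReal ((|w x| / l * 1 - A 1) + |A 1|) := by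
          refine mul_le_mul_right (ENNReal.ofReal_le_ofReal ?_) _
          linarith [le_abs_self (A 1)]
      _ ≤ _ := mul_le_mul_right (ENNReal.ofReal_add_le.trans (add_le_add h1 le_rfl)) _
  calc ∫⁻ x in U, ENNReal.ofReal ‖w x‖
      ≤ ∫⁻ x in U, ENNReal.ofReal l
        * (complementary A (|w x| / l) + ENNReal.ofReal |A 1|) := lintegral_mono key
    _ = ENNReal.ofReal l * ((∫⁻ x in U, complementary A (|w x| / l))
          + ENNReal.ofReal |A 1| * volume U) := by
        rw [lintegral_const_mul' _ _ ENNReal.ofReal_ne_top,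
          lintegral_add_right _ measurable_const, setLIntegral_const]
    _ < ⊤ := ENNReal.mul_lt_top ENNReal.ofReal_lt_top
        (ENNReal.add_lt_top.2 ⟨hfin, ENNReal.mul_lt_top ENNReal.ofReal_lt_top hUt⟩)

end

end FracGLaplace

open FracGLaplace in
theorem corollary1 {N : ℕ} (hN : 0 < N)
    -- a bounded domain with Lipschitz boundary
    (Ω : Set (E N)) (hΩ : IsBoundedLipschitzDomain Ω)
    (s : ℝ) (hs₀ : 0 < s) (hs₁ : s < 1)
    -- the N-function `G`, with derivative `g` of class `C¹` on `[0, ∞)`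
    (G g : ℝ → ℝ) (hG : IsNFunction G)
    (hg : ∀ t, 0 ≤ t → HasDerivWithinAt G (g t) (Set.Ici 0) t)
    (hgC1 : ContDiffOn ℝ 1 g (Set.Ici 0))
    (pm pp : ℝ) (h1 : LocallyAbsCont g) (h2 : DerivMonotone g) (h3 : ConjIntegrability N s G) (h4 : GrowthBounds g pm pp)
    -- the exponents
    (α β : ℝ) (hα : 0 < α) (hβ₀ : 0 < β) (hβ₁ : β < pm - 1)
    -- the data
    (f k : E N → ℝ)
    (hf_nonneg : ∀ᵐ x ∂(MeasureTheory.volume.restrict Ω), 0 ≤ f x)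
    (hf_ne : ¬ (f =ᵐ[MeasureTheory.volume.restrict Ω] 0))
    (hk_pos : ∀ᵐ x ∂(MeasureTheory.volume.restrict Ω), 0 < k x)
    (hk : MemOrlicz (complementary (fun t => sobolevConj N s G (t ^ (1 / (β + 1))))) Ω k)
    -- the integrability of `f`, according to the size of `α`
    (hA : (1 < α ∧ MeasureTheory.IntegrableOn f Ω) ∨
      (α = 1 ∧ MemOrlicz (complementary (sobolevConj N s G)) Ω f) ∨
      (α < 1 ∧
        MemOrlicz (complementary (fun t => sobolevConj N s G (t ^ (1 / (1 - α))))) Ω f))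
    -- any two weak solutions coincide
    (u v : E N → ℝ)
    (hu : IsWeakSolution s α β G g Ω f k u) (hv : IsWeakSolution s α β G g Ω f k v) :
    u =ᵐ[MeasureTheory.volume.restrict Ω] v := by
  have : Nonempty (Fin N) := Fin.pos_iff_nonempty.1 hN
  obtain ⟨hGg, hpp⟩ := GrowthPair.of_hypotheses hG hg hgC1 h4
  have hfm : AEMeasurable f (MeasureTheory.volume.restrict Ω) := by
    rcases hA with h | h | h
    · exact h.2.1.aemeasurable
    · exact h.2.1
    · exact h.2.1
  have D : ProblemData Ω s α β G g pm pp f k :=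
    ⟨hΩ, hs₀, hs₁, hGg, by linarith, hα, hβ₀, hβ₁, hfm, hf_nonneg,
      hk.integrableOn_of_complementary hΩ.isBounded, hk_pos⟩
  filter_upwards [D.ae_le hu hv.2, D.ae_le hv hu.2] with x h₁ h₂
  exact le_antisymm h₁ h₂
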